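/- Let $H$ be a finite-dimensional complex vector space with a real structure, $u\mapsto\bar u$ its conjugation, and let $d\ge 0$ be an integer. Let $(H,W,F)$ be a real mixed Hodge structure: $W$ is a finite increasing filtration defined over $\mathbb R$, $F$ is a finite decreasing filtration, and $F$ induces on each $\mathrm{Gr}^W_kH$ a pure Hodge structure of weight $k$. Let $N$ be a nilpotent endomorphism of $H$ defined over $\mathbb R$ with $NW_k\subset W_{k-2}$ and $NF^p\subset F^{p-1}$, such that $W=W(N,d)$ is the monodromy weight filtration of $N$ centered at $d$, i.e. $N^l:\mathrm{Gr}^W_{d+l}H\to\mathrm{Gr}^W_{d-l}H$ is an isomorphism for all $l\ge0$. Let $S$ be a nondegenerate bilinear form on $H$ defined over $\mathbb R$ with $S(v,u)=(-1)^dS(u,v)$, $S(u,Nv)+S(Nu,v)=0$ and $S(F^p,F^{d-p+1})=0$ for all $p$. The Weil operator $C$ is multiplication by $i^{p-q}$ on the $(p,q)$-component of a Hodge structure. For $l\ge0$ put $P_{d+l}=\ker(N^{l+1}:\mathrm{Gr}^W_{d+l}H\to\mathrm{Gr}^W_{d-l-2}H)$, and for $p+q=d+l$ let $(s_+^{p,q},s_-^{p,q})$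 be the signature of the Hermitian form $S(C\,\cdot,N^{l}\,\overline{\cdot})$ on the $(p,q)$-component of $P_{d+l}$. Write $n_+=\max\{n,0\}$, and for $p,k\in\mathbb Z$, with $l=p+k-d$, put $$\mathbf S_\pm^{p,k}=\sum_{r\ge(-l)_+}s_\pm^{p+r,k+r}.$$ 1. There is a refinement of $F$ to a decreasing filtration $H=\hat F^0\supset\hat F^1\supset\dots\supset\hat F^{\dim H}=0$ with $\dim\mathrm{Gr}^k_{\hat F}H=1$ for $0\le k<\dim H$ (each $F^p$ is one of the $\hat F^k$), such that for $\mathrm{Im}(z)$ sufficiently large the Hermitian form $i^dS(\cdot,\overline{\cdot})$ is nondegenerate on $\exp(zN)\hat F^k$ for all $k$. 2. For $\mathrm{Im}(z)$ sufficiently large, $\exp(zN)F$ is a pure Hodge structure of weight $d$ on $H$, and for every $p\in\mathbb Z$ the Hermitian form $S(C\,\cdot,\overline{\cdot})$ on $\exp(zN)F^p\cap\overline{\exp(zN)F^{d-p}}$ is nondegenerate with signature $\left(\sum_{k\in\mathbb Z}\mathbf S_+^{p,k},\ \sum_{k\in\mathbb Z}\mathbf S_-^{p,k}\right)$ (finite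 sums). If $F^0=H$ and $F^{d+1}=0$, this is $$\left(\sum_{k=0}^d\mathbf S_+^{p,k},\ \sum_{k=0}^d\mathbf S_-^{p,k}\right)=\left(\sum_{\substack{l\ge p-d\\ r\ge(-l)_+}}s_+^{p+r,\,d+l-p+r},\ \sum_{\substack{l\ge p-d\\ r\ge(-l)_+}}s_-^{p+r,\,d+l-p+r}\right).$$ In particular, say that $(H,W,F)$ is polarized by $N$ centered at $d$ if $N^{d+1}=0$ and, for all $l\ge0$, the Hodge structure on $P_{d+l}$ is polarized by $S(\cdot,N^l\,\cdot)$. This holds if and only if $N^{d+1}=0$ and $s_-^{p,d+l-p}=0$ for all $p$ and all $l\ge0$. If $(H,W,F)$ is polarized, or more generally if $s_-^{p,d+l-p}=0$ for all $p$ and all $l\ge0$, then $z\mapsto\exp(zN)F$ is a nilpotent orbit: $NF^p\subset F^{p-1}$ for all $p$, and for $\mathrm{Im}(z)$ sufficiently large $\exp(zN)F$ is a Hodge structure of weight $d$ polarized by $S$. -/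

import Mathlib

namespace LimitMHS

noncomputable section

/-! ### Signature of a Hermitian form on a subspace -/

section Signature

/-- `B` has no radical on the subspace `U`. -/
def NondegOn {V : Type*} [AddCommGroup V] [Module ℂ V] (B : V → V → ℂ)
    (U : Submodule ℂ V) : Prop :=
  ∀ u ∈ U, (∀ v ∈ U, B u v = 0) → u = 0

/-- First entry of the signature of the Hermitian form `B` on `U`: the largest dimension of a
subspace of `U` on which `B` is positive definite. -/
def posIndex {V : Type*} [AddCommGroup V] [Module ℂ V] (B : V → V → ℂ)
    (U : Submodule ℂ V) : ℕ :=
  sSup {n : ℕ | ∃ X : Submodule ℂ V, X ≤ U ∧ Module.finrank ℂ X = n ∧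
    ∀ x ∈ X, x ≠ 0 → 0 < (B x x).re}

/-- Second entry of the signature of the Hermitian form `B` on `U`: the largest dimension of a
subspace of `U` on which `B` is negative definite. -/
def negIndex {V : Type*} [AddCommGroup V] [Module ℂ V] (B : V → V → ℂ)
    (U : Submodule ℂ V) : ℕ :=
  sSup {n : ℕ | ∃ X : Submodule ℂ V, X ≤ U ∧ Module.finrank ℂ X = n ∧
    ∀ x ∈ X, x ≠ 0 → (B x x).re < 0}

end Signature

/-! ### Pure Hodge structures

A real structure on a complex vector space `V` is given by its conjugation
`σ : V →ₛₗ[starRingEnd ℂ] V`, an antilinear involution. -/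

section Pure

/-- The decreasing filtration `F` is a pure (real) Hodge structure of weight `k`: it is finite and
`k`-opposed to its complex conjugate. -/
structure IsHodgeStructure {V : Type*} [AddCommGroup V] [Module ℂ V]
    (σ : V →ₛₗ[starRingEnd ℂ] V) (k : ℤ) (F : ℤ → Submodule ℂ V) : Prop where
  anti : Antitone F
  exists_top : ∃ a, F a = ⊤
  exists_bot : ∃ b, F b = ⊥
  opposed : ∀ p : ℤ, IsCompl (F p) ((F (k - p + 1)).map σ)

/-- The `(p, q)`-component `F^p ∩ conj (F^q)`. -/
def component {V : Type*} [AddCommGroup V] [Module ℂ V]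
    (σ : V →ₛₗ[starRingEnd ℂ] V) (F : ℤ → Submodule ℂ V) (p q : ℤ) : Submodule ℂ V :=
  F p ⊓ (F q).map σ

/-- The form `(u, v) ↦ B (C u, conj v)` on the `(p, q)`-component, on which the Weil operator `C`
is multiplication by `i ^ (p - q)`. -/
def weilForm {V : Type*} [AddCommGroup V] [Module ℂ V]
    (σ : V →ₛₗ[starRingEnd ℂ] V) (B : V →ₗ[ℂ] V →ₗ[ℂ] ℂ) (p q : ℤ) (u v : V) : ℂ :=
  B ((Complex.I ^ (p - q)) • u) (σ v)

/-- The two Hodge-Riemann bilinear relations: the bilinear form `B` polarizes the Hodge structure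
of weight `k` that `F` induces on the sub-Hodge structure `U`. -/
structure Polarizes {V : Type*} [AddCommGroup V] [Module ℂ V]
    (σ : V →ₛₗ[starRingEnd ℂ] V) (k : ℤ) (F : ℤ → Submodule ℂ V) (U : Submodule ℂ V)
    (B : V →ₗ[ℂ] V →ₗ[ℂ] ℂ) : Prop where
  isotropic : ∀ p : ℤ, ∀ u ∈ U ⊓ F p, ∀ v ∈ U ⊓ F (k - p + 1), B u v = 0
  positive : ∀ p : ℤ, ∀ u ∈ U ⊓ component σ F p (k - p), u ≠ 0 →
    0 < (weilForm σ B p (k - p) u u).re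

end Pure

/-! ### Graded pieces of an increasing filtration -/

section Graded

variable {H : Type*} [AddCommGroup H] [Module ℂ H]

/-- `Gr^W_k H = W_k / W_{k-1}`. -/
abbrev Gr (W : ℤ → Submodule ℂ H) (k : ℤ) : Type _ :=
  ↥(W k) ⧸ (W (k - 1)).submoduleOf (W k)

/-- The class in `Gr^W_k H` of an element of `W_k`. -/
abbrev grMk (W : ℤ → Submodule ℂ H) (k : ℤ) : ↥(W k) →ₗ[ℂ] Gr W k :=
  ((W (k - 1)).submoduleOf (W k)).mkQ

/-- The subspace of `Gr^W_k H` induced by a subspace `Y` of `H`: the image of `Y ∩ W_k`. -/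
def grImage (W : ℤ → Submodule ℂ H) (k : ℤ) (Y : Submodule ℂ H) : Submodule ℂ (Gr W k) :=
  (Y.submoduleOf (W k)).map (grMk W k)

/-- The conjugation induced on `Gr^W_k H` when `W` is defined over `ℝ`. -/
def grConj (σ : H →ₛₗ[starRingEnd ℂ] H) (W : ℤ → Submodule ℂ H)
    (hW : ∀ k, ∀ u ∈ W k, σ u ∈ W k) (k : ℤ) : Gr W k →ₛₗ[starRingEnd ℂ] Gr W k :=
  Submodule.mapQ _ _ (σ.restrict (hW k)) (fun u hu => hW (k - 1) u hu)

theorem pow_mem_of_mem {W : ℤ → Submodule ℂ H} {N : Module.End ℂ H}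
    (hN : ∀ i, ∀ u ∈ W i, N u ∈ W (i - 2)) (l : ℕ) :
    ∀ i, ∀ u ∈ W i, (N ^ l) u ∈ W (i - 2 * (l : ℤ)) := by
  induction l with
  | zero => intro i u hu; simpa using hu
  | succ l ih =>
    intro i u hu
    have h := hN _ _ (ih i u hu)
    have e : i - 2 * (l : ℤ) - 2 = i - 2 * ((l + 1 : ℕ) : ℤ) := by push_cast; ring
    rw [pow_succ', Module.End.mul_apply, ← e]
    exact h

/-- The map `N ^ l : Gr^W_i H → Gr^W_{i - 2l} H`. -/
def grPow {W : ℤ → Submodule ℂ H} {N : Module.End ℂ H}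
    (hN : ∀ i, ∀ u ∈ W i, N u ∈ W (i - 2)) (l : ℕ) (i : ℤ) :
    Gr W i →ₗ[ℂ] Gr W (i - 2 * (l : ℤ)) :=
  Submodule.mapQ _ _ ((N ^ l).restrict (pow_mem_of_mem hN l i)) (by
    intro u hu
    have h := pow_mem_of_mem hN l (i - 1) u hu
    have e : i - 1 - 2 * (l : ℤ) = i - 2 * (l : ℤ) - 1 := by ring
    rw [e] at h
    exact h)

/-- `W` is the monodromy weight filtration `W(N, d)` of `N` centered at `d`. -/
structure IsMonodromyWeight (N : Module.End ℂ H) (d : ℤ) (W : ℤ → Submodule ℂ H) : Prop where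
  mono : Monotone W
  exists_bot : ∃ a, W a = ⊥
  exists_top : ∃ b, W b = ⊤
  map_mem : ∀ i, ∀ u ∈ W i, N u ∈ W (i - 2)
  /-- `N ^ l : Gr_{d+l} → Gr_{d-l}` is an isomorphism; here `d - l` appears as `d + l - 2l`. -/
  bijective : ∀ l : ℕ, Function.Bijective (grPow map_mem l (d + l))

/-- `(W, F)` is a real mixed Hodge structure on `H`: both filtrations are finite, the weight
filtration `W` is increasing and defined over `ℝ`, the Hodge filtration `F` is decreasing, and `F`
induces on `Gr^W_k H` a pure Hodge structure of weight `k`, for every `k`. -/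
structure IsMHS (σ : H →ₛₗ[starRingEnd ℂ] H) (W F : ℤ → Submodule ℂ H) : Prop where
  conj_conj : ∀ u, σ (σ u) = u
  W_mono : Monotone W
  W_bot : ∃ a, W a = ⊥
  W_top : ∃ b, W b = ⊤
  W_real : ∀ k, ∀ u ∈ W k, σ u ∈ W k
  F_anti : Antitone F
  F_top : ∃ a, F a = ⊤
  F_bot : ∃ b, F b = ⊥
  pure : ∀ k, IsHodgeStructure (grConj σ W W_real k) k (fun p => grImage W k (F p))

/-- A real mixed Hodge structure with a nilpotent endomorphism `N` which is a morphism of type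
`(-1, -1)` and whose weight filtration centered at `d` is `W`. -/
structure SituationA (d : ℕ) (σ : H →ₛₗ[starRingEnd ℂ] H) (W F : ℤ → Submodule ℂ H)
    (N : Module.End ℂ H) : Prop where
  mhs : IsMHS σ W F
  nilpotent : IsNilpotent N
  N_real : ∀ u, N (σ u) = σ (N u)
  N_W : ∀ i, ∀ u ∈ W i, N u ∈ W (i - 2)
  N_F : ∀ p, ∀ u ∈ F p, N u ∈ F (p - 1)
  weight : IsMonodromyWeight N d W

/-- The previous situation with a nondegenerate real `(-1)^d`-symmetric bilinear form `S` for which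
`N` is an infinitesimal isometry and `S (F^p, F^{d-p+1}) = 0`. -/
structure SituationB (d : ℕ) (σ : H →ₛₗ[starRingEnd ℂ] H) (W F : ℤ → Submodule ℂ H)
    (N : Module.End ℂ H) (S : H →ₗ[ℂ] H →ₗ[ℂ] ℂ) : Prop extends SituationA d σ W F N where
  S_nondeg : S.Nondegenerate
  S_real : ∀ u v, S (σ u) (σ v) = starRingEnd ℂ (S u v)
  S_symm : ∀ u v, S v u = (-1) ^ d * S u v
  S_isom : ∀ u v, S u (N v) + S (N u) v = 0
  S_isotropic : ∀ p : ℤ, ∀ u ∈ F p, ∀ v ∈ F (d - p + 1), S u v = 0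

end Graded

/-! ### The forms `S (·, N ^ l ·)` on the graded pieces -/

section GradedForm

variable {H : Type*} [AddCommGroup H] [Module ℂ H] {d : ℕ} {σ : H →ₛₗ[starRingEnd ℂ] H}
  {W F : ℤ → Submodule ℂ H} {N : Module.End ℂ H} {S : H →ₗ[ℂ] H →ₗ[ℂ] ℂ}

theorem IsMonodromyWeight.exists_preimage {e : ℤ} (h : IsMonodromyWeight N e W) :
    ∀ l : ℕ, ∀ u ∈ W (e - l), ∃ x ∈ W (e + l), (N ^ l) x = u := by
  obtain ⟨a, ha⟩ := h.exists_bot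
  suffices key : ∀ n l : ℕ, e - l ≤ a + n → ∀ u ∈ W (e - l), ∃ x ∈ W (e + l), (N ^ l) x = u by
    intro l
    exact key (e - l - a).toNat l (by omega)
  intro n
  induction n with
  | zero =>
    intro l hl u hu
    have hu' : u ∈ W a := h.mono (by simpa using hl) hu
    rw [ha, Submodule.mem_bot] at hu'
    exact ⟨0, zero_mem _, by simp [hu']⟩
  | succ n ih =>
    intro l hl u hu
    have e1 : e + l - 2 * (l : ℤ) = e - l := by ring
    obtain ⟨y, hy⟩ := (h.bijective l).2 (grMk W _ ⟨u, by rw [e1]; exact hu⟩)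
    obtain ⟨x, rfl⟩ := Submodule.mkQ_surjective _ y
    have h2 : (N ^ l) (x : H) - u ∈ W (e + l - 2 * (l : ℤ) - 1) :=
      (Submodule.Quotient.eq ((W (e + l - 2 * (l : ℤ) - 1)).submoduleOf _)).1 hy
    have e2 : e + l - 2 * (l : ℤ) - 1 = e - ((l + 1 : ℕ) : ℤ) := by push_cast; ring
    rw [e2] at h2
    obtain ⟨t, ht, hNt⟩ := ih (l + 1) (by push_cast at hl ⊢; omega) _ h2
    refine ⟨x - N t, sub_mem x.2 (h.mono ?_ (h.map_mem _ _ ht)), ?_⟩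
    · push_cast; omega
    · rw [pow_succ, Module.End.mul_apply] at hNt
      rw [map_sub, hNt]
      abel

theorem SituationB.S_pow (h : SituationB d σ W F N S) (l : ℕ) :
    ∀ u v, S ((N ^ l) u) v = (-1) ^ l * S u ((N ^ l) v) := by
  induction l with
  | zero => simp
  | succ l ih =>
    intro u v
    have h1 := h.S_isom ((N ^ l) u) v
    have h2 := ih u (N v)
    rw [pow_succ' N, Module.End.mul_apply, ← pow_succ' N, pow_succ N, Module.End.mul_apply,
      pow_succ, mul_assoc, mul_left_comm, ← h2]
    linear_combination h1

/-- `S (W_a, W_b) = 0` for `a + b ≤ 2d - 1`. -/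
theorem SituationB.S_weight (h : SituationB d σ W F N S) {a b : ℤ} (hab : a + b < 2 * (d : ℤ))
    {u v : H} (hu : u ∈ W a) (hv : v ∈ W b) : S u v = 0 := by
  obtain ⟨c, hc⟩ := h.weight.exists_bot
  have key : ∀ n l : ℕ, (d : ℤ) - l ≤ c + n →
      ∀ u ∈ W ((d : ℤ) - l), ∀ v ∈ W ((d : ℤ) + l - 1), S u v = 0 := by
    intro n
    induction n with
    | zero =>
      intro l hl u hu v _
      have hu' : u ∈ W c := h.weight.mono (by simpa using hl) hu
      rw [hc, Submodule.mem_bot] at hu'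
      simp [hu']
    | succ n ih =>
      intro l hl u hu v hv
      obtain ⟨x, hx, rfl⟩ := h.weight.exists_preimage l u hu
      have hNv := pow_mem_of_mem h.weight.map_mem l _ _ hv
      have e1 : (d : ℤ) + l - 1 - 2 * (l : ℤ) = d - ((l + 1 : ℕ) : ℤ) := by push_cast; ring
      rw [e1] at hNv
      obtain ⟨y, hy, hNy⟩ := h.weight.exists_preimage (l + 1) _ hNv
      have hNx := pow_mem_of_mem h.weight.map_mem (l + 1) _ _ hx
      have h0 : S ((N ^ (l + 1)) x) y = 0 := by
        refine ih (l + 2) (by push_cast at hl ⊢; omega) _ (h.weight.mono ?_ hNx) _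
          (h.weight.mono ?_ hy)
        · push_cast; omega
        · push_cast; omega
      rw [h.S_pow] at h0
      rw [h.S_pow, ← hNy]
      have h1 : ((-1 : ℂ) ^ (l + 1)) ≠ 0 := pow_ne_zero _ (by norm_num)
      rw [(mul_eq_zero.1 h0).resolve_left h1, mul_zero]
  have key' : ∀ {a b : ℤ}, a ≤ d → a + b < 2 * (d : ℤ) → ∀ {u v : H}, u ∈ W a → v ∈ W b →
      S u v = 0 := by
    intro a b ha hab u v hu hv
    refine key ((d : ℤ) - (d - a).toNat - c).toNat (d - a).toNat (by omega) u
      (h.weight.mono (by omega) hu) v (h.weight.mono (by omega) hv)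
  rcases le_total a d with ha | ha
  · exact key' ha hab hu hv
  · rw [h.S_symm v u, key' (by omega) (by omega) hv hu, mul_zero]

/-- The bilinear form `([u], [v]) ↦ S (u, N ^ l v)` on `Gr^W_k H`, where `k = d + l`. -/
def SituationB.grForm (h : SituationB d σ W F N S) (k : ℤ) :
    Gr W k →ₗ[ℂ] Gr W k →ₗ[ℂ] ℂ :=
  LinearMap.liftQ₂ _ _ ((S.compl₂ (N ^ (k - d).toNat)).domRestrict₁₂ (W k) (W k))
    (by
      intro u hu
      ext v
      have h1 := pow_mem_of_mem h.weight.map_mem (k - d).toNat _ _ v.2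
      have hu' : (u : H) ∈ W (k - 1) := hu
      exact h.S_weight (by omega) hu' h1)
    (by
      intro v hv
      ext u
      have hv' : (v : H) ∈ W (k - 1) := hv
      have h1 := pow_mem_of_mem h.weight.map_mem (k - d).toNat _ _ hv'
      exact h.S_weight (by omega) u.2 h1)

/-- The primitive part `P_k = ker (N ^ (l + 1) : Gr^W_k H → Gr^W_{k - 2l - 2} H)`, where
`k = d + l` with `l ≥ 0`. -/
def SituationB.prim (h : SituationB d σ W F N S) (k : ℤ) : Submodule ℂ (Gr W k) :=
  LinearMap.ker (grPow h.weight.map_mem ((k - d).toNat + 1) k)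

/-- The `(p, q)`-component of the Hodge structure on the primitive part `P_{p+q}`. -/
def SituationB.primComponent (h : SituationB d σ W F N S) (p q : ℤ) :
    Submodule ℂ (Gr W (p + q)) :=
  h.prim (p + q) ⊓
    component (grConj σ W h.mhs.W_real (p + q)) (fun r => grImage W (p + q) (F r)) p q

/-- `s_+^{p,q}`, for `p + q ≥ d`: the positive index of `S (C ·, N ^ (p + q - d) conj ·)` on the
`(p, q)`-component of `P_{p+q}`. -/
def SituationB.sPos (h : SituationB d σ W F N S) (p q : ℤ) : ℕ :=
  posIndex (weilForm (grConj σ W h.mhs.W_real (p + q)) (h.grForm (p + q)) p q)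
    (h.primComponent p q)

/-- `s_-^{p,q}`, for `p + q ≥ d`: the negative index of `S (C ·, N ^ (p + q - d) conj ·)` on the
`(p, q)`-component of `P_{p+q}`. -/
def SituationB.sNeg (h : SituationB d σ W F N S) (p q : ℤ) : ℕ :=
  negIndex (weilForm (grConj σ W h.mhs.W_real (p + q)) (h.grForm (p + q)) p q)
    (h.primComponent p q)

/-- `𝐒_+^{p,k} = ∑_{r ≥ (-l)_+} s_+^{p+r,k+r}`, where `l = p + k - d`; a sum with finitely many
nonzero terms. -/
def SituationB.bigSPos (h : SituationB d σ W F N S) (p k : ℤ) : ℕ :=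
  ∑ᶠ r ∈ {r : ℤ | max (-(p + k - d)) 0 ≤ r}, h.sPos (p + r) (k + r)

/-- `𝐒_-^{p,k} = ∑_{r ≥ (-l)_+} s_-^{p+r,k+r}`, where `l = p + k - d`; a sum with finitely many
nonzero terms. -/
def SituationB.bigSNeg (h : SituationB d σ W F N S) (p k : ℤ) : ℕ :=
  ∑ᶠ r ∈ {r : ℤ | max (-(p + k - d)) 0 ≤ r}, h.sNeg (p + r) (k + r)

/-- The mixed Hodge structure is polarized by `N` (and `S`), centered at `d`. -/
structure SituationB.IsPolarized (h : SituationB d σ W F N S) : Prop where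
  pow_eq_zero : N ^ (d + 1) = 0
  polarizes : ∀ l : ℕ, Polarizes (grConj σ W h.mhs.W_real (d + l)) (d + l)
    (fun p => grImage W (d + l) (F p)) (h.prim (d + l)) (h.grForm (d + l))

end GradedForm

/-! ### Nilpotent orbits -/

section Orbit

variable {H : Type*} [AddCommGroup H] [Module ℂ H]

/-- `exp (z N)` for nilpotent `N`. -/
def expN (N : Module.End ℂ H) (z : ℂ) : Module.End ℂ H :=
  ∑ j ∈ Finset.range (nilpotencyClass N), (z ^ j / (j.factorial : ℂ)) • N ^ j

/-- The filtration `exp (z N) F`. -/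
def expF (N : Module.End ℂ H) (F : ℤ → Submodule ℂ H) (z : ℂ) (p : ℤ) : Submodule ℂ H :=
  (F p).map (expN N z)

/-- `z ↦ exp (z N) F` is a (polarized) nilpotent orbit of weight `d`: `N` is a nilpotent real
infinitesimal isometry of `S`, `N F^p ⊆ F^{p-1}`, and `exp (z N) F` is a Hodge structure of
weight `d` polarized by `S` for `Im z` sufficiently large. -/
structure IsNilpotentOrbit (d : ℕ) (σ : H →ₛₗ[starRingEnd ℂ] H) (F : ℤ → Submodule ℂ H)
    (N : Module.End ℂ H) (S : H →ₗ[ℂ] H →ₗ[ℂ] ℂ) : Prop where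
  nilpotent : IsNilpotent N
  real : ∀ u, N (σ u) = σ (N u)
  isom : ∀ u v, S u (N v) + S (N u) v = 0
  horizontal : ∀ p, ∀ u ∈ F p, N u ∈ F (p - 1)
  polarized : ∃ T : ℝ, ∀ z : ℂ, T < z.im →
    IsHodgeStructure σ d (expF N F z) ∧ Polarizes σ d (expF N F z) ⊤ S

/-- `G^0 ⊇ G^1 ⊇ ... ⊇ G^n` is a full flag of `H` (one-dimensional graded pieces) refining the
filtration `F`. -/
structure IsFullRefinement (F : ℤ → Submodule ℂ H) (n : ℕ) (G : ℕ → Submodule ℂ H) : Prop where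
  anti : Antitone G
  zero : G 0 = ⊤
  last : G n = ⊥
  gr : ∀ k < n, Module.finrank ℂ (↥(G k) ⧸ (G (k + 1)).submoduleOf (G k)) = 1
  refines : ∀ p : ℤ, ∃ k ≤ n, F p = G k

end Orbit

end

end LimitMHS

/-! The Hermitian form `i^d S(·, conj ·)` pulled back by `exp(zN)` becomes `S(·, exp(-2i Im(z) N)
conj ·)`, so only `s² = Im z` matters. The proof finds a basis, depending on `s`, whose Gram matrix
tends to a real diagonal matrix as `s → ∞`, and reads every signature off the diagonal.

Lift orthogonal bases of the primitive spaces `P^{a,b}` to vectors `u_i ∈ F^a ∩ W_{d+l}`. Strictness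
of `N` gives a Lefschetz decomposition inside `F`, so the vectors `N^j u_i`, `0 ≤ j ≤ l_i`, of Hodge
level `a_i - j ≥ p` span `F^p` (`levelSpan_eq`). Rescale `N^m u_i` by `s^{2m-l_i}`. By weights and
primitivity only pairings inside strings of equal length survive in the limit, and what remains is
the Gram matrix of an `sl₂`-string times `S(u_i, N^l conj u_{i'})` (`tendsto_scaledForm`).

An explicit unitriangular change of basis in each string, up to scale, diagonalizes this matrix by a
finite-difference identity (`sum_stringCoeff_mul_stringGram`). The diagonal entry at `N^j u_i` is a
positive multiple of `(-1)^{d-p} sgn_i`, where `p = a_i - j` is its Hodge level (`limitGram_self`).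
Since `i^{2p-d} = (-1)^{p-d} i^d`, the Weil operator cancels exactly this sign.

A nearly diagonal Gram matrix controls the span of every subfamily (`NearDiagonal.span_facts`). As
the change of basis is triangular, sets of basis vectors closed under lowering `j` have the same
span before and after it. These include the sets spanning each `F^p` and a full flag refining them,
which gives nondegeneracy along the flag. Nondegeneracy on `exp(zN)F^p` then gives opposedness
(`isHodgeStructure_expF`), and comparing `F^p` with `F^{p+1}` gives the signature on each component
(`index_component`). Counting the `N^j u_i` of level `p` yields the stated sums. -/

namespace LimitMHS

/-! ### Hermitian forms -/

section Hermitian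

variable {V : Type*} [AddCommGroup V] [Module ℂ V]

/-- `B` is a Hermitian form, linear in the first variable. -/
structure IsHermForm (B : V → V → ℂ) : Prop where
  add_left : ∀ u v w, B (u + v) w = B u w + B v w
  smul_left : ∀ (c : ℂ) u w, B (c • u) w = c * B u w
  conj_symm : ∀ u v, starRingEnd ℂ (B u v) = B v u

namespace IsHermForm

variable {B : V → V → ℂ} (hB : IsHermForm B)

include hB

theorem add_right (u v w : V) : B u (v + w) = B u v + B u w := by
  rw [← hB.conj_symm, hB.add_left, map_add, hB.conj_symm, hB.conj_symm]

theorem smul_right (c : ℂ) (u v : V) : B u (c • v) = starRingEnd ℂ c * B u v := by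
  rw [← hB.conj_symm, hB.smul_left, map_mul, hB.conj_symm]

theorem zero_left (v : V) : B 0 v = 0 := by
  simpa using hB.smul_left 0 0 v

theorem eq_zero_comm {u v : V} (h : B u v = 0) : B v u = 0 := by
  rw [← hB.conj_symm, h, map_zero]

theorem sum_left {ι : Type*} (s : Finset ι) (f : ι → V) (w : V) :
    B (∑ i ∈ s, f i) w = ∑ i ∈ s, B (f i) w := by
  classical
  induction s using Finset.induction_on with
  | empty => simp [hB.zero_left]
  | insert a s ha ih => rw [Finset.sum_insert ha, Finset.sum_insert ha, hB.add_left, ih]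

theorem sum_right {ι : Type*} (s : Finset ι) (f : ι → V) (w : V) :
    B w (∑ i ∈ s, f i) = ∑ i ∈ s, B w (f i) := by
  rw [← hB.conj_symm, hB.sum_left, map_sum]
  exact Finset.sum_congr rfl fun i _ => hB.conj_symm _ _

theorem neg : IsHermForm (fun u v => -B u v) where
  add_left u v w := by rw [hB.add_left]; ring
  smul_left c u w := by rw [hB.smul_left]; ring
  conj_symm u v := by rw [map_neg, hB.conj_symm]

theorem self_eq_re (u : V) : B u u = ((B u u).re : ℂ) :=
  (Complex.conj_eq_iff_re.1 (hB.conj_symm u u)).symm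

/-- The vectors of `V` orthogonal to `U`. -/
def orth (U : Submodule ℂ V) : Submodule ℂ V where
  carrier := {x | ∀ y ∈ U, B x y = 0}
  add_mem' {a b} ha hb y hy := by
    rw [hB.add_left, ha y hy, hb y hy, add_zero]
  zero_mem' y _ := hB.zero_left y
  smul_mem' c x hx y hy := by
    rw [hB.smul_left, hx y hy, mul_zero]

theorem mem_orth {U : Submodule ℂ V} {x : V} : x ∈ hB.orth U ↔ ∀ y ∈ U, B x y = 0 := Iff.rfl

omit hB in
theorem posIndex_neg (B : V → V → ℂ) (U : Submodule ℂ V) :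
    posIndex (fun u v => -B u v) U = negIndex B U := by
  simp [posIndex, negIndex]

omit hB in
theorem negIndex_neg (B : V → V → ℂ) (U : Submodule ℂ V) :
    negIndex (fun u v => -B u v) U = posIndex B U := by
  simp [posIndex, negIndex]

omit hB in
theorem exists_posDef [FiniteDimensional ℂ V] (B : V → V → ℂ) (U : Submodule ℂ V) :
    ∃ X ≤ U, Module.finrank ℂ X = posIndex B U ∧ ∀ x ∈ X, x ≠ 0 → 0 < (B x x).re := by
  have h := Nat.sSup_mem (s := {n : ℕ | ∃ X : Submodule ℂ V, X ≤ U ∧ Module.finrank ℂ X = n ∧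
    ∀ x ∈ X, x ≠ 0 → 0 < (B x x).re}) ⟨0, ⊥, bot_le, by simp, by simp⟩
    ⟨Module.finrank ℂ U, by
      rintro n ⟨X, hX, rfl, -⟩
      exact Submodule.finrank_mono hX⟩
  obtain ⟨X, hX, h1, h2⟩ := h
  exact ⟨X, hX, h1, h2⟩

omit hB in
theorem finrank_le_posIndex [FiniteDimensional ℂ V] {B : V → V → ℂ} {X U : Submodule ℂ V}
    (hX : X ≤ U) (h : ∀ x ∈ X, x ≠ 0 → 0 < (B x x).re) :
    Module.finrank ℂ X ≤ posIndex B U := by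
  refine le_csSup ⟨Module.finrank ℂ U, ?_⟩ ⟨X, hX, rfl, h⟩
  rintro n ⟨X, hX, rfl, -⟩
  exact Submodule.finrank_mono hX

omit hB in
theorem finrank_add_of_disjoint [FiniteDimensional ℂ V] {X Y : Submodule ℂ V} (h : X ⊓ Y = ⊥) :
    Module.finrank ℂ ↥(X ⊔ Y) = Module.finrank ℂ X + Module.finrank ℂ Y := by
  have h1 := Submodule.finrank_sup_add_finrank_inf_eq X Y
  rw [h, finrank_bot, add_zero] at h1
  exact h1

omit hB in
theorem posDef_inf_negDef {B : V → V → ℂ} {X Y : Submodule ℂ V}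
    (hX : ∀ x ∈ X, x ≠ 0 → 0 < (B x x).re) (hY : ∀ x ∈ Y, x ≠ 0 → (B x x).re < 0) :
    X ⊓ Y = ⊥ := by
  rw [eq_bot_iff]
  intro x hx
  rw [Submodule.mem_bot]
  by_contra h
  exact lt_asymm (hX x hx.1 h) (hY x hx.2 h)

-- A positive definite subspace meets `Y` only in zero, so its dimension is at most `dim U - dim Y`,
-- which `X` attains.
omit hB in
theorem posIndex_eq [FiniteDimensional ℂ V] {B : V → V → ℂ} {X Y U : Submodule ℂ V}
    (hXU : X ≤ U) (hYU : Y ≤ U)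
    (hX : ∀ x ∈ X, x ≠ 0 → 0 < (B x x).re) (hY : ∀ x ∈ Y, x ≠ 0 → (B x x).re < 0)
    (hd : Module.finrank ℂ U ≤ Module.finrank ℂ X + Module.finrank ℂ Y) :
    posIndex B U = Module.finrank ℂ X := by
  refine le_antisymm ?_ (finrank_le_posIndex hXU hX)
  obtain ⟨Z, hZU, hZ, hZp⟩ := exists_posDef B U
  have h1 := finrank_add_of_disjoint (posDef_inf_negDef hZp hY)
  have h2 := Submodule.finrank_mono (sup_le hZU hYU)
  omega

omit hB in
theorem negIndex_eq [FiniteDimensional ℂ V] {B : V → V → ℂ} {X Y U : Submodule ℂ V}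
    (hXU : X ≤ U) (hYU : Y ≤ U)
    (hX : ∀ x ∈ X, x ≠ 0 → 0 < (B x x).re) (hY : ∀ x ∈ Y, x ≠ 0 → (B x x).re < 0)
    (hd : Module.finrank ℂ U ≤ Module.finrank ℂ X + Module.finrank ℂ Y) :
    negIndex B U = Module.finrank ℂ Y := by
  rw [← posIndex_neg]
  refine posIndex_eq (X := Y) (Y := X) hYU hXU ?_ ?_ (by omega)
  · intro x hx h0
    simpa using hY x hx h0
  · intro x hx h0
    simpa using hX x hx h0

theorem nondegOn_of_split [FiniteDimensional ℂ V] {X Y U : Submodule ℂ V}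
    (hXU : X ≤ U) (hYU : Y ≤ U)
    (hX : ∀ x ∈ X, x ≠ 0 → 0 < (B x x).re) (hY : ∀ x ∈ Y, x ≠ 0 → (B x x).re < 0)
    (hd : Module.finrank ℂ U ≤ Module.finrank ℂ X + Module.finrank ℂ Y) : NondegOn B U := by
  have h0 := posDef_inf_negDef hX hY
  have hU : X ⊔ Y = U := by
    refine Submodule.eq_of_le_of_finrank_le (sup_le hXU hYU) ?_
    rw [finrank_add_of_disjoint h0]
    exact hd
  intro u hu h
  rw [← hU] at hu
  obtain ⟨x, hx, y, hy, rfl⟩ := Submodule.mem_sup.1 hu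
  have h1 := h x (hXU hx)
  have h2 := h y (hYU hy)
  rw [hB.add_left] at h1 h2
  have h3 : (B y x).re = (B x y).re := by rw [← hB.conj_symm, Complex.conj_re]
  have h1' := congrArg Complex.re h1
  have h2' := congrArg Complex.re h2
  simp only [Complex.add_re, Complex.zero_re] at h1' h2'
  by_cases hx0 : x = 0
  · by_cases hy0 : y = 0
    · simp [hx0, hy0]
    · have := hY y hy hy0
      rw [hx0, hB.zero_left, Complex.zero_re] at h2'
      linarith
  · have h4 := hX x hx hx0
    by_cases hy0 : y = 0
    · rw [hy0, hB.zero_left, Complex.zero_re] at h1'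
      linarith
    · have := hY y hy hy0
      linarith

/-- The sum of two orthogonal positive definite subspaces is positive definite. The inequality
suffices later, because the dimension count forces equality. -/
theorem posIndex_add_le [FiniteDimensional ℂ V] {C U₁ U : Submodule ℂ V} (hC : C ≤ U)
    (hU₁ : U₁ ≤ U) (horth : ∀ x ∈ C, ∀ y ∈ U₁, B x y = 0) :
    posIndex B C + posIndex B U₁ ≤ posIndex B U := by
  obtain ⟨X, hXC, hX, hXp⟩ := exists_posDef B C
  obtain ⟨Y, hYU, hY, hYp⟩ := exists_posDef B U₁
  have hd : X ⊓ Y = ⊥ := by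
    rw [eq_bot_iff]
    intro x hx
    rw [Submodule.mem_bot]
    by_contra h0
    have := hXp x hx.1 h0
    rw [horth x (hXC hx.1) x (hYU hx.2), Complex.zero_re] at this
    exact lt_irrefl _ this
  rw [← hX, ← hY, ← finrank_add_of_disjoint hd]
  refine finrank_le_posIndex (sup_le (hXC.trans hC) (hYU.trans hU₁)) ?_
  intro z hz h0
  obtain ⟨x, hx, y, hy, rfl⟩ := Submodule.mem_sup.1 hz
  have h1 := horth x (hXC hx) y (hYU hy)
  rw [hB.add_left, hB.add_right, hB.add_right, h1, hB.eq_zero_comm h1]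
  simp only [add_zero, zero_add, Complex.add_re]
  by_cases hx0 : x = 0
  · have hy0 : y ≠ 0 := by
      rintro rfl
      exact h0 (by simp [hx0])
    have := hYp y hy hy0
    rw [hx0, hB.zero_left, Complex.zero_re]
    linarith
  · have h4 := hXp x hx hx0
    by_cases hy0 : y = 0
    · rw [hy0, hB.zero_left, Complex.zero_re]
      linarith
    · have := hYp y hy hy0
      linarith

theorem negIndex_add_le [FiniteDimensional ℂ V] {C U₁ U : Submodule ℂ V} (hC : C ≤ U)
    (hU₁ : U₁ ≤ U) (horth : ∀ x ∈ C, ∀ y ∈ U₁, B x y = 0) :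
    negIndex B C + negIndex B U₁ ≤ negIndex B U := by
  simp only [← posIndex_neg]
  exact hB.neg.posIndex_add_le hC hU₁ fun x hx y hy => by rw [horth x hx y hy, neg_zero]

end IsHermForm

/-! ### Families with nearly diagonal Gram matrix. -/

theorem mem_span_image_finset {T : Type*} {v : T → V} {A : Finset T} {x : V} :
    x ∈ Submodule.span ℂ (v '' A) ↔ ∃ c : T → ℂ, ∑ t ∈ A, c t • v t = x := by
  classical
  rw [Submodule.mem_span_image_finset_iff_exists_fun]
  constructor
  · rintro ⟨c, hc⟩
    refine ⟨fun t => if h : t ∈ A then c ⟨t, h⟩ else 0, ?_⟩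
    rw [← hc, ← Finset.sum_coe_sort]
    exact Finset.sum_congr rfl fun t _ => by simp
  · rintro ⟨c, hc⟩
    exact ⟨fun t => c t, by rw [← hc]; exact Finset.sum_coe_sort A fun t => c t • v t⟩

/-- The Gram matrix of the family `v` is within `ε` of the real diagonal matrix with entries `lam`,
and `ε` is small compared with these. -/
structure NearDiagonal {T : Type*} [Fintype T] [DecidableEq T] (B : V → V → ℂ) (v : T → V)
    (lam : T → ℝ) (ε : ℝ) : Prop where
  dist_le : ∀ t t', ‖B (v t) (v t') - if t = t' then (lam t : ℂ) else 0‖ ≤ ε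
  small : ∀ t, ε * Fintype.card T < |lam t|

namespace NearDiagonal

variable {T : Type*} [Fintype T] [DecidableEq T] {B : V → V → ℂ} {v : T → V}
  {lam : T → ℝ} {ε : ℝ} (hv : NearDiagonal B v lam ε)

include hv

omit [AddCommGroup V] [Module ℂ V] in
theorem neg : NearDiagonal (fun u w => -B u w) v (fun t => -lam t) ε where
  dist_le t t' := by
    have h := hv.dist_le t t'
    have e : (-B (v t) (v t') - if t = t' then ((-lam t : ℝ) : ℂ) else 0) =
        -(B (v t) (v t') - if t = t' then (lam t : ℂ) else 0) := by
      split_ifs <;> push_cast <;> ring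
    rw [e, norm_neg]
    exact h
  small t := by simpa using hv.small t

theorem pos_of_sum (hB : IsHermForm B) {A : Finset T} (hA : ∀ t ∈ A, 0 < lam t) (c : T → ℂ)
    (hc : ∃ t ∈ A, c t ≠ 0) :
    0 < (B (∑ t ∈ A, c t • v t) (∑ t ∈ A, c t • v t)).re := by
  obtain ⟨t₀, ht₀, hc₀⟩ := hc
  have hε : 0 ≤ ε := (norm_nonneg _).trans (hv.dist_le t₀ t₀)
  have e1 : B (∑ t ∈ A, c t • v t) (∑ t ∈ A, c t • v t) =
      ∑ t ∈ A, ∑ t' ∈ A, c t * (starRingEnd ℂ (c t') * B (v t) (v t')) := by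
    rw [hB.sum_left]
    refine Finset.sum_congr rfl fun t _ => ?_
    rw [hB.smul_left, hB.sum_right, Finset.mul_sum]
    exact Finset.sum_congr rfl fun t' _ => by rw [hB.smul_right]
  have e2 : ∑ t ∈ A, ∑ t' ∈ A, c t * (starRingEnd ℂ (c t') *
      (if t = t' then (lam t : ℂ) else 0)) = ((∑ t ∈ A, lam t * ‖c t‖ ^ 2 : ℝ) : ℂ) := by
    push_cast
    refine Finset.sum_congr rfl fun t ht => ?_
    simp only [mul_ite, mul_zero, Finset.sum_ite_eq, ht, if_true]
    rw [← Complex.mul_conj']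
    ring
  have e3 : ‖(∑ t ∈ A, ∑ t' ∈ A, c t * (starRingEnd ℂ (c t') * B (v t) (v t'))) -
      ((∑ t ∈ A, lam t * ‖c t‖ ^ 2 : ℝ) : ℂ)‖ ≤ ε * (∑ t ∈ A, ‖c t‖) ^ 2 := by
    rw [← e2, ← Finset.sum_sub_distrib]
    refine (norm_sum_le _ _).trans ?_
    rw [sq, Finset.sum_mul_sum, Finset.mul_sum]
    refine Finset.sum_le_sum fun t _ => ?_
    rw [← Finset.sum_sub_distrib, Finset.mul_sum]
    refine (norm_sum_le _ _).trans (Finset.sum_le_sum fun t' _ => ?_)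
    rw [← mul_sub, ← mul_sub, norm_mul, norm_mul, RCLike.norm_conj]
    have h := mul_le_mul_of_nonneg_left (hv.dist_le t t')
      (mul_nonneg (norm_nonneg (c t)) (norm_nonneg (c t')))
    linarith
  -- Cauchy–Schwarz turns the entrywise error `ε` into `ε * card T` times the sum of squares; this
  -- is where the constant in `small` comes from.
  have e4 : (∑ t ∈ A, ‖c t‖) ^ 2 ≤ Fintype.card T * ∑ t ∈ A, ‖c t‖ ^ 2 := by
    refine sq_sum_le_card_mul_sum_sq.trans ?_
    gcongr
    exact Finset.card_le_univ A
  have e5 : 0 < ∑ t ∈ A, (lam t - ε * Fintype.card T) * ‖c t‖ ^ 2 := by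
    refine Finset.sum_pos' (fun t ht => ?_) ⟨t₀, ht₀, ?_⟩
    · have := hv.small t
      rw [abs_of_pos (hA t ht)] at this
      exact mul_nonneg (by linarith) (by positivity)
    · have := hv.small t₀
      rw [abs_of_pos (hA t₀ ht₀)] at this
      exact mul_pos (by linarith) (by positivity)
  have e6 : ∑ t ∈ A, (lam t - ε * Fintype.card T) * ‖c t‖ ^ 2 =
      ∑ t ∈ A, lam t * ‖c t‖ ^ 2 - ε * (Fintype.card T * ∑ t ∈ A, ‖c t‖ ^ 2) := by
    rw [Finset.mul_sum, Finset.mul_sum, ← Finset.sum_sub_distrib]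
    exact Finset.sum_congr rfl fun t _ => by ring
  rw [e1]
  have e7 := (Complex.abs_re_le_norm _).trans e3
  rw [Complex.sub_re, Complex.ofReal_re] at e7
  have e8 := (abs_le.1 e7).1
  have e9 := mul_le_mul_of_nonneg_left e4 hε
  linarith

theorem posDef_span (hB : IsHermForm B) {A : Finset T} (hA : ∀ t ∈ A, 0 < lam t) :
    ∀ x ∈ Submodule.span ℂ (v '' A), x ≠ 0 → 0 < (B x x).re := by
  intro x hx h0
  obtain ⟨c, rfl⟩ := mem_span_image_finset.1 hx
  refine hv.pos_of_sum hB hA c ?_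
  by_contra! h
  exact h0 (Finset.sum_eq_zero fun t ht => by rw [h t ht, zero_smul])

theorem finrank_span_pos (hB : IsHermForm B) {A : Finset T} (hA : ∀ t ∈ A, 0 < lam t) :
    Module.finrank ℂ (Submodule.span ℂ (v '' A)) = A.card := by
  have h : LinearIndepOn ℂ v (A : Set T) := by
    rw [linearIndepOn_finset_iff]
    intro c hc
    by_contra! h
    have := hv.pos_of_sum hB hA c h
    rw [hc, hB.zero_left, Complex.zero_re] at this
    exact lt_irrefl _ this
  rw [Set.image_eq_range]
  simpa using finrank_span_eq_card h

theorem negDef_span (hB : IsHermForm B) {A : Finset T} (hA : ∀ t ∈ A, lam t < 0) :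
    ∀ x ∈ Submodule.span ℂ (v '' A), x ≠ 0 → (B x x).re < 0 := by
  intro x hx h0
  simpa using hv.neg.posDef_span hB.neg (A := A) (by simpa using hA) x hx h0

theorem finrank_span_neg (hB : IsHermForm B) {A : Finset T} (hA : ∀ t ∈ A, lam t < 0) :
    Module.finrank ℂ (Submodule.span ℂ (v '' A)) = A.card :=
  hv.neg.finrank_span_pos hB.neg (A := A) (by simpa using hA)

omit [AddCommGroup V] [Module ℂ V] in
theorem lam_ne_zero (t : T) : lam t ≠ 0 := by
  intro h
  have hε := (norm_nonneg _).trans (hv.dist_le t t)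
  have := hv.small t
  rw [h, abs_zero] at this
  have h2 : 0 ≤ ε * Fintype.card T := by positivity
  linarith

/-- The vectors with `lam > 0` and those with `lam < 0` span definite subspaces of full dimension,
and no `lam` vanishes. One bound `ε` serves all subfamilies at once, which is what makes the result
uniform along a flag. -/
theorem span_facts [FiniteDimensional ℂ V] (hB : IsHermForm B) (A : Finset T) :
    Module.finrank ℂ (Submodule.span ℂ (v '' A)) = A.card ∧
    NondegOn B (Submodule.span ℂ (v '' A)) ∧
    posIndex B (Submodule.span ℂ (v '' A)) = (A.filter fun t => 0 < lam t).card ∧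
    negIndex B (Submodule.span ℂ (v '' A)) = (A.filter fun t => lam t < 0).card := by
  have hp : ∀ t ∈ A.filter (fun t => 0 < lam t), 0 < lam t := by simp
  have hn : ∀ t ∈ A.filter (fun t => lam t < 0), lam t < 0 := by simp
  have hXU : Submodule.span ℂ (v '' (A.filter fun t => 0 < lam t)) ≤
      Submodule.span ℂ (v '' A) :=
    Submodule.span_mono (Set.image_mono (by exact_mod_cast Finset.filter_subset _ _))
  have hYU : Submodule.span ℂ (v '' (A.filter fun t => lam t < 0)) ≤
      Submodule.span ℂ (v '' A) :=
    Submodule.span_mono (Set.image_mono (by exact_mod_cast Finset.filter_subset _ _))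
  have hX := hv.posDef_span hB hp
  have hY := hv.negDef_span hB hn
  have hcard : A.card = (A.filter fun t => 0 < lam t).card +
      (A.filter fun t => lam t < 0).card := by
    rw [← Finset.card_union_of_disjoint]
    · congr 1
      ext t
      simp only [Finset.mem_union, Finset.mem_filter]
      constructor
      · intro ht
        have h0 := hv.lam_ne_zero t
        rcases lt_or_gt_of_ne h0 with h | h
        · exact Or.inr ⟨ht, h⟩
        · exact Or.inl ⟨ht, h⟩
      · rintro (h | h) <;> exact h.1
    · rw [Finset.disjoint_filter]
      intro t _ h1 h2
      exact lt_asymm h1 h2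
  have hle : Module.finrank ℂ (Submodule.span ℂ (v '' A)) ≤ A.card := by
    classical
    rw [← Finset.coe_image]
    exact (finrank_span_finset_le_card _).trans Finset.card_image_le
  have hXd := hv.finrank_span_pos hB hp
  have hYd := hv.finrank_span_neg hB hn
  have hd : Module.finrank ℂ (Submodule.span ℂ (v '' A)) ≤
      Module.finrank ℂ (Submodule.span ℂ (v '' (A.filter fun t => 0 < lam t))) +
      Module.finrank ℂ (Submodule.span ℂ (v '' (A.filter fun t => lam t < 0))) := by
    rw [hXd, hYd, ← hcard]
    exact hle
  refine ⟨le_antisymm hle ?_, hB.nondegOn_of_split hXU hYU hX hY hd, ?_, ?_⟩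
  · have h1 := IsHermForm.finrank_add_of_disjoint (IsHermForm.posDef_inf_negDef hX hY)
    have h2 := Submodule.finrank_mono (sup_le hXU hYU)
    omega
  · rw [IsHermForm.posIndex_eq hXU hYU hX hY hd, hXd]
  · rw [IsHermForm.negIndex_eq hXU hYU hX hY hd, hYd]

end NearDiagonal

/-! ### Orthogonal bases of nondegenerate subspaces. -/

namespace IsHermForm

variable {B : V → V → ℂ} (hB : IsHermForm B)

include hB

/-- Polarization: if all `B u u` vanish, then `re B u w = 0` for all `w`, and `w = i v` removes the
imaginary part. -/
theorem exists_self_ne_zero {U : Submodule ℂ V} (hU : NondegOn B U) (h0 : U ≠ ⊥) :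
    ∃ u ∈ U, (B u u).re ≠ 0 := by
  by_contra! h
  obtain ⟨u, hu, hu0⟩ := Submodule.exists_mem_ne_zero_of_ne_bot h0
  refine hu0 (hU u hu fun v hv => ?_)
  have hre : ∀ w ∈ U, (B u w).re = 0 := by
    intro w hw
    have h1 := h (u + w) (U.add_mem hu hw)
    rw [hB.add_left, hB.add_right, hB.add_right, ← hB.conj_symm u w] at h1
    simp only [Complex.add_re, Complex.conj_re, h u hu, h w hw] at h1
    linarith
  have h2 := hre _ (U.smul_mem Complex.I hv)
  rw [hB.smul_right] at h2
  simp at h2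
  exact Complex.ext (hre v hv) h2

/-- Gram–Schmidt for an indefinite form: split off a non-isotropic vector; its orthogonal complement
in `U` is again nondegenerate. -/
theorem exists_orthogonal_family [FiniteDimensional ℂ V] (n : ℕ) :
    ∀ U : Submodule ℂ V, Module.finrank ℂ U = n → NondegOn B U →
      ∃ e : Fin n → V, Submodule.span ℂ (Set.range e) = U ∧
        (∀ i j, i ≠ j → B (e i) (e j) = 0) ∧ ∀ i, (B (e i) (e i)).re ≠ 0 := by
  induction n with
  | zero =>
    intro U hU _
    refine ⟨fun i => i.elim0, ?_, fun i => i.elim0, fun i => i.elim0⟩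
    rw [Submodule.finrank_eq_zero.1 hU]
    simp
  | succ n ih =>
    intro U hU hnd
    have hU0 : U ≠ ⊥ := by
      rintro rfl
      simp at hU
    obtain ⟨u, hu, huu⟩ := hB.exists_self_ne_zero hnd hU0
    have huu' : B u u ≠ 0 := fun h => huu (by rw [h, Complex.zero_re])
    let U' : Submodule ℂ V := U ⊓ hB.orth (Submodule.span ℂ {u})
    have hU' : ∀ x, x ∈ U' ↔ x ∈ U ∧ B x u = 0 := by
      intro x
      rw [Submodule.mem_inf, hB.mem_orth]
      refine and_congr_right fun _ => ⟨fun h => h u (Submodule.mem_span_singleton_self u), ?_⟩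
      intro h y hy
      obtain ⟨c, rfl⟩ := Submodule.mem_span_singleton.1 hy
      rw [hB.smul_right, h, mul_zero]
    have hproj : ∀ x ∈ U, x - (B x u / B u u) • u ∈ U' := by
      intro x hx
      rw [hU']
      refine ⟨U.sub_mem hx (U.smul_mem _ hu), ?_⟩
      rw [sub_eq_add_neg, ← neg_smul, hB.add_left, hB.smul_left]
      field_simp
      ring
    have hsup : Submodule.span ℂ {u} ⊔ U' = U := by
      refine le_antisymm (sup_le ?_ inf_le_left) fun x hx => ?_
      · rw [Submodule.span_singleton_le_iff_mem]
        exact hu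
      · rw [← sub_add_cancel x ((B x u / B u u) • u), add_comm]
        exact Submodule.add_mem_sup (Submodule.smul_mem _ _ (Submodule.mem_span_singleton_self u))
          (hproj x hx)
    have hinf : Submodule.span ℂ {u} ⊓ U' = ⊥ := by
      rw [eq_bot_iff]
      rintro x ⟨hx1, hx2⟩
      obtain ⟨c, rfl⟩ := Submodule.mem_span_singleton.1 hx1
      have := ((hU' _).1 hx2).2
      rw [hB.smul_left] at this
      rw [Submodule.mem_bot, (mul_eq_zero.1 this).resolve_right huu', zero_smul]
    have hu0 : u ≠ 0 := by
      rintro rfl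
      exact huu' (hB.zero_left 0)
    have hdim : Module.finrank ℂ U' = n := by
      have h1 := finrank_add_of_disjoint hinf
      rw [hsup, hU, finrank_span_singleton hu0] at h1
      omega
    have hnd' : NondegOn B U' := by
      intro x hx h
      refine hnd x ((hU' x).1 hx).1 fun y hy => ?_
      have h1 := h _ (hproj y hy)
      rw [sub_eq_add_neg, ← neg_smul, hB.add_right, hB.smul_right, ((hU' x).1 hx).2] at h1
      simpa using h1
    obtain ⟨e, he1, he2, he3⟩ := ih U' hdim hnd'
    have heU : ∀ i, e i ∈ U' := fun i => he1 ▸ Submodule.subset_span ⟨i, rfl⟩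
    refine ⟨Fin.cons u e, ?_, ?_, ?_⟩
    · rw [Fin.range_cons, Submodule.span_insert, he1, hsup]
    · intro i j
      refine Fin.cases ?_ (fun i => ?_) i <;> refine Fin.cases ?_ (fun j => ?_) j
      · simp
      · intro _
        simpa using hB.eq_zero_comm ((hU' _).1 (heU j)).2
      · intro _
        simpa using ((hU' _).1 (heU i)).2
      · intro hij
        simpa using he2 i j fun h => hij (by rw [h])
    · intro i
      refine Fin.cases ?_ (fun i => ?_) i
      · simpa using huu
      · simpa using he3 i

/-- The exact case `ε = 0`, so that `span_facts` also computes signatures from an orthogonal basis.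
-/
theorem nearDiagonal_of_orthogonal {T : Type*} [Fintype T] [DecidableEq T] {e : T → V}
    (h1 : ∀ i j, i ≠ j → B (e i) (e j) = 0) (h2 : ∀ i, (B (e i) (e i)).re ≠ 0) :
    NearDiagonal B e (fun i => (B (e i) (e i)).re) 0 where
  dist_le t t' := by
    split_ifs with h
    · subst h
      rw [← hB.self_eq_re, sub_self, norm_zero]
    · rw [h1 t t' h, sub_zero, norm_zero]
  small t := by simpa using h2 t

theorem posIndex_add_negIndex [FiniteDimensional ℂ V] {U : Submodule ℂ V} (hU : NondegOn B U) :
    posIndex B U + negIndex B U = Module.finrank ℂ U := by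
  obtain ⟨e, he, h1, h2⟩ := hB.exists_orthogonal_family _ U rfl hU
  obtain ⟨h3, -, h4, h5⟩ := (hB.nearDiagonal_of_orthogonal h1 h2).span_facts hB Finset.univ
  rw [Finset.coe_univ, Set.image_univ, he] at h3 h4 h5
  rw [h4, h5, ← Finset.card_union_of_disjoint]
  · refine Eq.trans (congrArg _ ?_) h3.symm
    ext t
    simpa using (h2 t).symm.lt_or_gt
  · rw [Finset.disjoint_filter]
    intro t _ h1 h2
    exact lt_asymm h1 h2

theorem posDef_of_negIndex_eq_zero [FiniteDimensional ℂ V] {U : Submodule ℂ V}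
    (hU : NondegOn B U) (h : negIndex B U = 0) : ∀ u ∈ U, u ≠ 0 → 0 < (B u u).re := by
  have h1 := hB.posIndex_add_negIndex hU
  obtain ⟨X, hX, h2, h3⟩ := exists_posDef B U
  have : X = U := Submodule.eq_of_le_of_finrank_le hX (by omega)
  rwa [this] at h3

omit hB in
theorem negIndex_eq_zero {U : Submodule ℂ V} (h : ∀ u ∈ U, u ≠ 0 → 0 < (B u u).re) :
    negIndex B U = 0 := by
  have : {n : ℕ | ∃ X : Submodule ℂ V, X ≤ U ∧ Module.finrank ℂ X = n ∧
      ∀ x ∈ X, x ≠ 0 → (B x x).re < 0} = {0} := by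
    ext n
    constructor
    · rintro ⟨X, hXU, rfl, hX⟩
      have : X = ⊥ := by
        rw [eq_bot_iff]
        intro x hx
        by_contra h0
        exact lt_asymm (h x (hXU hx) h0) (hX x hx h0)
      rw [this, finrank_bot, Set.mem_singleton_iff]
    · rintro rfl
      exact ⟨⊥, bot_le, by simp, by simp⟩
  rw [negIndex, this, csSup_singleton]

end IsHermForm

end Hermitian

section Lifts

variable {H : Type*} [AddCommGroup H] [Module ℂ H] {d : ℕ} {σ : H →ₛₗ[starRingEnd ℂ] H}
  {W F : ℤ → Submodule ℂ H} {N : Module.End ℂ H} {S : H →ₗ[ℂ] H →ₗ[ℂ] ℂ}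

/-! ### Statements about graded pieces, lifted to `H` -/

theorem grMk_eq_iff {k : ℤ} {x y : W k} :
    grMk W k x = grMk W k y ↔ (x : H) - y ∈ W (k - 1) :=
  Submodule.Quotient.eq ((W (k - 1)).submoduleOf (W k))

theorem grMk_eq_zero_iff {k : ℤ} {x : W k} : grMk W k x = 0 ↔ (x : H) ∈ W (k - 1) :=
  Submodule.Quotient.mk_eq_zero ((W (k - 1)).submoduleOf (W k))

theorem mem_grImage_iff {k : ℤ} {Y : Submodule ℂ H} {x : W k} :
    grMk W k x ∈ grImage W k Y ↔ ∃ y ∈ Y, y ∈ W k ∧ (x : H) - y ∈ W (k - 1) := by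
  constructor
  · rintro ⟨y, hy, hxy⟩
    exact ⟨y, hy, y.2, grMk_eq_iff.1 hxy.symm⟩
  · rintro ⟨y, hy, hyk, hxy⟩
    exact ⟨⟨y, hyk⟩, hy, (grMk_eq_iff.2 hxy).symm⟩

theorem mem_map_grConj_iff {hW : ∀ k, ∀ u ∈ W k, σ u ∈ W k} {k : ℤ} {Y : Submodule ℂ H}
    {x : W k} : grMk W k x ∈ (grImage W k Y).map (grConj σ W hW k) ↔
      ∃ y ∈ Y, y ∈ W k ∧ (x : H) - σ y ∈ W (k - 1) := by
  constructor
  · rintro ⟨z, ⟨y, hy, rfl⟩, hz⟩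
    exact ⟨y, hy, y.2, (grMk_eq_iff (x := x) (y := ⟨σ y, hW k y y.2⟩)).1 hz.symm⟩
  · rintro ⟨y, hy, hyk, hxy⟩
    exact ⟨grMk W k ⟨y, hyk⟩, ⟨⟨y, hyk⟩, hy, rfl⟩,
      (grMk_eq_iff (x := x) (y := ⟨σ y, hW k y hyk⟩)).2 hxy |>.symm⟩

/-- The spanning half of opposedness on `Gr^W_k`, expressed with representatives in `H`;
`IsMHS.disjoint` is the other half. -/
theorem IsMHS.split (h : IsMHS σ W F) (k p : ℤ) {x : H} (hx : x ∈ W k) :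
    ∃ x₁ ∈ F p, x₁ ∈ W k ∧ ∃ x₂ ∈ F (k - p + 1), x₂ ∈ W k ∧ x - x₁ - σ x₂ ∈ W (k - 1) := by
  have h1 := (h.pure k).opposed p
  have h2 : grMk W k ⟨x, hx⟩ ∈ grImage W k (F p) ⊔
      (grImage W k (F (k - p + 1))).map (grConj σ W h.W_real k) := by
    rw [h1.sup_eq_top]
    trivial
  obtain ⟨y, ⟨x₁, hx₁, rfl⟩, z, hz, hyz⟩ := Submodule.mem_sup.1 h2
  obtain ⟨w, rfl⟩ := Submodule.mkQ_surjective _ z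
  obtain ⟨x₂, hx₂, hx₂k, h3⟩ := mem_map_grConj_iff.1 hz
  refine ⟨x₁, hx₁, x₁.2, x₂, hx₂, hx₂k, ?_⟩
  have h4 : grMk W k (x₁ + w) = grMk W k ⟨x, hx⟩ := by rw [map_add]; exact hyz
  have h5 := grMk_eq_iff.1 h4
  have e : x - x₁ - σ x₂ = ((w : H) - σ x₂) - (((x₁ + w : W k) : H) - x) := by
    push_cast
    abel
  rw [e]
  exact sub_mem h3 h5

theorem IsMHS.disjoint (h : IsMHS σ W F) {k p q : ℤ} (hpq : p + q = k + 1) {x x' : H}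
    (hx : x ∈ F p) (hxk : x ∈ W k) (hx' : x' ∈ F q) (hxk' : x' ∈ W k)
    (hxx : x - σ x' ∈ W (k - 1)) : x ∈ W (k - 1) := by
  obtain rfl : q = k - p + 1 := by omega
  have h1 := ((h.pure k).opposed p).inf_eq_bot
  have h2 : grMk W k ⟨x, hxk⟩ ∈ grImage W k (F p) ⊓
      (grImage W k (F (k - p + 1))).map (grConj σ W h.W_real k) :=
    ⟨mem_grImage_iff.2 ⟨x, hx, hxk, by simp⟩, mem_map_grConj_iff.2 ⟨x', hx', hxk', hxx⟩⟩
  rw [h1, Submodule.mem_bot, grMk_eq_zero_iff] at h2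
  exact h2

theorem IsMHS.conj_sub_mem (h : IsMHS σ W F) {k : ℤ} {x y : H} (hxy : x - σ y ∈ W k) :
    y - σ x ∈ W k := by
  have := (W k).neg_mem (h.W_real k _ hxy)
  rwa [map_sub, h.conj_conj, neg_sub] at this

theorem pow_mem_F (h : SituationA d σ W F N) (l : ℕ) :
    ∀ p, ∀ u ∈ F p, (N ^ l) u ∈ F (p - l) := by
  induction l with
  | zero => intro p u hu; simpa using hu
  | succ l ih =>
    intro p u hu
    have := h.N_F _ _ (ih p u hu)
    rw [pow_succ', Module.End.mul_apply]
    convert this using 2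
    push_cast
    ring

theorem pow_conj (h : SituationA d σ W F N) (l : ℕ) (u : H) : (N ^ l) (σ u) = σ ((N ^ l) u) := by
  induction l with
  | zero => simp
  | succ l ih => rw [pow_succ', Module.End.mul_apply, ih, h.N_real, Module.End.mul_apply]

theorem pow_mem_W (h : SituationA d σ W F N) (l : ℕ) {i j : ℤ} (hij : i - 2 * l ≤ j) {u : H}
    (hu : u ∈ W i) : (N ^ l) u ∈ W j :=
  h.mhs.W_mono hij (pow_mem_of_mem h.N_W l i u hu)

/-- `N ^ m : Gr_{d+m} → Gr_{d-m}` is strictly compatible with the Hodge filtrations. -/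
theorem SituationA.strict (h : SituationA d σ W F N) (m : ℕ) (p : ℤ) {x : H}
    (hx : x ∈ F (p - m)) (hxW : x ∈ W ((d : ℤ) - m)) :
    ∃ w ∈ F p, w ∈ W ((d : ℤ) + m) ∧ x - (N ^ m) w ∈ W ((d : ℤ) - m - 1) := by
  obtain ⟨w₀, hw₀, rfl⟩ := h.weight.exists_preimage m x hxW
  obtain ⟨w₁, hw₁, hw₁W, w₂, hw₂, hw₂W, h3⟩ := h.mhs.split _ p hw₀
  refine ⟨w₁, hw₁, hw₁W, ?_⟩
  have h4 := pow_mem_W h m (j := (d : ℤ) - m - 1) (by omega) h3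
  rw [map_sub, map_sub, pow_conj h] at h4
  -- Modulo lower weight, `x - N^m w₁` lies in `F^{p-m}` and in the conjugate of `F^{d-p+1}`; these
  -- levels sum to `(d-m) + 1`, so the class vanishes.
  refine h.mhs.disjoint (p := p - m) (q := d + m - p + 1 - m) (by ring)
    (sub_mem hx (pow_mem_F h m _ _ hw₁)) (sub_mem hxW (pow_mem_W h m (by omega) hw₁W))
    (pow_mem_F h m _ _ hw₂) (pow_mem_W h m (by omega) hw₂W) h4

/-! ### Primitive elements -/

/-- The elements of `F^a ∩ W_{d+l}` whose class in `Gr_{d+l}` is primitive. -/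
def primF (d : ℕ) (W F : ℤ → Submodule ℂ H) (N : Module.End ℂ H) (l : ℕ) (a : ℤ) :
    Submodule ℂ H :=
  F a ⊓ W (d + l) ⊓ (W ((d : ℤ) - l - 3)).comap (N ^ (l + 1))

theorem mem_primF {l : ℕ} {a : ℤ} {x : H} : x ∈ primF d W F N l a ↔
    (x ∈ F a ∧ x ∈ W (d + l)) ∧ (N ^ (l + 1)) x ∈ W ((d : ℤ) - l - 3) := Iff.rfl

/-- The elements of `F^a ∩ W_{d+l}` whose class in `Gr_{d+l}` is primitive and of type `(a, b)`. -/
structure IsPrimLift (d : ℕ) (σ : H →ₛₗ[starRingEnd ℂ] H) (W F : ℤ → Submodule ℂ H)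
    (N : Module.End ℂ H) (l : ℕ) (a b : ℤ) (x : H) : Prop where
  mem : x ∈ primF d W F N l a
  conj : ∃ x' ∈ F b, x' ∈ W (d + l) ∧ x - σ x' ∈ W (d + l - 1)

/-- The primitive part is a sub-Hodge structure. Splitting `x` in `Gr_{d+l}` and applying `N^{l+1}`
gives two opposite pieces of `Gr_{d-l-2}` with sum zero, so each piece is primitive by itself. -/
theorem SituationA.prim_split (h : SituationA d σ W F N) {l : ℕ} {p : ℤ} {x : H}
    (hx : x ∈ primF d W F N l p) :
    ∃ x₁ x₂, IsPrimLift d σ W F N l p (d + l - p) x₁ ∧ x₂ ∈ primF d W F N l (p + 1) ∧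
      x = x₁ + x₂ := by
  obtain ⟨⟨hxF, hxW⟩, hxN⟩ := mem_primF.1 hx
  obtain ⟨x₂, hx₂, hx₂W, y, hy, hyW, h3⟩ := h.mhs.split _ (p + 1) hxW
  have e1 : (d : ℤ) + l - (p + 1) + 1 = d + l - p := by ring
  rw [e1] at hy
  have h4 := pow_mem_W h (l + 1) (j := (d : ℤ) - l - 3) (by push_cast; omega) h3
  rw [map_sub, map_sub, pow_conj h] at h4
  have h5 : (N ^ (l + 1)) x₂ ∈ W ((d : ℤ) - l - 2 - 1) := by
    refine h.mhs.disjoint (p := p + 1 - (l + 1 : ℕ)) (q := d + l - p - (l + 1 : ℕ))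
      (x' := -(N ^ (l + 1)) y)
      (by push_cast; ring) (pow_mem_F h (l + 1) _ _ hx₂) (pow_mem_W h _ (by push_cast; omega) hx₂W)
      (neg_mem (pow_mem_F h (l + 1) _ _ hy)) (neg_mem (pow_mem_W h _ (by push_cast; omega) hyW)) ?_
    have e2 : (d : ℤ) - l - 2 - 1 = d - l - 3 := by ring
    rw [e2]
    have := sub_mem hxN h4
    convert this using 1
    rw [map_neg]
    abel
  have e2 : (d : ℤ) - l - 2 - 1 = d - l - 3 := by ring
  rw [e2] at h5
  refine ⟨x - x₂, x₂, ⟨mem_primF.2 ⟨⟨sub_mem hxF (h.mhs.F_anti (by omega) hx₂),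
    sub_mem hxW hx₂W⟩, ?_⟩, y, hy, hyW, h3⟩, mem_primF.2 ⟨⟨hx₂, hx₂W⟩, h5⟩, by abel⟩
  rw [map_sub]
  exact sub_mem hxN h5

/-- One step of the Lefschetz decomposition, compatible with `F`: strictness of `N^{l+2}` produces
`w` with `N^{l+2} w ≡ N^{l+1} x`, without loss of Hodge level. -/
theorem SituationA.exists_primF_sub (h : SituationA d σ W F N) {l : ℕ} {p : ℤ} {x : H}
    (hx : x ∈ F p) (hxW : x ∈ W (d + l)) :
    ∃ w ∈ F (p + 1), w ∈ W (d + (l + 2 : ℕ)) ∧ x - N w ∈ primF d W F N l p := by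
  have e1 : (d : ℤ) - (l + 2 : ℕ) = d + l - 2 * (l + 1 : ℕ) := by push_cast; ring
  obtain ⟨w, hw, hwW, h3⟩ := h.strict (l + 2) (p + 1) (x := (N ^ (l + 1)) x)
    (by
      have := pow_mem_F h (l + 1) _ _ hx
      convert this using 2
      push_cast
      ring)
    (pow_mem_W h (l + 1) e1.ge hxW)
  refine ⟨w, hw, hwW, mem_primF.2 ⟨⟨sub_mem hx ?_, sub_mem hxW ?_⟩, ?_⟩⟩
  · have := h.N_F _ _ hw
    rwa [add_sub_cancel_right] at this
  · exact h.mhs.W_mono (by push_cast; omega) (h.N_W _ _ hwW)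
  · have e2 : (N ^ (l + 2)) w = (N ^ (l + 1)) (N w) := by
      rw [← Module.End.mul_apply, ← pow_succ]
    have e3 : (d : ℤ) - l - 3 = d - (l + 2 : ℕ) - 1 := by push_cast; ring
    rw [map_sub, ← e2, e3]
    exact h3

theorem SituationA.F_eq_bot_induction (h : SituationA d σ W F N) {motive : ℤ → Prop}
    (bot : ∀ p, F p = ⊥ → motive p) (step : ∀ p, motive (p + 1) → motive p) (p : ℤ) :
    motive p := by
  obtain ⟨b, hb⟩ := h.mhs.F_bot
  have key : ∀ n : ℕ, ∀ p, b - n ≤ p → motive p := by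
    intro n
    induction n with
    | zero =>
      intro p hp
      exact bot p (eq_bot_iff.2 (hb ▸ h.mhs.F_anti (by simpa using hp)))
    | succ n ih =>
      intro p hp
      exact step p (ih (p + 1) (by push_cast at hp; omega))
  exact key (b - p).toNat p (by omega)

end Lifts

section Duality

variable {H : Type*} [AddCommGroup H] [Module ℂ H] {d : ℕ} {σ : H →ₛₗ[starRingEnd ℂ] H}
  {W F : ℤ → Submodule ℂ H} {N : Module.End ℂ H} {S : H →ₗ[ℂ] H →ₗ[ℂ] ℂ}

/-! ### Duality for the weight and Hodge filtrations -/

theorem finrank_gr_add [FiniteDimensional ℂ H] (hW : Monotone W) (k : ℤ) :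
    Module.finrank ℂ (Gr W k) + Module.finrank ℂ (W (k - 1)) = Module.finrank ℂ (W k) := by
  rw [← Submodule.finrank_quotient_add_finrank ((W (k - 1)).submoduleOf (W k))]
  congr 1
  exact (Submodule.comapSubtypeEquivOfLe (hW (by omega))).finrank_eq.symm

/-- The isomorphisms `Gr_{d+l} ≃ Gr_{d-l}` make the sum independent of `m`. Together with `S_weight`
this identifies `W_{2d-m-1}` with the full orthogonal of `W_m`. -/
theorem SituationA.finrank_W_add [FiniteDimensional ℂ H] (h : SituationA d σ W F N) (m : ℤ) :
    Module.finrank ℂ (W m) + Module.finrank ℂ (W (2 * d - m - 1)) = Module.finrank ℂ H := by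
  have step : ∀ l : ℕ, Module.finrank ℂ (W ((d : ℤ) + l)) + Module.finrank ℂ (W ((d : ℤ) - l - 1)) =
      Module.finrank ℂ (W ((d : ℤ) + l - 1)) + Module.finrank ℂ (W ((d : ℤ) - l)) := by
    intro l
    have h1 := finrank_gr_add h.mhs.W_mono ((d : ℤ) + l)
    have h2 := finrank_gr_add h.mhs.W_mono ((d : ℤ) + l - 2 * l)
    have h3 := (LinearEquiv.ofBijective _ (h.weight.bijective l)).finrank_eq
    have e : (d : ℤ) + l - 2 * l = d - l := by ring
    rw [← h3, e] at h2
    omega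
  obtain ⟨a, ha⟩ := h.mhs.W_bot
  obtain ⟨b, hb⟩ := h.mhs.W_top
  have key : ∀ n l : ℕ, b ≤ d + l + n → (d : ℤ) - l - n - 1 ≤ a →
      Module.finrank ℂ (W ((d : ℤ) + l)) + Module.finrank ℂ (W ((d : ℤ) - l - 1)) =
        Module.finrank ℂ H := by
    intro n
    induction n with
    | zero =>
      intro l h1 h2
      have e1 : W ((d : ℤ) + l) = ⊤ := eq_top_iff.2 (hb ▸ h.mhs.W_mono (by simpa using h1))
      have e2 : W ((d : ℤ) - l - 1) = ⊥ := eq_bot_iff.2 (ha ▸ h.mhs.W_mono (by simpa using h2))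
      rw [e1, e2, finrank_bot, finrank_top, add_zero]
    | succ n ih =>
      intro l h1 h2
      have h3 := ih (l + 1) (by push_cast at h1 ⊢; omega) (by push_cast at h2 ⊢; omega)
      rw [step (l + 1)] at h3
      convert h3 using 4 <;> push_cast <;> ring_nf
  have main : ∀ l : ℕ, Module.finrank ℂ (W ((d : ℤ) + l)) + Module.finrank ℂ (W ((d : ℤ) - l - 1)) =
      Module.finrank ℂ H := fun l =>
    key ((b - (d + l)).toNat + (d - l - 1 - a).toNat) l (by push_cast; omega) (by push_cast; omega)
  rcases le_or_gt (d : ℤ) m with hm | hm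
  · have h1 := main (m - d).toNat
    have e1 : (d : ℤ) + (m - d).toNat = m := by omega
    have e2 : (d : ℤ) - (m - d).toNat - 1 = 2 * d - m - 1 := by omega
    rwa [e1, e2] at h1
  · have h1 := main (d - m - 1).toNat
    have e1 : (d : ℤ) + (d - m - 1).toNat = 2 * d - m - 1 := by omega
    have e2 : (d : ℤ) - (d - m - 1).toNat - 1 = m := by omega
    rw [e1, e2] at h1
    omega

theorem SituationB.S_eq_zero_comm (h : SituationB d σ W F N S) {u v : H} (huv : S u v = 0) :
    S v u = 0 := by
  rw [h.S_symm u v, huv, mul_zero]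

theorem SituationB.mem_orthogonal_iff (h : SituationB d σ W F N S) {U : Submodule ℂ H} {x : H} :
    x ∈ LinearMap.BilinForm.orthogonal S U ↔ ∀ y ∈ U, S x y = 0 :=
  ⟨fun hx y hy => h.S_eq_zero_comm (hx y hy), fun hx y hy => h.S_eq_zero_comm (hx y hy)⟩

theorem SituationB.finrank_orthogonal [FiniteDimensional ℂ H] (h : SituationB d σ W F N S)
    (U : Submodule ℂ H) : Module.finrank ℂ (LinearMap.BilinForm.orthogonal S U) =
      Module.finrank ℂ H - Module.finrank ℂ U :=
  LinearMap.BilinForm.finrank_orthogonal h.S_nondeg U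

theorem SituationB.mem_W_of_orthogonal [FiniteDimensional ℂ H] (h : SituationB d σ W F N S)
    {m : ℤ} {x : H} (hx : ∀ y ∈ W m, S x y = 0) : x ∈ W (2 * d - m - 1) := by
  have h1 := h.finrank_W_add m
  have h2 := h.finrank_orthogonal (W m)
  have h3 : W (2 * d - m - 1) = LinearMap.BilinForm.orthogonal S (W m) := by
    refine Submodule.eq_of_le_of_finrank_le (fun y hy => ?_) (by omega)
    exact h.mem_orthogonal_iff.2 fun z hz => h.S_weight (by omega) hy hz
  rw [h3]
  exact h.mem_orthogonal_iff.2 hx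

theorem SituationB.S_eq_zero_of_F (h : SituationB d σ W F N S) {a b : ℤ} (hab : (d : ℤ) < a + b)
    {u v : H} (hu : u ∈ F a) (hv : v ∈ F b) : S u v = 0 :=
  h.S_isotropic a u hu v (h.mhs.F_anti (by omega) hv)

theorem SituationA.W_eq_bot_induction (h : SituationA d σ W F N) {motive : ℤ → Prop}
    (bot : ∀ k, W k = ⊥ → motive k) (step : ∀ k, motive (k - 1) → motive k) (k : ℤ) :
    motive k := by
  obtain ⟨a, ha⟩ := h.mhs.W_bot
  have key : ∀ n : ℕ, ∀ k, k ≤ a + n → motive k := by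
    intro n
    induction n with
    | zero =>
      intro p hp
      exact bot p (eq_bot_iff.2 (ha ▸ h.mhs.W_mono (by simpa using hp)))
    | succ n ih =>
      intro p hp
      exact step p (ih (p - 1) (by push_cast at hp; omega))
  exact key (k - a).toNat k (by omega)

/-- The assumption `S(F^p, F^{d-p+1}) = 0` gives only one inclusion; its converse follows by
induction on the weight, as each `Gr^W_k` carries a pure structure. -/
theorem SituationB.mem_F_of_orthogonal [FiniteDimensional ℂ H] (h : SituationB d σ W F N S)
    {p : ℤ} {x : H} (hx : ∀ y ∈ F p, S x y = 0) : x ∈ F (d - p + 1) := by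
  have key : ∀ k : ℤ, ∀ x ∈ W k, (∀ y ∈ F p, S x y = 0) → x ∈ F (d - p + 1) := by
    refine h.W_eq_bot_induction ?_ ?_
    · intro k hk x hx _
      rw [hk, Submodule.mem_bot] at hx
      rw [hx]
      exact zero_mem _
    · intro k ih x hxk hx
      obtain ⟨x₁, hx₁, hx₁k, x₂, hx₂, hx₂k, h3⟩ := h.mhs.split k (d - p + 1) hxk
      have h1 : ∀ y ∈ F p, S (x - x₁) y = 0 := by
        intro y hy
        rw [map_sub, LinearMap.sub_apply, hx y hy, h.S_eq_zero_of_F (by omega) hx₁ hy, sub_zero]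
      -- Test `σ x₂` against `y = y₁ + σ y₂ + lower` in `W_{2d-k}`: `y₁ ∈ F^p` is handled by the
      -- orthogonality of `x - x₁`, and `y₂` by isotropy, as the levels of `x₂` and `y₂` sum to `d +
      -- 1`.
      have h2 : σ x₂ ∈ W (2 * d - (2 * d - k) - 1) := by
        refine h.mem_W_of_orthogonal fun y hy => ?_
        obtain ⟨y₁, hy₁, hy₁k, y₂, hy₂, hy₂k, h4⟩ := h.mhs.split _ p hy
        have e : y = (y - y₁ - σ y₂) + y₁ + σ y₂ := by abel
        have e2 : σ x₂ = (x - x₁) - (x - x₁ - σ x₂) := by abel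
        rw [e, map_add, map_add, h.S_weight (by omega) (h.mhs.W_real _ _ hx₂k) h4, h.S_real,
          h.S_eq_zero_of_F (by omega) hx₂ hy₂, map_zero, zero_add, add_zero, e2, map_sub,
          LinearMap.sub_apply, h1 y₁ hy₁, h.S_weight (by omega) h3 hy₁k, sub_zero]
      have e : x = (x - x₁) + x₁ := by abel
      rw [e]
      refine add_mem (ih _ ?_ h1) hx₁
      have e3 : 2 * (d : ℤ) - (2 * d - k) - 1 = k - 1 := by ring
      rw [e3] at h2
      simpa using add_mem h3 h2
  obtain ⟨b, hb⟩ := h.mhs.W_top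
  exact key b x (by rw [hb]; trivial) hx

/-! ### The Hermitian form on primitive elements -/

theorem IsPrimLift.exists_conj (h : SituationA d σ W F N) {l : ℕ} {a b : ℤ} {x : H}
    (hx : IsPrimLift d σ W F N l a b x) :
    ∃ x', IsPrimLift d σ W F N l b a x' ∧ x - σ x' ∈ W (d + l - 1) ∧ x' - σ x ∈ W (d + l - 1) := by
  obtain ⟨x', hx', hx'W, h1⟩ := hx.conj
  obtain ⟨⟨h2, h3⟩, h4⟩ := mem_primF.1 hx.mem
  have h5 := h.mhs.conj_sub_mem h1
  refine ⟨x', ⟨mem_primF.2 ⟨⟨hx', hx'W⟩, ?_⟩, x, h2, h3, h5⟩, h1, h5⟩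
  have h6 := pow_mem_W h (l + 1) (j := (d : ℤ) - l - 3) (by push_cast; omega) h5
  rw [map_sub, pow_conj h] at h6
  simpa using add_mem h6 (h.mhs.W_real _ _ h4)

theorem SituationB.S_pow_congr (h : SituationB d σ W F N S) {l : ℕ} {x y y' : H}
    (hx : x ∈ W (d + l)) (hy : y - y' ∈ W (d + l - 1)) : S x ((N ^ l) y) = S x ((N ^ l) y') := by
  rw [← sub_eq_zero, ← map_sub, ← map_sub]
  exact h.S_weight (by omega) hx (pow_mem_W h.toSituationA l le_rfl hy)

/-- For `a' < a`, replace `σ y` by a lift in `F^{b'}`; then `a + b' - l > d` and isotropy applies.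
The other order follows by symmetry and conjugation. -/
theorem SituationB.S_prim_eq_zero (h : SituationB d σ W F N S) {l : ℕ} {a b a' b' : ℤ}
    (hab : a + b = d + l) (hab' : a' + b' = d + l) (hne : a ≠ a') {x y : H}
    (hx : IsPrimLift d σ W F N l a b x) (hy : IsPrimLift d σ W F N l a' b' y) :
    S x ((N ^ l) (σ y)) = 0 := by
  have key : ∀ {a b a' b' : ℤ}, a + b = d + l → a' + b' = d + l → a' < a → ∀ {x y : H},
      IsPrimLift d σ W F N l a b x → IsPrimLift d σ W F N l a' b' y →
      S x ((N ^ l) (σ y)) = 0 := by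
    intro a b a' b' hab hab' hlt x y hx hy
    obtain ⟨y', hy', -, h1⟩ := hy.exists_conj h.toSituationA
    obtain ⟨⟨h2, h3⟩, -⟩ := mem_primF.1 hx.mem
    rw [← h.S_pow_congr h3 h1]
    exact h.S_eq_zero_of_F (by omega) h2 (pow_mem_F h.toSituationA l _ _ (mem_primF.1 hy'.mem).1.1)
  rcases lt_or_gt_of_ne hne with hlt | hlt
  · have h1 := key hab' hab hlt hy hx
    rw [pow_conj h.toSituationA, ← h.mhs.conj_conj y, h.S_real, map_eq_zero] at h1
    have h2 := h.S_pow l x (σ y)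
    rw [h.S_symm, h1, mul_zero] at h2
    exact (mul_eq_zero.1 h2.symm).resolve_left (pow_ne_zero _ (by norm_num))
  · exact key hab hab' hlt hx hy

theorem SituationB.S_primF_eq_zero (h : SituationB d σ W F N S) {l : ℕ} {a b : ℤ}
    (hab : a + b = d + l) {x : H} (hx : IsPrimLift d σ W F N l a b x)
    (horth : ∀ v, IsPrimLift d σ W F N l a b v → S x ((N ^ l) (σ v)) = 0) (p : ℤ) :
    ∀ w ∈ primF d W F N l p, S x ((N ^ l) w) = 0 := by
  refine h.F_eq_bot_induction
    (motive := fun p => ∀ w ∈ primF d W F N l p, S x ((N ^ l) w) = 0) ?_ ?_ p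
  · intro p hp w hw
    have := (mem_primF.1 hw).1.1
    rw [hp, Submodule.mem_bot] at this
    rw [this, map_zero, map_zero]
  · intro p ih w hw
    obtain ⟨w₁, w₂, h1, h2, rfl⟩ := h.prim_split hw
    rw [map_add, map_add, ih w₂ h2, add_zero]
    obtain ⟨w', hw', h3, -⟩ := h1.exists_conj h.toSituationA
    rw [h.S_pow_congr (mem_primF.1 hx.mem).1.2 h3]
    by_cases hpa : (d : ℤ) + l - p = a
    · have hpb : p = b := by omega
      rw [hpa, hpb] at hw'
      exact horth _ hw'
    · exact h.S_prim_eq_zero hab (by ring) (Ne.symm hpa) hx hw'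

/-- Every element of `W_{d-l}` is `N^l w` with `w` a primitive element plus some `N w₁`. The first
part is killed by `S_primF_eq_zero`, the second because `N^{l+1} x` has too low a weight. Hence `x`
is orthogonal to `W_{d-l}`. -/
theorem SituationB.prim_nondegenerate [FiniteDimensional ℂ H] (h : SituationB d σ W F N S) {l : ℕ}
    {a b : ℤ} (hab : a + b = d + l) {x : H} (hx : IsPrimLift d σ W F N l a b x)
    (horth : ∀ v, IsPrimLift d σ W F N l a b v → S x ((N ^ l) (σ v)) = 0) :
    x ∈ W (d + l - 1) := by
  obtain ⟨q, hq⟩ := h.mhs.F_top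
  have h1 : ∀ y ∈ W ((d : ℤ) - l), S x y = 0 := by
    intro y hy
    obtain ⟨w, hw, rfl⟩ := h.weight.exists_preimage l y hy
    obtain ⟨w₁, hw₁, hw₁W, h2⟩ :=
      h.exists_primF_sub (p := q) (x := w) (by rw [hq]; trivial) hw
    have h3 := h.S_primF_eq_zero hab hx horth q _ h2
    have h4 : S ((N ^ (l + 1)) x) w₁ = 0 :=
      h.S_weight (by push_cast; omega) (mem_primF.1 hx.mem).2 hw₁W
    rw [h.S_pow] at h4
    have h5 := (mul_eq_zero.1 h4).resolve_left (pow_ne_zero _ (by norm_num))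
    rw [pow_succ, Module.End.mul_apply] at h5
    rw [map_sub, map_sub, h5, sub_zero] at h3
    exact h3
  have h2 := h.mem_W_of_orthogonal h1
  convert h2 using 2
  ring

end Duality

/-! ### Frames of primitive elements -/

theorem isHermForm_weilForm {V : Type*} [AddCommGroup V] [Module ℂ V]
    {σ : V →ₛₗ[starRingEnd ℂ] V} {B : V →ₗ[ℂ] V →ₗ[ℂ] ℂ} {p q : ℤ}
    (hσ : ∀ u, σ (σ u) = u) (hreal : ∀ u v, B (σ u) (σ v) = starRingEnd ℂ (B u v))
    (hsymm : ∀ u v, B v u = (-1) ^ (p - q) * B u v) : IsHermForm (weilForm σ B p q) where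
  add_left u v w := by simp [weilForm]
  smul_left c u w := by
    simp only [weilForm, map_smul, LinearMap.smul_apply, smul_eq_mul]
    ring
  conj_symm u v := by
    simp only [weilForm, map_smul, LinearMap.smul_apply, smul_eq_mul, map_mul]
    rw [← hreal, hσ, hsymm v, map_zpow₀, Complex.conj_I, ← mul_assoc, ← mul_zpow]
    simp

section Frame

variable {H : Type*} [AddCommGroup H] [Module ℂ H] {d : ℕ} {σ : H →ₛₗ[starRingEnd ℂ] H}
  {W F : ℤ → Submodule ℂ H} {N : Module.End ℂ H} {S : H →ₗ[ℂ] H →ₗ[ℂ] ℂ}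

theorem SituationB.weilForm_grMk (h : SituationB d σ W F N S) {a b : ℤ} {l : ℕ}
    (hab : a + b = d + l) (x y : W (a + b)) :
    weilForm (grConj σ W h.mhs.W_real (a + b)) (h.grForm (a + b)) a b (grMk W _ x) (grMk W _ y) =
      Complex.I ^ (a - b) * S x ((N ^ l) (σ y)) := by
  have hl : (a + b - d).toNat = l := by omega
  rw [← hl]
  simp only [weilForm, map_smul, LinearMap.smul_apply, smul_eq_mul]
  rfl

theorem SituationB.isHermForm_gr (h : SituationB d σ W F N S) {a b : ℤ} {l : ℕ}
    (hab : a + b = d + l) :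
    IsHermForm (weilForm (grConj σ W h.mhs.W_real (a + b)) (h.grForm (a + b)) a b) := by
  have hl : (a + b - d).toNat = l := by omega
  have hform : ∀ x y : W (a + b), h.grForm (a + b) (grMk W _ x) (grMk W _ y) =
      S x ((N ^ l) y) := by
    intro x y
    rw [← hl]
    rfl
  refine isHermForm_weilForm ?_ ?_ ?_
  · intro u
    obtain ⟨x, rfl⟩ := Submodule.mkQ_surjective _ u
    refine (grMk_eq_iff (x := ⟨σ (σ x), h.mhs.W_real _ _ (h.mhs.W_real _ _ x.2)⟩) (y := x)).2 ?_
    simp [h.mhs.conj_conj]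
  · intro u v
    obtain ⟨x, rfl⟩ := Submodule.mkQ_surjective _ u
    obtain ⟨y, rfl⟩ := Submodule.mkQ_surjective _ v
    refine (hform ⟨σ x, h.mhs.W_real _ _ x.2⟩ ⟨σ y, h.mhs.W_real _ _ y.2⟩).trans ?_
    rw [pow_conj h.toSituationA, h.S_real]
    exact congrArg _ (hform x y).symm
  · intro u v
    obtain ⟨x, rfl⟩ := Submodule.mkQ_surjective _ u
    obtain ⟨y, rfl⟩ := Submodule.mkQ_surjective _ v
    refine (hform y x).trans ?_
    have h1 := hform x y
    refine Eq.trans ?_ (congrArg _ h1.symm)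
    have e : (-1 : ℂ) ^ (a - b) = (-1) ^ d * (-1) ^ l := by
      have : a - b = ((d : ℤ) + l) + 2 * (-b) := by omega
      rw [this, zpow_add₀ (by norm_num), zpow_mul, zpow_add₀ (by norm_num)]
      simp
    have h2 := h.S_pow l y x
    have h3 := h.S_symm x ((N ^ l) y)
    rw [h3] at h2
    rw [e, mul_right_comm, h2, mul_right_comm, ← mul_pow]
    simp

theorem SituationB.mem_primComponent (h : SituationB d σ W F N S) {a b : ℤ} {l : ℕ}
    (hab : a + b = d + l) {z : Gr W (a + b)} : z ∈ h.primComponent a b ↔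
      ∃ x : W (a + b), z = grMk W _ x ∧ IsPrimLift d σ W F N l a b x := by
  have hl : (a + b - d).toNat = l := by omega
  have hk : a + b - 2 * ((l + 1 : ℕ) : ℤ) - 1 = d - l - 3 := by push_cast; omega
  have hprim : ∀ x : W (a + b), grMk W _ x ∈ h.prim (a + b) ↔
      (N ^ (l + 1)) (x : H) ∈ W ((d : ℤ) - l - 3) := by
    intro x
    rw [← hk, ← hl]
    exact grMk_eq_zero_iff
      (x := ⟨(N ^ ((a + b - d).toNat + 1)) (x : H), pow_mem_of_mem h.weight.map_mem _ _ _ x.2⟩)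
  constructor
  · rintro ⟨h1, h2, h3⟩
    obtain ⟨w, rfl⟩ := Submodule.mkQ_surjective _ z
    obtain ⟨x, hx, hxW, h4⟩ := mem_grImage_iff.1 h2
    have h5 : grMk W _ w = grMk W _ ⟨x, hxW⟩ := grMk_eq_iff.2 h4
    refine ⟨⟨x, hxW⟩, h5, ?_⟩
    change grMk W _ w ∈ _ at h1 h3
    rw [h5] at h1 h3
    obtain ⟨x', hx', hxW', h6⟩ := mem_map_grConj_iff.1 h3
    have hW : W (a + b) = W (d + l) := by rw [hab]
    have hW1 : W (a + b - 1) = W (d + l - 1) := by rw [hab]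
    exact ⟨mem_primF.2 ⟨⟨hx, hW.le hxW⟩, (hprim _).1 h1⟩, x', hx', hW.le hxW', hW1.le h6⟩
  · rintro ⟨x, rfl, hx⟩
    obtain ⟨x', hx', hxW', h6⟩ := hx.conj
    obtain ⟨⟨h1, h2⟩, h3⟩ := mem_primF.1 hx.mem
    rw [← hab] at hxW' h6
    exact ⟨(hprim x).2 h3, mem_grImage_iff.2 ⟨x, h1, x.2, by simp⟩,
      mem_map_grConj_iff.2 ⟨x', hx', hxW', h6⟩⟩

theorem SituationB.nondegOn_primComponent [FiniteDimensional ℂ H] (h : SituationB d σ W F N S)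
    {a b : ℤ} {l : ℕ} (hab : a + b = d + l) :
    NondegOn (weilForm (grConj σ W h.mhs.W_real (a + b)) (h.grForm (a + b)) a b)
      (h.primComponent a b) := by
  intro u hu h0
  obtain ⟨x, rfl, hx⟩ := (h.mem_primComponent hab).1 hu
  have hW1 : W (d + l - 1) = W (a + b - 1) := by rw [hab]
  refine grMk_eq_zero_iff.2 (hW1.le ?_)
  refine h.prim_nondegenerate hab hx fun v hv => ?_
  have hvW : v ∈ W (a + b) := hab ▸ (mem_primF.1 hv.mem).1.2
  have h1 := h0 _ ((h.mem_primComponent hab).2 ⟨⟨v, hvW⟩, rfl, hv⟩)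
  rw [h.weilForm_grMk hab] at h1
  exact (mul_eq_zero.1 h1).resolve_left (zpow_ne_zero _ Complex.I_ne_zero)

/-- Lifts of orthogonal bases of the spaces `P^{a,b}`. -/
structure PrimFrame (h : SituationB d σ W F N S) (I : Type) [Fintype I] where
  a : I → ℤ
  b : I → ℤ
  l : I → ℕ
  u : I → H
  sgn : I → ℝ
  add_eq : ∀ i, a i + b i = d + l i
  isPrimLift : ∀ i, IsPrimLift d σ W F N (l i) (a i) (b i) (u i)
  form_self : ∀ i, Complex.I ^ (a i - b i) * S (u i) ((N ^ l i) (σ (u i))) = sgn i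
  form_ne : ∀ i j, i ≠ j → a i = a j → b i = b j → S (u i) ((N ^ l i) (σ (u j))) = 0
  sgn_ne : ∀ i, sgn i ≠ 0
  mem_span : ∀ (l' : ℕ) (a' b' : ℤ) (x : H), a' + b' = d + l' → IsPrimLift d σ W F N l' a' b' x →
    x ∈ Submodule.span ℂ (u '' {i | a i = a' ∧ b i = b'}) ⊔ W (d + l' - 1)
  sPos_eq : ∀ p q, (d : ℤ) ≤ p + q →
    h.sPos p q = ∑ i, if a i = p ∧ b i = q ∧ 0 < sgn i then 1 else 0
  sNeg_eq : ∀ p q, (d : ℤ) ≤ p + q →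
    h.sNeg p q = ∑ i, if a i = p ∧ b i = q ∧ sgn i < 0 then 1 else 0

theorem SituationB.exists_local_frame [FiniteDimensional ℂ H] (h : SituationB d σ W F N S)
    {a b : ℤ} {l : ℕ} (hab : a + b = d + l) :
    ∃ (n : ℕ) (u : Fin n → H) (s : Fin n → ℝ),
      (∀ i, IsPrimLift d σ W F N l a b (u i)) ∧
      (∀ i, Complex.I ^ (a - b) * S (u i) ((N ^ l) (σ (u i))) = s i) ∧
      (∀ i j, i ≠ j → S (u i) ((N ^ l) (σ (u j))) = 0) ∧
      (∀ i, s i ≠ 0) ∧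
      (∀ x, IsPrimLift d σ W F N l a b x →
        x ∈ Submodule.span ℂ (Set.range u) ⊔ W (d + l - 1)) ∧
      (h.sPos a b = ∑ i, if 0 < s i then 1 else 0) ∧
      (h.sNeg a b = ∑ i, if s i < 0 then 1 else 0) := by
  have hB := h.isHermForm_gr hab
  obtain ⟨e, he, h1, h2⟩ := hB.exists_orthogonal_family _ _ rfl (h.nondegOn_primComponent hab)
  obtain ⟨-, -, h4, h5⟩ := (hB.nearDiagonal_of_orthogonal h1 h2).span_facts hB Finset.univ
  rw [Finset.coe_univ, Set.image_univ, he] at h4 h5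
  have h6 : ∀ i, e i ∈ h.primComponent a b := fun i => by
    rw [← he]
    exact Submodule.subset_span ⟨i, rfl⟩
  choose x hx hxP using fun i => (h.mem_primComponent hab).1 (h6 i)
  have h7 := fun i j => h.weilForm_grMk hab (x i) (x j)
  simp only [← hx] at h7
  refine ⟨_, fun i => x i, _, hxP, fun i => ?_, fun i j hij => ?_, h2, fun y hy => ?_, ?_, ?_⟩
  · rw [← h7]
    exact hB.self_eq_re _
  · have := h7 i j
    rw [h1 i j hij] at this
    exact (mul_eq_zero.1 this.symm).resolve_left (zpow_ne_zero _ Complex.I_ne_zero)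
  · have hyW : y ∈ W (a + b) := hab ▸ (mem_primF.1 hy.mem).1.2
    have h8 := (h.mem_primComponent hab).2 ⟨⟨y, hyW⟩, rfl, hy⟩
    rw [← he, Submodule.mem_span_range_iff_exists_fun] at h8
    obtain ⟨c, hc⟩ := h8
    have h9 : grMk W _ ⟨y, hyW⟩ = grMk W _ (∑ i, c i • x i) := by
      rw [← hc, map_sum]
      exact Finset.sum_congr rfl fun i _ => by rw [map_smul, ← hx]
    have h10 := grMk_eq_iff.1 h9
    rw [← add_sub_cancel (∑ i, c i • (x i : H)) y]
    refine Submodule.add_mem_sup (Submodule.sum_mem _ fun i _ =>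
      Submodule.smul_mem _ _ (Submodule.subset_span ⟨i, rfl⟩)) ?_
    have hW1 : W (a + b - 1) = W (d + l - 1) := by rw [hab]
    refine hW1.le ?_
    convert h10 using 2
    simp
  · rw [SituationB.sPos, h4, Finset.card_filter]
  · rw [SituationB.sNeg, h5, Finset.card_filter]

theorem posIndex_bot {V : Type*} [AddCommGroup V] [Module ℂ V] (B : V → V → ℂ) :
    posIndex B ⊥ = 0 := by
  rw [← IsHermForm.negIndex_neg]
  exact IsHermForm.negIndex_eq_zero fun u hu h0 => absurd hu h0

theorem SituationB.primComponent_eq_bot (h : SituationB d σ W F N S) {a b : ℤ}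
    (hF : F a = ⊥ ∨ F b = ⊥) : h.primComponent a b = ⊥ := by
  have h0 : grImage W (a + b) (⊥ : Submodule ℂ H) = ⊥ := by
    have : (⊥ : Submodule ℂ H).submoduleOf (W (a + b)) = ⊥ := by
      ext x
      simp [Submodule.submoduleOf]
    rw [grImage, this, Submodule.map_bot]
  rw [SituationB.primComponent, component]
  rcases hF with hF | hF <;> simp [hF, h0]

theorem SituationB.exists_primFrame [FiniteDimensional ℂ H] (h : SituationB d σ W F N S) :
    ∃ (I : Type) (_ : Fintype I), Nonempty (PrimFrame h I) := by
  obtain ⟨B, hB⟩ := h.mhs.F_bot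
  have hbot : ∀ a, B < a → F a = ⊥ := fun a ha => eq_bot_iff.2 (hB ▸ h.mhs.F_anti ha.le)
  -- Nonzero types have both entries at most `B`; with `a + b ≥ d` each is then at least `d - B`, so
  -- finitely many types remain.
  let Box : Finset (ℤ × ℤ) := ((Finset.Icc (d - B) B) ×ˢ (Finset.Icc (d - B) B)).filter
    fun x => (d : ℤ) ≤ x.1 + x.2
  have hBox : ∀ a b : ℤ, (d : ℤ) ≤ a + b → (a, b) ∉ Box → B < a ∨ B < b := by
    intro a b hab hn
    by_contra! hlt
    refine hn (Finset.mem_filter.2 ⟨Finset.mem_product.2 ⟨Finset.mem_Icc.2 ?_,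
      Finset.mem_Icc.2 ?_⟩, hab⟩) <;> dsimp only <;> omega
  have hl : ∀ x : Box, x.1.1 + x.1.2 = d + ((x.1.1 + x.1.2 - d).toNat : ℤ) := by
    intro x
    have := (Finset.mem_filter.1 x.2).2
    omega
  choose n u s h1 h2 h3 h4 h5 h6 h7 using fun x : Box => h.exists_local_frame (hl x)
  refine ⟨Σ x : Box, Fin (n x), inferInstance, ⟨{
    a := fun i => i.1.1.1
    b := fun i => i.1.1.2
    l := fun i => (i.1.1.1 + i.1.1.2 - d).toNat
    u := fun i => u i.1 i.2
    sgn := fun i => s i.1 i.2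
    add_eq := fun i => hl i.1
    isPrimLift := fun i => h1 i.1 i.2
    form_self := fun i => h2 i.1 i.2
    form_ne := ?_
    sgn_ne := fun i => h4 i.1 i.2
    mem_span := ?_
    sPos_eq := ?_
    sNeg_eq := ?_ }⟩⟩
  · rintro ⟨⟨⟨a, b⟩, hx⟩, i⟩ ⟨⟨⟨a', b'⟩, hx'⟩, j⟩ hne ha hb
    dsimp only at ha hb
    subst ha hb
    exact h3 _ i j fun hij => hne (by rw [hij])
  · intro l' a' b' x hab hx
    by_cases hmem : (a', b') ∈ Box
    · have e : (a' + b' - d).toNat = l' := by omega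
      have := h5 ⟨(a', b'), hmem⟩ x (by rw [e]; exact hx)
      rw [e] at this
      refine (sup_le_sup (Submodule.span_mono ?_) le_rfl :
        _ ⊔ W (d + l' - 1) ≤ _ ⊔ W (d + l' - 1)) this
      rintro _ ⟨i, rfl⟩
      exact ⟨⟨⟨(a', b'), hmem⟩, i⟩, ⟨rfl, rfl⟩, rfl⟩
    · have hb := h.primComponent_eq_bot ((hBox a' b' (by omega) hmem).imp (hbot _) (hbot _))
      have hxW : x ∈ W (a' + b') := hab ▸ (mem_primF.1 hx.mem).1.2
      have h8 := (h.mem_primComponent hab).2 ⟨⟨x, hxW⟩, rfl, hx⟩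
      rw [hb, Submodule.mem_bot, grMk_eq_zero_iff] at h8
      have hW1 : W (a' + b' - 1) = W (d + l' - 1) := by rw [hab]
      exact Submodule.mem_sup_right (hW1.le h8)
  all_goals
    intro p q hpq
    rw [Fintype.sum_sigma]
    by_cases hmem : (p, q) ∈ Box
    · rw [Finset.sum_eq_single ⟨(p, q), hmem⟩]
      · simp [h6 ⟨(p, q), hmem⟩, h7 ⟨(p, q), hmem⟩]
      · rintro ⟨⟨a, b⟩, hab⟩ - hne
        refine Finset.sum_eq_zero fun i _ => if_neg ?_
        rintro ⟨rfl, rfl, -⟩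
        exact hne rfl
      · simp
    · have hb := h.primComponent_eq_bot ((hBox p q hpq hmem).imp (hbot _) (hbot _))
      rw [Finset.sum_eq_zero]
      · simp only [SituationB.sPos, SituationB.sNeg, hb, ← IsHermForm.posIndex_neg, posIndex_bot]
      · rintro ⟨⟨a, b⟩, hab⟩ -
        refine Finset.sum_eq_zero fun i _ => if_neg ?_
        rintro ⟨rfl, rfl, -⟩
        exact hmem hab

end Frame

/-! ### The strings `N^j u_i` as a system adapted to the Hodge filtration. -/

section Strings

variable {H : Type*} [AddCommGroup H] [Module ℂ H] {d : ℕ} {σ : H →ₛₗ[starRingEnd ℂ] H}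
  {W F : ℤ → Submodule ℂ H} {N : Module.End ℂ H} {S : H →ₗ[ℂ] H →ₗ[ℂ] ℂ}
  {h : SituationB d σ W F N S} {I : Type} [Fintype I]

namespace PrimFrame

variable (φ : PrimFrame h I)

/-- The index set of the basis `N ^ j u_i`, `0 ≤ j ≤ l_i`, of `H`. -/
abbrev Idx : Type := Σ i : I, Fin (φ.l i + 1)

/-- The vector `N ^ j u_i`. -/
def vec (t : φ.Idx) : H := (N ^ (t.2 : ℕ)) (φ.u t.1)

/-- The Hodge level of `N ^ j u_i`. -/
def deg (t : φ.Idx) : ℤ := φ.a t.1 - (t.2 : ℕ)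

/-- The span of the `N ^ j u_i` of Hodge level at least `p`. -/
def levelSpan (p : ℤ) : Submodule ℂ H := Submodule.span ℂ (φ.vec '' {t | p ≤ φ.deg t})

theorem levelSpan_anti : Antitone φ.levelSpan := fun _ _ hpq =>
  Submodule.span_mono (Set.image_mono fun _ ht => hpq.trans ht)

theorem pow_u_mem_levelSpan (i : I) {j : ℕ} (hj : j ≤ φ.l i) {p : ℤ} (hp : p ≤ φ.a i - j) :
    (N ^ j) (φ.u i) ∈ φ.levelSpan p :=
  Submodule.subset_span ⟨⟨i, ⟨j, by omega⟩⟩, hp, rfl⟩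

theorem u_mem_F (i : I) : φ.u i ∈ F (φ.a i) := (mem_primF.1 (φ.isPrimLift i).mem).1.1

theorem u_mem_W (i : I) : φ.u i ∈ W (d + φ.l i) := (mem_primF.1 (φ.isPrimLift i).mem).1.2

theorem vec_mem_F (t : φ.Idx) : φ.vec t ∈ F (φ.deg t) :=
  pow_mem_F h.toSituationA _ _ _ (φ.u_mem_F t.1)

theorem levelSpan_le (p : ℤ) : φ.levelSpan p ≤ F p := by
  rw [levelSpan, Submodule.span_le]
  rintro _ ⟨t, ht, rfl⟩
  exact h.mhs.F_anti ht (φ.vec_mem_F t)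

theorem pow_mem_levelSpan_of_isPrimLift {k : ℤ} (ih : ∀ p, ∀ x ∈ F p, x ∈ W (k - 1) → x ∈ φ.levelSpan p)
    {l j : ℕ} (hj : j ≤ l) (hk : (d : ℤ) + l - 2 * j = k) {a b : ℤ} (hab : a + b = d + l) {x : H}
    (hx : IsPrimLift d σ W F N l a b x) : (N ^ j) x ∈ φ.levelSpan (a - j) := by
  obtain ⟨y, hy, z, hz, rfl⟩ := Submodule.mem_sup.1 (φ.mem_span l a b x hab hx)
  have h1 : ∀ y ∈ Submodule.span ℂ (φ.u '' {i | φ.a i = a ∧ φ.b i = b}),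
      y ∈ F a ∧ (N ^ j) y ∈ φ.levelSpan (a - j) := by
    intro y hy
    suffices Submodule.span ℂ (φ.u '' {i | φ.a i = a ∧ φ.b i = b}) ≤
        F a ⊓ (φ.levelSpan (a - j)).comap (N ^ j) from this hy
    rw [Submodule.span_le]
    rintro _ ⟨i, ⟨rfl, rfl⟩, rfl⟩
    have := φ.add_eq i
    exact ⟨φ.u_mem_F i, φ.pow_u_mem_levelSpan i (by omega) le_rfl⟩
  rw [map_add]
  refine add_mem (h1 y hy).2 (ih _ _ (pow_mem_F h.toSituationA _ _ _ ?_)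
    (pow_mem_W h.toSituationA j (by omega) hz))
  have := sub_mem (mem_primF.1 hx.mem).1.1 (h1 y hy).1
  simpa using this

theorem pow_mem_levelSpan_of_primF {k : ℤ} (ih : ∀ p, ∀ x ∈ F p, x ∈ W (k - 1) → x ∈ φ.levelSpan p)
    {l j : ℕ} (hj : j ≤ l) (hk : (d : ℤ) + l - 2 * j = k) (p : ℤ) :
    ∀ x ∈ primF d W F N l p, (N ^ j) x ∈ φ.levelSpan (p - j) := by
  refine h.F_eq_bot_induction
    (motive := fun p => ∀ x ∈ primF d W F N l p, (N ^ j) x ∈ φ.levelSpan (p - j)) ?_ ?_ p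
  · intro p hp w hw
    have := (mem_primF.1 hw).1.1
    rw [hp, Submodule.mem_bot] at this
    rw [this, map_zero]
    exact zero_mem _
  · intro p ihp x hx
    obtain ⟨x₁, x₂, h1, h2, rfl⟩ := h.prim_split hx
    rw [map_add]
    exact add_mem (φ.pow_mem_levelSpan_of_isPrimLift ih hj hk (by ring) h1)
      (φ.levelSpan_anti (by omega) (ihp x₂ h2))

/-- Write `x` as a primitive element plus `N w` with `w ∈ F^{p+1} ∩ W_{d+l+2}`. Passing from `(l, j,
p)` to `(l+2, j+1, p+1)` keeps both the weight `k` and the level `p - j`, and stops once `N^{l+1} x`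
falls into `W_c = 0`. -/
theorem pow_mem_levelSpan {k : ℤ} (ih : ∀ p, ∀ x ∈ F p, x ∈ W (k - 1) → x ∈ φ.levelSpan p)
    {l j : ℕ} (hj : j ≤ l) (hk : (d : ℤ) + l - 2 * j = k) (p : ℤ) {x : H} (hx : x ∈ F p)
    (hxW : x ∈ W (d + l)) : (N ^ j) x ∈ φ.levelSpan (p - j) := by
  obtain ⟨c, hc⟩ := h.mhs.W_bot
  have key : ∀ n l j : ℕ, (d : ℤ) - l - 2 ≤ c + n → j ≤ l → (d : ℤ) + l - 2 * j = k → ∀ p,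
      ∀ x ∈ F p, x ∈ W (d + l) → (N ^ j) x ∈ φ.levelSpan (p - j) := by
    intro n
    induction n with
    | zero =>
      intro l j hl hj hk p x hx hxW
      refine φ.pow_mem_levelSpan_of_primF ih hj hk p x (mem_primF.2 ⟨⟨hx, hxW⟩, ?_⟩)
      have h1 : (N ^ (l + 1)) x ∈ W c := pow_mem_W h.toSituationA _ (by push_cast; omega) hxW
      rw [hc, Submodule.mem_bot] at h1
      rw [h1]
      exact zero_mem _
    | succ n ihn =>
      intro l j hl hj hk p x hx hxW
      obtain ⟨w, hw, hwW, h1⟩ := h.exists_primF_sub hx hxW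
      have h2 := φ.pow_mem_levelSpan_of_primF ih hj hk p _ h1
      have h3 := ihn (l + 2) (j + 1) (by push_cast at hl ⊢; omega) (by omega)
        (by push_cast; omega) (p + 1) w hw hwW
      rw [pow_succ, Module.End.mul_apply] at h3
      have e : p + 1 - ((j + 1 : ℕ) : ℤ) = p - j := by push_cast; ring
      rw [e] at h3
      rw [map_sub] at h2
      simpa using add_mem h2 h3
  exact key (d - l - 2 - c).toNat l j (by omega) hj hk p x hx hxW

/-- Induction on the weight. Above the middle, use `pow_mem_levelSpan` with `j = 0`; below it,
strictness writes `x` as `N^l w` modulo lower weight. -/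
theorem le_levelSpan_of_mem_W (k : ℤ) : ∀ p, ∀ x ∈ F p, x ∈ W k → x ∈ φ.levelSpan p := by
  refine h.W_eq_bot_induction
    (motive := fun k => ∀ p, ∀ x ∈ F p, x ∈ W k → x ∈ φ.levelSpan p) ?_ ?_ k
  · intro k hk p x _ hx
    rw [hk, Submodule.mem_bot] at hx
    rw [hx]
    exact zero_mem _
  · intro k ih p x hx hxW
    rcases le_or_gt (d : ℤ) k with hk | hk
    · obtain ⟨l, rfl⟩ : ∃ l : ℕ, k = d + l := ⟨(k - d).toNat, by omega⟩
      simpa using φ.pow_mem_levelSpan ih (j := 0) (Nat.zero_le _) (by simp) p hx hxW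
    · obtain ⟨l, rfl⟩ : ∃ l : ℕ, k = d - l := ⟨(d - k).toNat, by omega⟩
      obtain ⟨w, hw, hwW, h1⟩ := h.strict l (p + l) (by simpa using hx) hxW
      have h2 := φ.pow_mem_levelSpan ih (le_refl l) (by ring) (p + l) hw hwW
      have h3 := pow_mem_F h.toSituationA l _ _ hw
      rw [add_sub_cancel_right] at h2 h3
      have h4 := ih p _ (sub_mem hx h3) h1
      simpa using add_mem h4 h2

theorem levelSpan_eq (p : ℤ) : φ.levelSpan p = F p := by
  refine le_antisymm (φ.levelSpan_le p) fun x hx => ?_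
  obtain ⟨b, hb⟩ := h.mhs.W_top
  exact φ.le_levelSpan_of_mem_W b p x hx (by rw [hb]; trivial)

theorem span_vec_eq_top : Submodule.span ℂ (Set.range φ.vec) = ⊤ := by
  obtain ⟨a, ha⟩ := h.mhs.F_top
  rw [eq_top_iff, ← ha, ← φ.levelSpan_eq a]
  exact Submodule.span_mono (Set.image_subset_range _ _)

end PrimFrame

end Strings

/-! ### A binomial identity -/

section Binomial

-- The sum is the `j`-th forward difference at `l - j` of `x ↦ choose x q`, a polynomial of degree
-- `q ≤ j` with leading coefficient `1/q!`.
open fwdDiff in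
theorem sum_neg_one_pow_choose_mul_choose {j l q : ℕ} (hj : j ≤ l) (hq : q ≤ j) :
    ∑ m ∈ Finset.range (j + 1), (-1 : ℤ) ^ m * j.choose m * (l - m).choose q =
      if q = j then 1 else 0 := by
  have h1 := fwdDiff_iter_eq_sum_shift 1 (fun x : ℕ => (x.choose q : ℤ)) j (l - j)
  rw [← Finset.sum_flip] at h1
  have h2 : ∑ m ∈ Finset.range (j + 1), (-1 : ℤ) ^ m * j.choose m * (l - m).choose q =
      (Δ_[1])^[j] (fun x : ℕ => (x.choose q : ℤ)) (l - j) := by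
    rw [h1]
    refine Finset.sum_congr rfl fun m hm => ?_
    have hm' : m ≤ j := by
      have := Finset.mem_range.1 hm
      omega
    have e1 : j - (j - m) = m := by omega
    have e2 : l - j + (j - m) • 1 = l - m := by
      rw [smul_eq_mul, mul_one]
      omega
    rw [e1, e2, Nat.choose_symm hm', smul_eq_mul]
  rw [h2]
  have h3 : ∀ q, (Δ_[1])^[q] (fun x : ℕ => (x.choose q : ℤ)) = fun _ => 1 := by
    intro q
    have := fwdDiff_iter_choose 0 q
    simpa using this
  split_ifs with hqj
  · subst hqj
    rw [h3]
  · obtain ⟨k, rfl⟩ : ∃ k, j = k + 1 + q := ⟨j - q - 1, by omega⟩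
    rw [Function.iterate_add_apply, h3, Function.iterate_add_apply, Function.iterate_one,
      fwdDiff_const, fwdDiff_iter_eq_sum_shift]
    simp

/-- The coefficients of the orthogonal basis of an `sl₂`-string. -/
noncomputable def stringCoeff (l j m : ℕ) : ℂ :=
  j.choose m * (-2 * Complex.I) ^ m * (l - m).factorial / l.factorial

/-- The Gram matrix of `1, N, ..., N ^ l` with respect to `(u, v) ↦ S (u, exp (-2iN) conj v)`. -/
noncomputable def stringGram (l m n : ℕ) : ℂ :=
  if m + n ≤ l then (-1) ^ m * (-2 * Complex.I) ^ (l - m - n) / (l - m - n).factorial else 0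

/-- The `j`-th combination is orthogonal to `N^n` for `n < j`: this is Gram–Schmidt in closed form.
After cancelling factorials the coefficients become those of the alternating binomial sum. -/
theorem sum_stringCoeff_mul_stringGram {l j n : ℕ} (hj : j ≤ l) (hn : n ≤ j) :
    ∑ m ∈ Finset.range (j + 1), stringCoeff l j m * stringGram l m n =
      if n = j then (-2 * Complex.I) ^ (l - j) * j.factorial / l.factorial else 0 := by
  have h1 : ∀ m ∈ Finset.range (j + 1), stringCoeff l j m * stringGram l m n =
      (-2 * Complex.I) ^ (l - n) * n.factorial / l.factorial *
        (((-1 : ℤ) ^ m * j.choose m * (l - m).choose n : ℤ) : ℂ) := by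
    intro m hm
    have hm' : m ≤ j := by
      have := Finset.mem_range.1 hm
      omega
    rw [stringCoeff, stringGram]
    split_ifs with hmn
    · have h2 := Nat.choose_mul_factorial_mul_factorial (n := l - m) (k := n) (by omega)
      have h3 : l - n = m + (l - m - n) := by omega
      have h4 : ((l - m - n).factorial : ℂ) ≠ 0 := by exact_mod_cast Nat.factorial_ne_zero _
      have h5 : (l.factorial : ℂ) ≠ 0 := by exact_mod_cast Nat.factorial_ne_zero _
      rw [h3, pow_add, ← h2]
      push_cast
      field_simp
    · rw [Nat.choose_eq_zero_of_lt (show l - m < n by omega)]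
      simp
  rw [Finset.sum_congr rfl h1, ← Finset.mul_sum, ← Int.cast_sum,
    sum_neg_one_pow_choose_mul_choose hj hn]
  split_ifs with h
  · subst h
    simp
  · simp

end Binomial

/-! ### The exponential -/

section Exp

variable {H : Type*} [AddCommGroup H] [Module ℂ H] {N : Module.End ℂ H}

theorem pow_nilpotencyClass_eq_zero (hN : IsNilpotent N) {n : ℕ} (hn : nilpotencyClass N ≤ n) :
    N ^ n = 0 :=
  pow_eq_zero_of_le hn (pow_nilpotencyClass hN)

/-- `IsNilpotent.exp` uses rational scalars, so a `ℚ`-module structure is restricted from `ℂ`. The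
addition law then comes from the general theory. -/
theorem expN_eq_exp (hN : IsNilpotent N) (z : ℂ) :
    letI : Module ℚ (Module.End ℂ H) := Module.compHom _ (algebraMap ℚ ℂ)
    expN N z = IsNilpotent.exp (z • N) := by
  let : Module ℚ (Module.End ℂ H) := Module.compHom _ (algebraMap ℚ ℂ)
  have h0 : (z • N) ^ nilpotencyClass N = 0 := by
    rw [smul_pow, pow_nilpotencyClass hN, smul_zero]
  have hs : ∀ (q : ℚ) (f : Module.End ℂ H), q • f = (q : ℂ) • f := fun q f => rfl
  change expN N z = _
  rw [IsNilpotent.exp_eq_sum h0, expN]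
  refine Finset.sum_congr rfl fun n _ => ?_
  rw [hs, smul_pow, smul_smul]
  congr 1
  push_cast
  rw [div_eq_mul_inv, mul_comm]

theorem expN_add (hN : IsNilpotent N) (z w : ℂ) : expN N (z + w) = expN N z * expN N w := by
  let : Module ℚ (Module.End ℂ H) := Module.compHom _ (algebraMap ℚ ℂ)
  rw [expN_eq_exp hN, expN_eq_exp hN, expN_eq_exp hN, add_smul]
  exact IsNilpotent.exp_add_of_commute (((Commute.refl N).smul_left z).smul_right w)
    (hN.smul z) (hN.smul w)

theorem expN_zero (hN : IsNilpotent N) : expN N 0 = 1 := by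
  let : Module ℚ (Module.End ℂ H) := Module.compHom _ (algebraMap ℚ ℂ)
  rw [expN_eq_exp hN, zero_smul]
  exact IsNilpotent.exp_zero

theorem expN_neg_apply (hN : IsNilpotent N) (z : ℂ) (u : H) : expN N (-z) (expN N z u) = u := by
  rw [← Module.End.mul_apply, ← expN_add hN, neg_add_cancel, expN_zero hN, Module.End.one_apply]

theorem expN_injective (hN : IsNilpotent N) (z : ℂ) : Function.Injective (expN N z) :=
  Function.LeftInverse.injective (expN_neg_apply hN z)

theorem expN_apply (z : ℂ) (u : H) : expN N z u =
    ∑ j ∈ Finset.range (nilpotencyClass N), (z ^ j / (j.factorial : ℂ)) • (N ^ j) u := by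
  simp [expN]

theorem expN_conj {σ : H →ₛₗ[starRingEnd ℂ] H} (hσ : ∀ l u, (N ^ l) (σ u) = σ ((N ^ l) u))
    (z : ℂ) (u : H) : σ (expN N z u) = expN N (starRingEnd ℂ z) (σ u) := by
  rw [expN_apply, expN_apply, map_sum]
  refine Finset.sum_congr rfl fun n _ => ?_
  rw [map_smulₛₗ, hσ, map_div₀, map_pow, Complex.conj_natCast]

theorem expN_adjoint {S : H →ₗ[ℂ] H →ₗ[ℂ] ℂ}
    (hS : ∀ (l : ℕ) u v, S ((N ^ l) u) v = (-1) ^ l * S u ((N ^ l) v)) (z : ℂ) (u v : H) :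
    S (expN N z u) v = S u (expN N (-z) v) := by
  rw [expN_apply, expN_apply, map_sum, map_sum, LinearMap.sum_apply]
  refine Finset.sum_congr rfl fun n _ => ?_
  rw [map_smul, map_smul, LinearMap.smul_apply, hS, neg_pow]
  simp only [smul_eq_mul]
  ring

end Exp

/-! ### The form along the orbit and its limit after rescaling. -/

section Rescaled

variable {H : Type*} [AddCommGroup H] [Module ℂ H] {d : ℕ} {σ : H →ₛₗ[starRingEnd ℂ] H}
  {W F : ℤ → Submodule ℂ H} {N : Module.End ℂ H} {S : H →ₗ[ℂ] H →ₗ[ℂ] ℂ}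
  {h : SituationB d σ W F N S} {I : Type} [Fintype I]

theorem SituationB.S_expN (h : SituationB d σ W F N S) (z : ℂ) (u v : H) :
    S (expN N z u) (expN N z v) = S u v := by
  rw [expN_adjoint h.S_pow, expN_neg_apply h.nilpotent]

theorem SituationB.S_expN_conj (h : SituationB d σ W F N S) (z : ℂ) (u v : H) :
    S (expN N z u) (σ (expN N z v)) = S u (expN N (-2 * Complex.I * z.im) (σ v)) := by
  rw [expN_conj (pow_conj h.toSituationA), expN_adjoint h.S_pow, ← Module.End.mul_apply,
    ← expN_add h.nilpotent]
  congr 3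
  apply Complex.ext <;> simp
  ring

/-- The rescaled form `(u, v) ↦ S (u, exp (-2i s² N) conj v)`. -/
noncomputable def scaledForm (σ : H →ₛₗ[starRingEnd ℂ] H) (N : Module.End ℂ H)
    (S : H →ₗ[ℂ] H →ₗ[ℂ] ℂ) (s : ℝ) (u v : H) : ℂ :=
  S u (expN N (-2 * Complex.I * ((s ^ 2 : ℝ) : ℂ)) (σ v))

theorem SituationB.scaledForm_pow (h : SituationB d σ W F N S) (s : ℝ) (m m' : ℕ) (u v : H) :
    scaledForm σ N S s ((N ^ m) u) ((N ^ m') v) =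
      ∑ n ∈ Finset.range (nilpotencyClass N), ((s : ℂ) ^ (2 * n)) *
        ((-1) ^ m * (-2 * Complex.I) ^ n / n.factorial * S u ((N ^ (m + m' + n)) (σ v))) := by
  rw [scaledForm, expN_apply, map_sum]
  refine Finset.sum_congr rfl fun n _ => ?_
  rw [map_smul, h.S_pow, ← pow_conj h.toSituationA, ← Module.End.mul_apply, ← Module.End.mul_apply,
    ← pow_add, ← pow_add, smul_eq_mul, show m + n + m' = m + m' + n by ring]
  rw [mul_pow, pow_mul]
  push_cast
  ring

namespace PrimFrame

variable (φ : PrimFrame h I)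

/-- Only for equal lengths and `2τ = l + l'` does `S (u_i, N ^ τ conj u_{i'})` survive. -/
theorem S_u_eq_zero (i i' : I) {τ : ℕ} (hτ : φ.l i + φ.l i' ≤ 2 * τ)
    (hne : φ.l i = φ.l i' → φ.l i + φ.l i' ≠ 2 * τ) : S (φ.u i) ((N ^ τ) (σ (φ.u i'))) = 0 := by
  have hu := φ.u_mem_W i
  have hv := h.mhs.W_real _ _ (φ.u_mem_W i')
  by_cases h1 : φ.l i + φ.l i' = 2 * τ
  · rcases lt_trichotomy (φ.l i) (φ.l i') with hlt | heq | hgt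
    -- Weights alone just miss here. As `τ ≥ l_i + 1`, primitivity lowers the weight of `N^τ u_i` by
    -- one more, making the total `2d - 1`.
    · obtain ⟨t, rfl⟩ : ∃ t, τ = t + (φ.l i + 1) := ⟨τ - (φ.l i + 1), by omega⟩
      have h2 := (mem_primF.1 (φ.isPrimLift i).mem).2
      have h3 : S ((N ^ (t + (φ.l i + 1))) (φ.u i)) (σ (φ.u i')) = 0 := by
        refine h.S_weight (a := d - φ.l i - 3 - 2 * t) (by omega) ?_ hv
        rw [pow_add, Module.End.mul_apply]
        exact pow_mem_W h.toSituationA t le_rfl h2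
      rw [h.S_pow] at h3
      exact (mul_eq_zero.1 h3).resolve_left (pow_ne_zero _ (by norm_num))
    · exact absurd h1 (hne heq)
    · obtain ⟨t, rfl⟩ : ∃ t, τ = t + (φ.l i' + 1) := ⟨τ - (φ.l i' + 1), by omega⟩
      have h2 := h.mhs.W_real _ _ (mem_primF.1 (φ.isPrimLift i').mem).2
      refine h.S_weight (b := d - φ.l i' - 3 - 2 * t) (by omega) hu ?_
      rw [pow_add, Module.End.mul_apply, pow_conj h.toSituationA]
      exact pow_mem_W h.toSituationA t le_rfl h2
  · exact h.S_weight (by omega) hu (pow_mem_W h.toSituationA τ le_rfl hv)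

-- The `n`-th term of the exponential carries `s^{2(m+m'+n) - l - l'}`. Negative powers decay, and
-- for nonnegative exponents `S_u_eq_zero` kills everything except `l = l'`, `m + m' + n = l`, where
-- the power is `s^0`.
open Filter Topology in
theorem tendsto_scaledForm (i i' : I) (m m' : ℕ) :
    Tendsto (fun s : ℝ => scaledForm σ N S s
      (((s : ℂ) ^ (2 * (m : ℤ) - φ.l i)) • (N ^ m) (φ.u i))
      (((s : ℂ) ^ (2 * (m' : ℤ) - φ.l i')) • (N ^ m') (φ.u i'))) atTop
      (𝓝 (if φ.l i = φ.l i' then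
        stringGram (φ.l i) m m' * S (φ.u i) ((N ^ (φ.l i)) (σ (φ.u i'))) else 0)) := by
  let c : ℕ → ℂ := fun n => (-1) ^ m * (-2 * Complex.I) ^ n / n.factorial *
    S (φ.u i) ((N ^ (m + m' + n)) (σ (φ.u i')))
  have h1 : ∀ n, Tendsto (fun s : ℝ => (s : ℂ) ^ (2 * ((m + m' + n : ℕ) : ℤ) - φ.l i - φ.l i') * c n)
      atTop (𝓝 (if φ.l i = φ.l i' ∧ m + m' + n = φ.l i then c n else 0)) := by
    intro n
    rcases lt_or_ge (2 * (m + m' + n)) (φ.l i + φ.l i') with hlt | hge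
    · rw [if_neg (by omega)]
      obtain ⟨k, hk, hk0⟩ : ∃ k : ℕ, 2 * ((m + m' + n : ℕ) : ℤ) - φ.l i - φ.l i' = -k ∧ k ≠ 0 :=
        ⟨φ.l i + φ.l i' - 2 * (m + m' + n), by omega, by omega⟩
      rw [hk, ← zero_mul (c n)]
      refine Tendsto.mul_const _ ?_
      have h2 := (tendsto_pow_atTop (α := ℝ) hk0).inv_tendsto_atTop
      have h3 := (Complex.continuous_ofReal.tendsto 0).comp h2
      rw [Complex.ofReal_zero] at h3
      refine h3.congr fun s => ?_
      simp
    · by_cases heq : φ.l i = φ.l i' ∧ m + m' + n = φ.l i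
      · rw [if_pos heq]
        have e : 2 * ((m + m' + n : ℕ) : ℤ) - φ.l i - φ.l i' = 0 := by omega
        rw [e]
        simp
      · rw [if_neg heq]
        have : c n = 0 := by
          simp only [c]
          rw [φ.S_u_eq_zero i i' (by omega) (by omega), mul_zero]
        simp [this]
  have h2 := tendsto_finsetSum (Finset.range (nilpotencyClass N)) fun n _ => h1 n
  have h3 : (∑ n ∈ Finset.range (nilpotencyClass N),
      if φ.l i = φ.l i' ∧ m + m' + n = φ.l i then c n else 0) =
      if φ.l i = φ.l i' then
        stringGram (φ.l i) m m' * S (φ.u i) ((N ^ (φ.l i)) (σ (φ.u i'))) else 0 := by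
    by_cases hl : φ.l i = φ.l i'
    · rw [if_pos hl, stringGram]
      by_cases hm : m + m' ≤ φ.l i
      · have e : m + m' + (φ.l i - m - m') = φ.l i := by omega
        rw [Finset.sum_eq_single (φ.l i - m - m')]
        · rw [if_pos ⟨hl, e⟩, if_pos hm]
          simp only [c, e]
        · intro n _ hn
          rw [if_neg (by omega)]
        · intro hn
          -- If the surviving index lies beyond the truncation of the exponential, then `N^l = 0`
          -- and the expected limit is zero as well.
          rw [if_pos ⟨hl, e⟩]
          simp only [c]
          rw [pow_nilpotencyClass_eq_zero h.nilpotent (n := m + m' + (φ.l i - m - m'))]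
          · simp
          · have := Finset.mem_range.not.1 hn
            omega
      · rw [if_neg hm, zero_mul]
        exact Finset.sum_eq_zero fun n _ => if_neg (by omega)
    · rw [if_neg hl]
      exact Finset.sum_eq_zero fun n _ => if_neg (by tauto)
  rw [h3] at h2
  refine h2.congr' ?_
  filter_upwards [eventually_gt_atTop (0 : ℝ)] with s hs
  have hs0 : (s : ℂ) ≠ 0 := by exact_mod_cast hs.ne'
  have h4 : scaledForm σ N S s
      (((s : ℂ) ^ (2 * (m : ℤ) - φ.l i)) • (N ^ m) (φ.u i))
      (((s : ℂ) ^ (2 * (m' : ℤ) - φ.l i')) • (N ^ m') (φ.u i')) =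
      (s : ℂ) ^ (2 * (m : ℤ) - φ.l i) * ((s : ℂ) ^ (2 * (m' : ℤ) - φ.l i') *
        scaledForm σ N S s ((N ^ m) (φ.u i)) ((N ^ m') (φ.u i'))) := by
    simp only [scaledForm, map_smul, map_smulₛₗ, LinearMap.smul_apply, smul_eq_mul, map_zpow₀,
      Complex.conj_ofReal]
    ring
  rw [h4, h.scaledForm_pow, Finset.mul_sum, Finset.mul_sum]
  refine Finset.sum_congr rfl fun n _ => ?_
  have e : (s : ℂ) ^ (2 * ((m + m' + n : ℕ) : ℤ) - φ.l i - φ.l i') =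
      (s : ℂ) ^ (2 * (m : ℤ) - φ.l i) * ((s : ℂ) ^ (2 * (m' : ℤ) - φ.l i') * (s : ℂ) ^ (2 * n)) := by
    rw [← zpow_natCast, ← zpow_add₀ hs0, ← zpow_add₀ hs0]
    congr 1
    push_cast
    ring
  rw [e]
  ring

end PrimFrame

end Rescaled

theorem NearDiagonal.sign_mul {V T : Type*} [Fintype T] [DecidableEq T] {B : V → V → ℂ}
    {v : T → V} {lam : T → ℝ} {ε : ℝ} (hv : NearDiagonal B v lam ε) {c : ℝ} (hc : |c| = 1) :
    NearDiagonal (fun u w => c * B u w) v (fun t => c * lam t) ε where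
  dist_le t t' := by
    have e : (c : ℂ) * B (v t) (v t') - (if t = t' then ((c * lam t : ℝ) : ℂ) else 0) =
        c * (B (v t) (v t') - if t = t' then (lam t : ℂ) else 0) := by
      split_ifs <;> push_cast <;> ring
    rw [e, norm_mul, Complex.norm_real, Real.norm_eq_abs, hc, one_mul]
    exact hv.dist_le t t'
  small t := by
    rw [abs_mul, hc, one_mul]
    exact hv.small t

/-! ### The limiting Gram matrix, and the spans of sets of basis vectors. -/

section Limit

variable {H : Type*} [AddCommGroup H] [Module ℂ H] {d : ℕ} {σ : H →ₛₗ[starRingEnd ℂ] H}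
  {W F : ℤ → Submodule ℂ H} {N : Module.End ℂ H} {S : H →ₗ[ℂ] H →ₗ[ℂ] ℂ}
  {h : SituationB d σ W F N S} {I : Type} [Fintype I]

theorem SituationB.isHermForm (h : SituationB d σ W F N S) {p q : ℤ} (hpq : p + q = d) :
    IsHermForm (weilForm σ S p q) := by
  refine isHermForm_weilForm h.mhs.conj_conj h.S_real fun u v => ?_
  have e : p - q = d + 2 * (-q) := by omega
  rw [h.S_symm, e, zpow_add₀ (by norm_num), zpow_mul]
  simp

theorem weilForm_apply {V : Type*} [AddCommGroup V] [Module ℂ V] (σ : V →ₛₗ[starRingEnd ℂ] V)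
    (B : V →ₗ[ℂ] V →ₗ[ℂ] ℂ) (p q : ℤ) (u v : V) :
    weilForm σ B p q u v = Complex.I ^ (p - q) * B u (σ v) := by
  simp [weilForm]

/-- On level `p` the Weil form differs from the fixed form `i^d S(·, conj ·)` only by the sign
`i^{2p-2d} = (-1)^{p-d}`, so one Gram matrix serves all `p`. -/
theorem weilForm_eq_sign_mul (p : ℤ) :
    weilForm σ S p (d - p) = fun u v => (((-1 : ℝ) ^ (p - d) : ℝ) : ℂ) * weilForm σ S d 0 u v := by
  funext u v
  rw [weilForm_apply, weilForm_apply, ← mul_assoc]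
  congr 1
  have e : p - (d - p) = 2 * (p - d) + (d - 0) := by ring
  rw [e, zpow_add₀ Complex.I_ne_zero, zpow_mul]
  congr 1
  push_cast
  congr 1
  exact Complex.I_sq

theorem SituationB.weilForm_expN (h : SituationB d σ W F N S) {z : ℂ} {s : ℝ} (hz : z.im = s ^ 2)
    (u v : H) : weilForm σ S d 0 (expN N z u) (expN N z v) =
      Complex.I ^ d * scaledForm σ N S s u v := by
  rw [weilForm_apply, h.S_expN_conj, hz, sub_zero, zpow_natCast]
  rfl

theorem SituationB.isHermForm_scaledForm (h : SituationB d σ W F N S) (s : ℝ) :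
    IsHermForm (fun u v => Complex.I ^ d * scaledForm σ N S s u v) := by
  have hQ := h.isHermForm (p := d) (q := 0) (by simp)
  have e : (fun u v => Complex.I ^ d * scaledForm σ N S s u v) =
      fun u v => weilForm σ S d 0 (expN N (Complex.I * ((s ^ 2 : ℝ) : ℂ)) u)
        (expN N (Complex.I * ((s ^ 2 : ℝ) : ℂ)) v) := by
    funext u v
    refine (h.weilForm_expN ?_ u v).symm
    rw [Complex.I_mul_im, Complex.ofReal_re]
  rw [e]
  exact ⟨fun u v w => by rw [map_add, hQ.add_left], fun c u w => by rw [map_smul, hQ.smul_left],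
    fun u v => hQ.conj_symm _ _⟩

namespace PrimFrame

variable (φ : PrimFrame h I)

/-- The orthogonal basis of the rescaled `sl₂`-strings. -/
noncomputable def stringVec (s : ℝ) (t : φ.Idx) : H :=
  ∑ m ∈ Finset.range (t.2 + 1), stringCoeff (φ.l t.1) t.2 m •
    (((s : ℂ) ^ (2 * (m : ℤ) - φ.l t.1)) • (N ^ m) (φ.u t.1))

/-- The limit of the Gram matrix of `stringVec`, up to the factor `i ^ d`. -/
noncomputable def limitGram (t t' : φ.Idx) : ℂ :=
  ∑ m ∈ Finset.range (t.2 + 1), ∑ m' ∈ Finset.range (t'.2 + 1),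
    stringCoeff (φ.l t.1) t.2 m * (starRingEnd ℂ (stringCoeff (φ.l t'.1) t'.2 m') *
      if φ.l t.1 = φ.l t'.1 then stringGram (φ.l t.1) m m' *
        S (φ.u t.1) ((N ^ (φ.l t.1)) (σ (φ.u t'.1))) else 0)

/-- The limits of the diagonal entries. -/
noncomputable def lam (t : φ.Idx) : ℝ :=
  (-1) ^ ((d : ℤ) - φ.deg t) * ((2 : ℝ) ^ (φ.l t.1) * (t.2 : ℕ).factorial *
    (φ.l t.1 - t.2).factorial / ((φ.l t.1).factorial : ℝ) ^ 2 * φ.sgn t.1)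

open Filter Topology

theorem tendsto_limitGram (t t' : φ.Idx) :
    Tendsto (fun s : ℝ => Complex.I ^ d * scaledForm σ N S s (φ.stringVec s t) (φ.stringVec s t'))
      atTop (𝓝 (Complex.I ^ d * φ.limitGram t t')) := by
  refine Tendsto.const_mul _ ?_
  have h1 := tendsto_finsetSum (Finset.range (t.2 + 1)) fun m _ =>
    tendsto_finsetSum (Finset.range (t'.2 + 1)) fun m' _ =>
      ((φ.tendsto_scaledForm t.1 t'.1 m m').const_mul
        (starRingEnd ℂ (stringCoeff (φ.l t'.1) t'.2 m'))).const_mul (stringCoeff (φ.l t.1) t.2 m)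
  refine h1.congr fun s => ?_
  have hI : Complex.I ^ d ≠ 0 := pow_ne_zero _ Complex.I_ne_zero
  refine mul_left_cancel₀ hI ?_
  have hB := h.isHermForm_scaledForm s
  have h2 := hB.sum_left (Finset.range (t.2 + 1)) (fun m => stringCoeff (φ.l t.1) t.2 m •
    (((s : ℂ) ^ (2 * (m : ℤ) - φ.l t.1)) • (N ^ m) (φ.u t.1))) (φ.stringVec s t')
  refine Eq.trans ?_ h2.symm
  rw [Finset.mul_sum]
  refine Finset.sum_congr rfl fun m _ => ?_
  rw [hB.smul_left, stringVec, hB.sum_right, Finset.mul_sum, Finset.mul_sum]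
  refine Finset.sum_congr rfl fun m' _ => ?_
  rw [hB.smul_right]
  ring

/-- Hermitian symmetry passes to the limit; it reduces the off-diagonal entries to the case `j' ≤
j`. -/
theorem conj_limitGram (t t' : φ.Idx) :
    starRingEnd ℂ (Complex.I ^ d * φ.limitGram t t') = Complex.I ^ d * φ.limitGram t' t := by
  refine tendsto_nhds_unique ?_ (φ.tendsto_limitGram t' t)
  refine ((Complex.continuous_conj.tendsto _).comp (φ.tendsto_limitGram t t')).congr fun s => ?_
  exact (h.isHermForm_scaledForm s).conj_symm _ _

/-- The inner sum over `m` vanishes unless `m' = j`; since `m' ≤ j' ≤ j`, only the top term with `j'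
= j` can survive. -/
theorem limitGram_of_le {t t' : φ.Idx} (hjj : (t'.2 : ℕ) ≤ t.2) :
    φ.limitGram t t' = if φ.l t.1 = φ.l t'.1 ∧ (t'.2 : ℕ) = t.2 then
      starRingEnd ℂ (stringCoeff (φ.l t.1) t.2 t.2) * ((-2 * Complex.I) ^ (φ.l t.1 - t.2) *
        (t.2 : ℕ).factorial / (φ.l t.1).factorial *
        S (φ.u t.1) ((N ^ (φ.l t.1)) (σ (φ.u t'.1)))) else 0 := by
  have hj : (t.2 : ℕ) ≤ φ.l t.1 := by omega
  by_cases hl : φ.l t.1 = φ.l t'.1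
  · have h1 : φ.limitGram t t' = ∑ m' ∈ Finset.range (t'.2 + 1),
        (starRingEnd ℂ (stringCoeff (φ.l t.1) t'.2 m') *
          ((if m' = t.2 then (-2 * Complex.I) ^ (φ.l t.1 - t.2) *
            (t.2 : ℕ).factorial / (φ.l t.1).factorial else 0) *
          S (φ.u t.1) ((N ^ (φ.l t.1)) (σ (φ.u t'.1))))) := by
      rw [limitGram, Finset.sum_comm]
      refine Finset.sum_congr rfl fun m' hm' => ?_
      have := Finset.mem_range.1 hm'
      rw [← sum_stringCoeff_mul_stringGram hj (by omega), Finset.sum_mul, Finset.mul_sum]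
      refine Finset.sum_congr rfl fun m _ => ?_
      rw [if_pos hl, show stringCoeff (φ.l t'.1) t'.2 m' = stringCoeff (φ.l t.1) t'.2 m' by rw [hl]]
      ring
    rw [h1]
    split_ifs with hc
    · rw [Finset.sum_eq_single (t.2 : ℕ), if_pos rfl, hc.2]
      · intro m' _ hm'
        rw [if_neg hm', zero_mul, mul_zero]
      · intro hm'
        exact absurd (Finset.mem_range.2 (by omega)) hm'
    · refine Finset.sum_eq_zero fun m' hm' => ?_
      have := Finset.mem_range.1 hm'
      rw [if_neg (by omega), zero_mul, mul_zero]
  · rw [if_neg (by tauto), limitGram]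
    refine Finset.sum_eq_zero fun m _ => Finset.sum_eq_zero fun m' _ => ?_
    rw [if_neg hl, mul_zero, mul_zero]

theorem S_u_eq_zero_of_ne {i i' : I} (hl : φ.l i = φ.l i') (hne : i ≠ i') :
    S (φ.u i) ((N ^ (φ.l i)) (σ (φ.u i'))) = 0 := by
  have h1 := φ.add_eq i
  have h2 := φ.add_eq i'
  by_cases ha : φ.a i = φ.a i'
  · exact φ.form_ne i i' hne ha (by omega)
  · have h3 := φ.isPrimLift i'
    rw [← hl] at h3
    exact h.S_prim_eq_zero h1 (by omega) ha (φ.isPrimLift i) h3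

/-- The powers of `i` collect to `i^{d+l+b-a} = i^{2b}` because `a + b = d + l`. With `(-1)^{l-j}`
from `(-2i)^{l-j}`, the resulting sign depends only on the Hodge level `a - j`. -/
theorem limitGram_self (t : φ.Idx) : Complex.I ^ d * φ.limitGram t t = φ.lam t := by
  rw [φ.limitGram_of_le le_rfl, if_pos ⟨rfl, rfl⟩]
  obtain ⟨i, ⟨j, hj⟩⟩ := t
  have hj' : j ≤ φ.l i := by omega
  have h1 := φ.add_eq i
  have h2 := φ.form_self i
  have h3 : S (φ.u i) ((N ^ (φ.l i)) (σ (φ.u i))) = Complex.I ^ (φ.b i - φ.a i) * φ.sgn i := by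
    rw [← h2, ← mul_assoc, ← zpow_add₀ Complex.I_ne_zero]
    simp
  simp only [lam, deg, stringCoeff]
  rw [h3]
  have h4 : starRingEnd ℂ ((j.choose j : ℂ) * (-2 * Complex.I) ^ j * ((φ.l i - j).factorial : ℂ) /
      ((φ.l i).factorial : ℂ)) =
      (2 * Complex.I) ^ j * ((φ.l i - j).factorial : ℂ) / ((φ.l i).factorial : ℂ) := by
    simp [Complex.conj_ofNat]
  rw [h4]
  have h5 : (Complex.I ^ d * ((2 * Complex.I) ^ j * (-2 * Complex.I) ^ (φ.l i - j)) *
      Complex.I ^ (φ.b i - φ.a i)) = (-1) ^ ((d : ℤ) - (φ.a i - j)) * 2 ^ (φ.l i) := by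
    have e1 : (-2 * Complex.I) ^ (φ.l i - j) =
        (-1) ^ (φ.l i - j) * (2 ^ (φ.l i - j) * Complex.I ^ (φ.l i - j)) := by
      rw [← mul_pow, ← mul_pow]
      congr 1
      ring
    have e2 : (2 : ℂ) ^ (φ.l i) = 2 ^ j * 2 ^ (φ.l i - j) := by
      rw [← pow_add]
      congr 1
      omega
    have e3 : Complex.I ^ d * Complex.I ^ j * Complex.I ^ (φ.l i - j) *
        Complex.I ^ (φ.b i - φ.a i) = (-1) ^ (φ.b i) := by
      rw [← zpow_natCast, ← zpow_natCast, ← zpow_natCast, ← zpow_add₀ Complex.I_ne_zero,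
        ← zpow_add₀ Complex.I_ne_zero, ← zpow_add₀ Complex.I_ne_zero]
      have : (d : ℤ) + j + ((φ.l i - j : ℕ) : ℤ) + (φ.b i - φ.a i) = 2 * φ.b i := by omega
      rw [this, zpow_mul]
      congr 1
      exact Complex.I_sq
    have e4 : (-1 : ℂ) ^ ((d : ℤ) - (φ.a i - j)) = (-1) ^ (φ.b i) * (-1) ^ (φ.l i - j) := by
      rw [← zpow_natCast, ← zpow_add₀ (by norm_num)]
      have : (d : ℤ) - (φ.a i - j) = φ.b i + ((φ.l i - j : ℕ) : ℤ) + 2 * (-((φ.l i - j : ℕ) : ℤ)) := by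
        omega
      rw [this, zpow_add₀ (by norm_num) (φ.b i + _), zpow_mul]
      simp
    rw [e1, e2, e4, ← e3, mul_pow]
    ring
  push_cast
  have h6 : ((φ.l i).factorial : ℂ) ≠ 0 := by exact_mod_cast Nat.factorial_ne_zero _
  have h7 := congrArg (fun x : ℂ => x * (((φ.l i - j).factorial : ℂ) / ((φ.l i).factorial : ℂ) *
    ((j.factorial : ℂ) / ((φ.l i).factorial : ℂ)) * φ.sgn i)) h5
  field_simp at h7 ⊢
  linear_combination h7

theorem limitGram_eq (t t' : φ.Idx) [Decidable (t = t')] :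
    Complex.I ^ d * φ.limitGram t t' = if t = t' then (φ.lam t : ℂ) else 0 := by
  split_ifs with htt
  · subst htt
    exact φ.limitGram_self t
  have key : ∀ t t' : φ.Idx, t ≠ t' → (t'.2 : ℕ) ≤ t.2 →
      Complex.I ^ d * φ.limitGram t t' = 0 := by
    intro t t' hne hle
    rw [φ.limitGram_of_le hle]
    split_ifs with hc
    · have hi : t.1 ≠ t'.1 := by
        intro hi
        apply hne
        obtain ⟨i, j⟩ := t
        obtain ⟨i', j'⟩ := t'
        dsimp only at hi
        subst hi
        exact congrArg _ (Fin.ext hc.2.symm)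
      rw [φ.S_u_eq_zero_of_ne hc.1 hi]
      simp
    · rw [mul_zero]
  rcases le_total (t'.2 : ℕ) t.2 with hle | hle
  · exact key t t' htt hle
  · rw [← φ.conj_limitGram, key t' t (Ne.symm htt) hle, map_zero]

theorem sign_abs (n : ℤ) : |(-1 : ℝ) ^ n| = 1 := by
  rw [abs_zpow, abs_neg, abs_one, one_zpow]

theorem lam_ne_zero (t : φ.Idx) : φ.lam t ≠ 0 := by
  refine mul_ne_zero (zpow_ne_zero _ (by norm_num)) (mul_ne_zero ?_ (φ.sgn_ne t.1))
  positivity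

/-- There are finitely many entries, so one `ε` below all `|lam| / card` and one threshold for `s =
√(Im z)` suffice. -/
theorem exists_nearDiagonal [DecidableEq φ.Idx] :
    ∃ T ε : ℝ, 0 ≤ T ∧ ∀ z : ℂ, T < z.im → NearDiagonal (weilForm σ S d 0)
      (fun t => expN N z (φ.stringVec (√z.im) t)) φ.lam ε := by
  obtain ⟨ε, hε, hsmall⟩ : ∃ ε : ℝ, 0 < ε ∧ ∀ t, ε * Fintype.card φ.Idx < |φ.lam t| := by
    have h1 : ∀ t, ∀ᶠ ε : ℝ in 𝓝[>] 0, ε * Fintype.card φ.Idx < |φ.lam t| := by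
      intro t
      have h2 : Tendsto (fun ε : ℝ => ε * Fintype.card φ.Idx) (𝓝[>] 0) (𝓝 0) := by
        have h3 : Continuous fun ε : ℝ => ε * (Fintype.card φ.Idx : ℝ) := by fun_prop
        have h4 := h3.tendsto 0
        rw [zero_mul] at h4
        exact h4.mono_left nhdsWithin_le_nhds
      exact h2.eventually_lt_const (abs_pos.2 (φ.lam_ne_zero t))
    obtain ⟨ε, h3, h4⟩ := ((eventually_all.2 h1).and self_mem_nhdsWithin).exists
    exact ⟨ε, h4, h3⟩
  have h1 : ∀ t t', ∀ᶠ s : ℝ in atTop,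
      ‖Complex.I ^ d * scaledForm σ N S s (φ.stringVec s t) (φ.stringVec s t') -
        (if t = t' then (φ.lam t : ℂ) else 0)‖ ≤ ε := by
    intro t t'
    have h2 := φ.tendsto_limitGram t t'
    rw [φ.limitGram_eq] at h2
    filter_upwards [(tendsto_iff_norm_sub_tendsto_zero.1 h2).eventually_lt_const hε] with s hs
    exact hs.le
  obtain ⟨s₀, hs₀⟩ := eventually_atTop.1
    (eventually_all.2 fun t => eventually_all.2 fun t' => h1 t t')
  refine ⟨(max s₀ 0) ^ 2, ε, by positivity, fun z hz => ⟨fun t t' => ?_, hsmall⟩⟩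
  have hz0 : 0 ≤ z.im := (sq_nonneg _).trans hz.le
  rw [h.weilForm_expN (Real.sq_sqrt hz0).symm]
  exact hs₀ _ ((le_max_left _ _).trans (Real.le_sqrt_of_sq_le hz.le)) t t'

/-- A set of basis vectors containing with `N ^ j u_i` all `N ^ m u_i`, `m ≤ j`. -/
def IsLower (A : Finset φ.Idx) : Prop :=
  ∀ i (j m : Fin (φ.l i + 1)), m ≤ j → (⟨i, j⟩ : φ.Idx) ∈ A → (⟨i, m⟩ : φ.Idx) ∈ A

theorem stringVec_mem {A : Finset φ.Idx} (hA : φ.IsLower A) (s : ℝ) {t : φ.Idx} (ht : t ∈ A) :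
    φ.stringVec s t ∈ Submodule.span ℂ (φ.vec '' A) := by
  refine Submodule.sum_mem _ fun m hm => Submodule.smul_mem _ _ (Submodule.smul_mem _ _ ?_)
  have hm' := Finset.mem_range.1 hm
  exact Submodule.subset_span ⟨⟨t.1, ⟨m, by omega⟩⟩, hA t.1 t.2 ⟨m, by omega⟩
    (Fin.le_def.2 (Nat.lt_succ_iff.1 hm')) ht, rfl⟩

theorem finrank_span_vec_le (A : Finset φ.Idx) :
    Module.finrank ℂ (Submodule.span ℂ (φ.vec '' A)) ≤ A.card := by
  classical
  rw [← Finset.coe_image]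
  exact (finrank_span_finset_le_card _).trans Finset.card_image_le

/-- The span of the diagonalizing vectors lies in the image of `span (vec '' A)` because `A` is
lower. It has dimension `card A`, the largest possible, so the two agree; this also gives the linear
independence of the `N^j u_i` in `A`. -/
theorem map_span_facts [FiniteDimensional ℂ H] [DecidableEq φ.Idx] {B : H → H → ℂ}
    (hB : IsHermForm B) {z : ℂ} {lam : φ.Idx → ℝ} {ε s : ℝ}
    (hv : NearDiagonal B (fun t => expN N z (φ.stringVec s t)) lam ε)
    {A : Finset φ.Idx} (hA : φ.IsLower A) :
    Module.finrank ℂ (Submodule.span ℂ (φ.vec '' A)) = A.card ∧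
    NondegOn B ((Submodule.span ℂ (φ.vec '' A)).map (expN N z)) ∧
    posIndex B ((Submodule.span ℂ (φ.vec '' A)).map (expN N z)) =
      (A.filter fun t => 0 < lam t).card ∧
    negIndex B ((Submodule.span ℂ (φ.vec '' A)).map (expN N z)) =
      (A.filter fun t => lam t < 0).card := by
  have h1 := hv.span_facts hB A
  have h2 : Submodule.span ℂ ((fun t => expN N z (φ.stringVec s t)) '' A) ≤
      (Submodule.span ℂ (φ.vec '' A)).map (expN N z) := by
    rw [Submodule.span_le]
    rintro _ ⟨t, ht, rfl⟩
    exact Submodule.mem_map_of_mem (φ.stringVec_mem hA s ht)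
  have h3 : Module.finrank ℂ ((Submodule.span ℂ (φ.vec '' A)).map (expN N z)) =
      Module.finrank ℂ (Submodule.span ℂ (φ.vec '' A)) :=
    (Submodule.equivMapOfInjective _ (expN_injective h.nilpotent z) _).finrank_eq.symm
  have h4 := φ.finrank_span_vec_le A
  have h5 := Submodule.eq_of_le_of_finrank_le h2 (by omega)
  rw [h5] at h1
  exact ⟨by omega, h1.2⟩

theorem finrank_span_vec [FiniteDimensional ℂ H] {A : Finset φ.Idx} (hA : φ.IsLower A) :
    Module.finrank ℂ (Submodule.span ℂ (φ.vec '' A)) = A.card := by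
  classical
  obtain ⟨T, ε, -, hT⟩ := φ.exists_nearDiagonal
  exact (φ.map_span_facts (h.isHermForm (by simp)) (hT ⟨0, T + 1⟩ (by simp)) hA).1

/-- The basis vectors of Hodge level at least `p`. -/
noncomputable def levelSet (p : ℤ) : Finset φ.Idx := Finset.univ.filter fun t => p ≤ φ.deg t

theorem mem_levelSet {p : ℤ} {t : φ.Idx} : t ∈ φ.levelSet p ↔ p ≤ φ.deg t := by
  simp [levelSet]

theorem isLower_levelSet (p : ℤ) : φ.IsLower (φ.levelSet p) := by
  intro i j m hm hj
  rw [mem_levelSet] at hj ⊢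
  simp only [deg] at hj ⊢
  have := Fin.le_def.1 hm
  omega

theorem F_eq_span (p : ℤ) : F p = Submodule.span ℂ (φ.vec '' (φ.levelSet p)) := by
  rw [← φ.levelSpan_eq p, levelSpan, levelSet]
  simp

theorem card_idx [FiniteDimensional ℂ H] : Fintype.card φ.Idx = Module.finrank ℂ H := by
  have h1 := φ.finrank_span_vec (A := Finset.univ) (fun _ _ _ _ _ => Finset.mem_univ _)
  rw [Finset.coe_univ, Set.image_univ, φ.span_vec_eq_top, finrank_top, Finset.card_univ] at h1
  exact h1.symm

end PrimFrame

end Limit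

theorem card_fin_lt (n c : ℕ) (hc : c ≤ n) :
    (Finset.univ.filter fun x : Fin n => (x : ℕ) < c).card = c := by
  have h1 : (Finset.univ.filter fun x : Fin n => (x : ℕ) < c) =
      (Finset.univ : Finset (Fin c)).map (Fin.castLEEmb hc) := by
    ext x
    simp only [Finset.mem_filter, Finset.mem_univ, true_and, Finset.mem_map, Fin.castLEEmb_apply]
    exact ⟨fun hx => ⟨⟨x, hx⟩, rfl⟩, by rintro ⟨y, rfl⟩; exact y.2⟩
  rw [h1, Finset.card_map, Finset.card_univ, Fintype.card_fin]

/-- A lower set of `Fin n` is an initial segment. -/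
theorem exists_eq_filter_lt {n : ℕ} (s : Finset (Fin n)) (hs : IsLowerSet (s : Set (Fin n))) :
    ∃ c ≤ n, s = Finset.univ.filter fun x : Fin n => (x : ℕ) < c := by
  have hc : s.card ≤ n := by simpa using Finset.card_le_univ s
  refine ⟨s.card, hc, ?_⟩
  have h2 := card_fin_lt n s.card hc
  have hl : IsLowerSet
      ((Finset.univ.filter fun x : Fin n => (x : ℕ) < s.card : Finset (Fin n)) : Set (Fin n)) := by
    intro x y hyx hx
    simp only [Finset.coe_filter, Finset.mem_univ, true_and, Set.mem_ofPred_eq] at hx ⊢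
    exact (Fin.le_def.1 hyx).trans_lt hx
  rcases hs.total hl with hle | hle
  · exact Finset.eq_of_subset_of_card_le (by exact_mod_cast hle) h2.le
  · exact (Finset.eq_of_subset_of_card_le (by exact_mod_cast hle) h2.ge).symm

section Orbit

variable {H : Type*} [AddCommGroup H] [Module ℂ H] {d : ℕ} {σ : H →ₛₗ[starRingEnd ℂ] H}
  {W F : ℤ → Submodule ℂ H} {N : Module.End ℂ H} {S : H →ₗ[ℂ] H →ₗ[ℂ] ℂ}
  {h : SituationB d σ W F N S} {I : Type} [Fintype I]

namespace PrimFrame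

variable (φ : PrimFrame h I)

/-! ### The refined filtration -/

theorem exists_fullRefinement [FiniteDimensional ℂ H] :
    ∃ A : ℕ → Finset φ.Idx, (∀ k, φ.IsLower (A k)) ∧
      IsFullRefinement F (Module.finrank ℂ H) fun k => Submodule.span ℂ (φ.vec '' (A k)) := by
  obtain ⟨n, hn⟩ : ∃ n, n = Module.finrank ℂ H := ⟨_, rfl⟩
  rw [← hn]
  let e₀ : Fin n ≃ φ.Idx := (Fintype.equivFinOfCardEq (φ.card_idx.trans hn.symm)).symm
  -- Order the basis by decreasing Hodge level. Since `N` lowers the level strictly, every initial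
  -- segment is lower, and each `levelSet p` is an initial segment.
  let g : Fin n ≃ φ.Idx := (Tuple.sort fun x => -φ.deg (e₀ x)).trans e₀
  have hg : ∀ x y, x ≤ y → φ.deg (g y) ≤ φ.deg (g x) := fun x y hxy =>
    neg_le_neg_iff.1 (Tuple.monotone_sort (fun x => -φ.deg (e₀ x)) hxy)
  let A : ℕ → Finset φ.Idx := fun k =>
    (Finset.univ.filter fun x : Fin n => (x : ℕ) < n - k).map g.toEmbedding
  have hmem : ∀ k t, t ∈ A k ↔ (g.symm t : ℕ) < n - k := by
    intro k t
    simp only [A, Finset.mem_map, Finset.mem_filter, Finset.mem_univ, true_and,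
      Equiv.coe_toEmbedding]
    constructor
    · rintro ⟨x, hx, rfl⟩
      simpa using hx
    · intro ht
      exact ⟨g.symm t, ht, g.apply_symm_apply t⟩
  have hcard : ∀ k, (A k).card = n - k := fun k => by
    rw [Finset.card_map, card_fin_lt n (n - k) (Nat.sub_le _ _)]
  have hlow : ∀ k, φ.IsLower (A k) := by
    intro k i j m hmj hj
    rw [hmem] at hj ⊢
    rcases hmj.eq_or_lt with rfl | hlt
    · exact hj
    · refine lt_of_le_of_lt (Fin.le_def.1 (le_of_not_gt fun hgt => ?_)) hj
      have h1 := hg _ _ hgt.le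
      rw [g.apply_symm_apply, g.apply_symm_apply] at h1
      simp only [deg] at h1
      have := Fin.lt_def.1 hlt
      omega
  have hanti : Antitone fun k => Submodule.span ℂ (φ.vec '' (A k)) := by
    intro k l hkl
    refine Submodule.span_mono (Set.image_mono fun t ht => ?_)
    rw [Finset.mem_coe, hmem] at ht ⊢
    omega
  refine ⟨A, hlow, ⟨hanti, ?_, ?_, ?_, ?_⟩⟩
  · have : A 0 = Finset.univ := by
      ext t
      simp [hmem]
    rw [this, Finset.coe_univ, Set.image_univ, φ.span_vec_eq_top]
  · have : A n = ∅ := by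
      ext t
      simp [hmem]
    simp [this]
  · intro k hk
    have h1 := Submodule.finrank_quotient_add_finrank
      ((Submodule.span ℂ (φ.vec '' (A (k + 1)))).submoduleOf (Submodule.span ℂ (φ.vec '' (A k))))
    have h2 := (Submodule.comapSubtypeEquivOfLe (hanti (Nat.le_succ k))).finrank_eq
    have h3 := φ.finrank_span_vec (hlow k)
    have h4 := φ.finrank_span_vec (hlow (k + 1))
    rw [hcard] at h3 h4
    change Module.finrank ℂ ↥((Submodule.span ℂ (φ.vec '' (A (k + 1)))).submoduleOf _) =
      Module.finrank ℂ (Submodule.span ℂ (φ.vec '' (A (k + 1)))) at h2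
    rw [h2, h3, h4] at h1
    omega
  · intro p
    obtain ⟨c, hc, hs⟩ := exists_eq_filter_lt (Finset.univ.filter fun x : Fin n => p ≤ φ.deg (g x))
      (by
        intro x y hyx hx
        simp only [Finset.coe_filter, Finset.mem_univ, true_and, Set.mem_ofPred_eq] at hx ⊢
        exact hx.trans (hg _ _ hyx))
    refine ⟨n - c, Nat.sub_le _ _, ?_⟩
    have h1 : φ.levelSet p = A (n - c) := by
      ext t
      have h2 := Finset.ext_iff.1 hs (g.symm t)
      simp only [Finset.mem_filter, Finset.mem_univ, true_and, g.apply_symm_apply] at h2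
      rw [mem_levelSet, hmem, h2, Nat.sub_sub_self hc]
    rw [φ.F_eq_span, h1]

/-! ### The Hodge structure `exp (z N) F` -/

end PrimFrame

theorem SituationB.S_expF (h : SituationB d σ W F N S) {z : ℂ} {p q : ℤ} (hpq : p + q = d + 1)
    {u v : H} (hu : u ∈ expF N F z p) (hv : v ∈ expF N F z q) : S u v = 0 := by
  obtain ⟨u, hu, rfl⟩ := hu
  obtain ⟨v, hv, rfl⟩ := hv
  rw [h.S_expN]
  exact h.S_eq_zero_of_F (by omega) hu hv

/-- A vector in `exp(zN)F^p` and in the conjugate of `exp(zN)F^{d-p+1}` is Hermitian-orthogonal to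
`exp(zN)F^p`, hence zero. A vector `S`-orthogonal to both spaces lies in `exp(zN)F^{d-p+1}` by
duality and in the radical there, so their sum is `H`. -/
theorem SituationB.isHodgeStructure_expF [FiniteDimensional ℂ H] (h : SituationB d σ W F N S)
    {z : ℂ} (hnd : ∀ p, NondegOn (weilForm σ S d 0) (expF N F z p)) :
    IsHodgeStructure σ d (expF N F z) := by
  have hS : ∀ p, ∀ x ∈ expF N F z p, (∀ v ∈ expF N F z p, S x (σ v) = 0) → x = 0 := by
    intro p x hx h0
    refine hnd p x hx fun v hv => ?_
    rw [weilForm_apply, h0 v hv, mul_zero]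
  refine ⟨fun p q hpq => Submodule.map_mono (h.mhs.F_anti hpq), ?_, ?_, fun p => ⟨?_, ?_⟩⟩
  · obtain ⟨a, ha⟩ := h.mhs.F_top
    refine ⟨a, ?_⟩
    rw [expF, ha, Submodule.map_top, LinearMap.range_eq_top]
    exact fun u => ⟨expN N (-z) u, by simpa using expN_neg_apply h.nilpotent (-z) u⟩
  · obtain ⟨b, hb⟩ := h.mhs.F_bot
    exact ⟨b, by rw [expF, hb, Submodule.map_bot]⟩
  · rw [Submodule.disjoint_def]
    rintro _ hx ⟨x, hx', rfl⟩
    refine hS p _ hx fun v hv => ?_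
    rw [h.S_real, h.S_expF (by ring) hx' hv, map_zero]
  · rw [codisjoint_iff]
    have h1 := h.finrank_orthogonal (expF N F z p ⊔ (expF N F z (d - p + 1)).map σ)
    have h2 : LinearMap.BilinForm.orthogonal S
        (expF N F z p ⊔ (expF N F z (d - p + 1)).map σ) = ⊥ := by
      rw [eq_bot_iff]
      intro y hy
      rw [h.mem_orthogonal_iff] at hy
      refine hS (d - p + 1) y ?_ fun v hv =>
        hy _ (Submodule.mem_sup_right (Submodule.mem_map_of_mem hv))
      refine ⟨expN N (-z) y, h.mem_F_of_orthogonal fun w hw => ?_, ?_⟩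
      · rw [expN_adjoint h.S_pow, neg_neg]
        exact hy _ (Submodule.mem_sup_left (Submodule.mem_map_of_mem hw))
      · simpa using expN_neg_apply h.nilpotent (-z) y
    rw [h2, finrank_bot] at h1
    have h3 := Submodule.finrank_le (expF N F z p ⊔ (expF N F z (d - p + 1)).map σ)
    exact Submodule.eq_top_of_finrank_eq (by omega)

theorem IsHodgeStructure.component_sup {V : Type*} [AddCommGroup V] [Module ℂ V]
    {σ : V →ₛₗ[starRingEnd ℂ] V} {k : ℤ} {F : ℤ → Submodule ℂ V} (hF : IsHodgeStructure σ k F)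
    (p : ℤ) : component σ F p (k - p) ⊔ F (p + 1) = F p ∧
      component σ F p (k - p) ⊓ F (p + 1) = ⊥ := by
  have h1 := hF.opposed (p + 1)
  have e : k - (p + 1) + 1 = k - p := by ring
  rw [e] at h1
  have hle : F (p + 1) ≤ F p := hF.anti (by omega)
  constructor
  · refine le_antisymm (sup_le inf_le_left hle) fun x hx => ?_
    have h2 : x ∈ F (p + 1) ⊔ (F (k - p)).map σ := by
      rw [h1.sup_eq_top]
      trivial
    obtain ⟨y, hy, w, hw, rfl⟩ := Submodule.mem_sup.1 h2
    rw [sup_comm]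
    refine Submodule.add_mem_sup hy ⟨?_, hw⟩
    have := sub_mem hx (hle hy)
    simpa using this
  · rw [eq_bot_iff, ← h1.inf_eq_bot]
    exact fun x hx => ⟨hx.2, hx.1.2⟩

theorem SituationB.nondegOn_component [FiniteDimensional ℂ H] (h : SituationB d σ W F N S) {z : ℂ}
    (hF : IsHodgeStructure σ d (expF N F z)) {p : ℤ}
    (hnd : NondegOn (weilForm σ S p (d - p)) (expF N F z p)) :
    (∀ x ∈ component σ (expF N F z) p (d - p), ∀ y ∈ expF N F z (p + 1),
      weilForm σ S p (d - p) x y = 0) ∧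
    NondegOn (weilForm σ S p (d - p)) (component σ (expF N F z) p (d - p)) := by
  have hB := h.isHermForm (p := p) (q := d - p) (by ring)
  have horth : ∀ x ∈ component σ (expF N F z) p (d - p), ∀ y ∈ expF N F z (p + 1),
      weilForm σ S p (d - p) x y = 0 := by
    rintro _ ⟨-, x, hx, rfl⟩ y hy
    rw [weilForm_apply, h.S_real, h.S_expF (by ring) hx hy, map_zero, mul_zero]
  refine ⟨horth, fun x hx h0 => hnd x hx.1 fun v hv => ?_⟩
  rw [← (hF.component_sup p).1] at hv
  obtain ⟨y, hy, w, hw, rfl⟩ := Submodule.mem_sup.1 hv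
  rw [hB.add_right, h0 y hy, horth x hx w hw, add_zero]

namespace PrimFrame

variable (φ : PrimFrame h I)

theorem sign_mul_lam {p : ℤ} {t : φ.Idx} (ht : φ.deg t = p) :
    ∃ c : ℝ, 0 < c ∧ (-1 : ℝ) ^ (p - d) * φ.lam t = c * φ.sgn t.1 := by
  refine ⟨(2 : ℝ) ^ (φ.l t.1) * (t.2 : ℕ).factorial *
    (φ.l t.1 - t.2).factorial / ((φ.l t.1).factorial : ℝ) ^ 2, by positivity, ?_⟩
  rw [lam, ht, ← mul_assoc, ← zpow_add₀ (by norm_num)]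
  simp

/-- The component is an orthogonal complement of `F^{p+1}` in `F^p`. Signatures of both steps are
known, and on the vectors of level exactly `p` the sign of the diagonal entry is that of `sgn`. -/
theorem index_component [FiniteDimensional ℂ H] [DecidableEq φ.Idx] {z : ℂ} {ε s : ℝ}
    (hF : IsHodgeStructure σ d (expF N F z))
    (hv : NearDiagonal (weilForm σ S d 0) (fun t => expN N z (φ.stringVec s t)) φ.lam ε) (p : ℤ) :
    NondegOn (weilForm σ S p (d - p)) (component σ (expF N F z) p (d - p)) ∧
    posIndex (weilForm σ S p (d - p)) (component σ (expF N F z) p (d - p)) =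
      (Finset.univ.filter fun t : φ.Idx => φ.deg t = p ∧ 0 < φ.sgn t.1).card ∧
    negIndex (weilForm σ S p (d - p)) (component σ (expF N F z) p (d - p)) =
      (Finset.univ.filter fun t : φ.Idx => φ.deg t = p ∧ φ.sgn t.1 < 0).card := by
  have hB := h.isHermForm (p := p) (q := d - p) (by ring)
  have hv' := hv.sign_mul (sign_abs (p - d))
  rw [← weilForm_eq_sign_mul] at hv'
  have facts := fun q => φ.map_span_facts hB hv' (φ.isLower_levelSet q)
  have hfinF : ∀ q, Module.finrank ℂ (F q) = (φ.levelSet q).card := fun q => by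
    rw [← (facts q).1, ← φ.F_eq_span]
  simp only [← φ.F_eq_span] at facts
  obtain ⟨-, f2, f3, f4⟩ := facts p
  obtain ⟨-, -, g3, g4⟩ := facts (p + 1)
  obtain ⟨horth, hnd⟩ := h.nondegOn_component hF f2
  have hle : expF N F z (p + 1) ≤ expF N F z p := hF.anti (by omega)
  have i1 := hB.posIndex_add_le (C := component σ (expF N F z) p (d - p)) inf_le_left hle horth
  have i2 := hB.negIndex_add_le (C := component σ (expF N F z) p (d - p)) inf_le_left hle horth
  have i3 := hB.posIndex_add_negIndex hnd
  have i4 := IsHermForm.finrank_add_of_disjoint (hF.component_sup p).2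
  rw [(hF.component_sup p).1] at i4
  have hfin : ∀ q, Module.finrank ℂ (expF N F z q) = Module.finrank ℂ (F q) := fun q =>
    (Submodule.equivMapOfInjective _ (expN_injective h.nilpotent z) _).finrank_eq.symm
  rw [hfin, hfin, hfinF, hfinF] at i4
  change _ + posIndex _ ((F (p + 1)).map (expN N z)) ≤ posIndex _ ((F p).map (expN N z)) at i1
  change _ + negIndex _ ((F (p + 1)).map (expN N z)) ≤ negIndex _ ((F p).map (expN N z)) at i2
  rw [f3, g3] at i1
  rw [f4, g4] at i2
  have split : ∀ P Q : φ.Idx → Prop, ∀ [DecidablePred P] [DecidablePred Q],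
      (∀ t, φ.deg t = p → (P t ↔ Q t)) → ((φ.levelSet p).filter P).card =
        ((φ.levelSet (p + 1)).filter P).card +
          (Finset.univ.filter fun t : φ.Idx => φ.deg t = p ∧ Q t).card := by
    intro P Q _ _ hPQ
    rw [← Finset.card_union_of_disjoint]
    · congr 1
      ext t
      simp only [Finset.mem_union, Finset.mem_filter, Finset.mem_univ, true_and, mem_levelSet]
      constructor
      · rintro ⟨h1, h2⟩
        rcases h1.eq_or_lt with heq | hlt
        · exact Or.inr ⟨heq.symm, (hPQ t heq.symm).1 h2⟩
        · exact Or.inl ⟨hlt, h2⟩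
      · rintro (⟨h1, h2⟩ | ⟨h1, h2⟩)
        · exact ⟨by omega, h2⟩
        · exact ⟨h1.ge, (hPQ t h1).2 h2⟩
    · rw [Finset.disjoint_left]
      intro t h1 h2
      have h3 := φ.mem_levelSet.1 (Finset.mem_filter.1 h1).1
      have h4 := (Finset.mem_filter.1 h2).2.1
      omega
  have s1 := split (fun t => 0 < (-1 : ℝ) ^ (p - d) * φ.lam t) (fun t => 0 < φ.sgn t.1)
    (by
      intro t ht
      obtain ⟨c, hc, h1⟩ := φ.sign_mul_lam ht
      rw [h1, mul_pos_iff_of_pos_left hc])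
  have s2 := split (fun t => (-1 : ℝ) ^ (p - d) * φ.lam t < 0) (fun t => φ.sgn t.1 < 0)
    (by
      intro t ht
      obtain ⟨c, hc, h1⟩ := φ.sign_mul_lam ht
      rw [h1, ← neg_pos, ← mul_neg, mul_pos_iff_of_pos_left hc, neg_pos])
  have s3 := split (fun _ => True) (fun _ => True) (fun _ _ => Iff.rfl)
  have s4 : (Finset.univ.filter fun t : φ.Idx => φ.deg t = p ∧ True).card =
      (Finset.univ.filter fun t : φ.Idx => φ.deg t = p ∧ 0 < φ.sgn t.1).card +
        (Finset.univ.filter fun t : φ.Idx => φ.deg t = p ∧ φ.sgn t.1 < 0).card := by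
    rw [← Finset.card_union_of_disjoint]
    · congr 1
      ext t
      have := (φ.sgn_ne t.1).lt_or_gt
      simp only [Finset.mem_union, Finset.mem_filter, Finset.mem_univ, true_and]
      tauto
    · rw [Finset.disjoint_left]
      intro t h1 h2
      exact lt_asymm (Finset.mem_filter.1 h1).2.2 (Finset.mem_filter.1 h2).2.2
  simp only [Finset.filter_true] at s3
  -- Each index is at most the number of level-`p` vectors of that sign, while the indices sum to
  -- the number of all of them; so both bounds are equalities.
  refine ⟨hnd, ?_, ?_⟩ <;> omega

end PrimFrame

end Orbit

/-! ### Counting -/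

theorem finsum_sum_ite_eq {α I : Type*} [Fintype I] (x : I → α) (P : I → Prop) [DecidableEq α]
    [DecidablePred P] : ∑ᶠ a, ∑ i, (if x i = a ∧ P i then 1 else 0 : ℕ) =
      ∑ i, if P i then 1 else 0 := by
  rw [finsum_sum_comm]
  · refine Finset.sum_congr rfl fun i _ => ?_
    rw [finsum_eq_single _ (x i)]
    · simp
    · intro a ha
      exact if_neg fun h => ha h.1.symm
  · intro i _
    refine (Set.finite_singleton (x i)).subset fun a ha => ?_
    by_contra hne
    exact ha (if_neg fun h => hne h.1.symm)

theorem finsum_mem_sum_ite_eq {α I : Type*} [Fintype I] (R : Set α) [DecidablePred (· ∈ R)]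
    (x : I → α) (P : I → Prop) [DecidableEq α] [DecidablePred P] :
    ∑ᶠ a ∈ R, ∑ i, (if x i = a ∧ P i then 1 else 0 : ℕ) =
      ∑ i, if x i ∈ R ∧ P i then 1 else 0 := by
  rw [← finsum_sum_ite_eq x, finsum_mem_def]
  refine finsum_congr fun a => ?_
  by_cases ha : a ∈ R
  · rw [Set.indicator_of_mem ha]
    refine Finset.sum_congr rfl fun i _ => if_congr ?_ rfl rfl
    constructor
    · rintro ⟨rfl, h⟩
      exact ⟨rfl, ha, h⟩
    · rintro ⟨rfl, -, h⟩
      exact ⟨rfl, h⟩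
  · rw [Set.indicator_of_notMem ha]
    refine (Finset.sum_eq_zero fun i _ => if_neg ?_).symm
    rintro ⟨rfl, h, -⟩
    exact ha h

section Counting

variable {I : Type} [Fintype I] {d : ℕ} {a b : I → ℤ} {l : I → ℕ} {P : I → Prop} [DecidablePred P]
  {s : ℤ → ℤ → ℕ}

/-- The sum defining `𝐒_±^{p,k}`, for a function `s` counting indices of type `(a, b)`. -/
theorem finsum_diagonal (hs : ∀ p q, (d : ℤ) ≤ p + q →
      s p q = ∑ i, if a i = p ∧ b i = q ∧ P i then 1 else 0) (hl : ∀ i, a i + b i = d + l i)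
    (p k : ℤ) : ∑ᶠ r ∈ {r : ℤ | max (-(p + k - d)) 0 ≤ r}, s (p + r) (k + r) =
      ∑ i, if b i - a i + p = k ∧ (0 ≤ a i - p ∧ a i - p ≤ l i) ∧ P i then 1 else 0 := by
  -- The range of `r` forces `(p + r) + (k + r) ≥ d`, where `s` is a count. An index of type `(a,
  -- b)` enters only at `r = a - p` and `k = b - r`: the type of `N^r u` is `(p, k)`.
  have h1 : ∀ r ∈ {r : ℤ | max (-(p + k - d)) 0 ≤ r}, s (p + r) (k + r) =
      ∑ i, if a i - p = r ∧ (b i - a i + p = k ∧ P i) then 1 else 0 := by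
    intro r hr
    obtain ⟨h2, h3⟩ := max_le_iff.1 (show max (-(p + k - d)) 0 ≤ r from hr)
    rw [hs _ _ (by omega)]
    refine Finset.sum_congr rfl fun i _ => if_congr ?_ rfl rfl
    constructor
    · rintro ⟨h4, h5, h6⟩
      exact ⟨by omega, by omega, h6⟩
    · rintro ⟨h4, h5, h6⟩
      exact ⟨by omega, by omega, h6⟩
  rw [finsum_mem_congr rfl h1, finsum_mem_sum_ite_eq]
  refine Finset.sum_congr rfl fun i _ => if_congr ?_ rfl rfl
  have := hl i
  constructor
  · rintro ⟨h4, h5, h6⟩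
    obtain ⟨h2, h3⟩ := max_le_iff.1 (show max (-(p + k - d)) 0 ≤ a i - p from h4)
    exact ⟨h5, ⟨h3, by omega⟩, h6⟩
  · rintro ⟨h4, ⟨h5, h6⟩, h7⟩
    exact ⟨max_le (by omega) h5, h4, h7⟩

theorem finsum_finsum_diagonal (hs : ∀ p q, (d : ℤ) ≤ p + q →
      s p q = ∑ i, if a i = p ∧ b i = q ∧ P i then 1 else 0) (hl : ∀ i, a i + b i = d + l i)
    (p : ℤ) : ∑ᶠ k : ℤ, ∑ᶠ r ∈ {r : ℤ | max (-(p + k - d)) 0 ≤ r}, s (p + r) (k + r) =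
      ∑ i, if (0 ≤ a i - p ∧ a i - p ≤ l i) ∧ P i then 1 else 0 := by
  rw [finsum_congr fun k => finsum_diagonal hs hl p k, finsum_sum_ite_eq]

/-- A contributing index has `k = b - (a - p)`; the bounds `0 ≤ a - p ≤ l` give `d - a ≤ k ≤ b`,
hence `0 ≤ k ≤ d`. -/
theorem sum_Icc_diagonal (hs : ∀ p q, (d : ℤ) ≤ p + q →
      s p q = ∑ i, if a i = p ∧ b i = q ∧ P i then 1 else 0) (hl : ∀ i, a i + b i = d + l i)
    (ha : ∀ i, a i ≤ d) (hb : ∀ i, b i ≤ d) (p : ℤ) :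
    ∑ k ∈ Finset.Icc (0 : ℤ) d, ∑ᶠ r ∈ {r : ℤ | max (-(p + k - d)) 0 ≤ r}, s (p + r) (k + r) =
      ∑ i, if (0 ≤ a i - p ∧ a i - p ≤ l i) ∧ P i then 1 else 0 := by
  rw [Finset.sum_congr rfl fun k _ => finsum_diagonal hs hl p k, Finset.sum_comm]
  refine Finset.sum_congr rfl fun i _ => ?_
  have h1 := ha i
  have h2 := hb i
  have h3 := hl i
  split_ifs with h
  · rw [Finset.sum_eq_single (b i - a i + p)]
    · exact if_pos ⟨rfl, h⟩
    · intro k _ hk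
      exact if_neg fun h' => hk h'.1.symm
    · intro hk
      exact absurd (Finset.mem_Icc.2 ⟨by omega, by omega⟩) hk
  · exact Finset.sum_eq_zero fun k _ => if_neg fun h' => h h'.2

/-- Substitute `k = d + l - p`; the condition `l ≥ p - d` is `k ≥ 0`, which follows from `a ≤ d` as
above. -/
theorem finsum_pairs_diagonal (hs : ∀ p q, (d : ℤ) ≤ p + q →
      s p q = ∑ i, if a i = p ∧ b i = q ∧ P i then 1 else 0) (hl : ∀ i, a i + b i = d + l i)
    (ha : ∀ i, a i ≤ d) (p : ℤ) :
    ∑ᶠ x ∈ {x : ℤ × ℤ | p - d ≤ x.1 ∧ max (-x.1) 0 ≤ x.2}, s (p + x.2) (d + x.1 - p + x.2) =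
      ∑ i, if (0 ≤ a i - p ∧ a i - p ≤ l i) ∧ P i then 1 else 0 := by
  classical
  have h1 : ∀ x ∈ {x : ℤ × ℤ | p - d ≤ x.1 ∧ max (-x.1) 0 ≤ x.2},
      s (p + x.2) (d + x.1 - p + x.2) =
        ∑ i, if ((b i - a i + 2 * p - d, a i - p) : ℤ × ℤ) = x ∧ P i then 1 else 0 := by
    rintro ⟨x, r⟩ ⟨hx, hr⟩
    obtain ⟨h2, h3⟩ := max_le_iff.1 hr
    dsimp only at *
    rw [hs _ _ (by omega)]
    refine Finset.sum_congr rfl fun i _ => if_congr ?_ rfl rfl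
    rw [Prod.mk.injEq]
    constructor
    · rintro ⟨h4, h5, h6⟩
      exact ⟨⟨by omega, by omega⟩, h6⟩
    · rintro ⟨⟨h4, h5⟩, h6⟩
      exact ⟨by omega, by omega, h6⟩
  rw [finsum_mem_congr rfl h1, finsum_mem_sum_ite_eq]
  refine Finset.sum_congr rfl fun i _ => if_congr (and_congr_left fun _ => ?_) rfl rfl
  have h2 := ha i
  have h3 := hl i
  constructor
  · rintro ⟨-, h4⟩
    obtain ⟨h5, h6⟩ := max_le_iff.1 h4
    dsimp only at *
    exact ⟨h6, by omega⟩
  · rintro ⟨h4, h5⟩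
    exact ⟨by dsimp only; omega, max_le (by dsimp only; omega) h4⟩

end Counting

/-! ### Numbers of basis vectors of each level, and the polarized case. -/

section Main

variable {H : Type*} [AddCommGroup H] [Module ℂ H] {d : ℕ} {σ : H →ₛₗ[starRingEnd ℂ] H}
  {W F : ℤ → Submodule ℂ H} {N : Module.End ℂ H} {S : H →ₗ[ℂ] H →ₗ[ℂ] ℂ}
  {h : SituationB d σ W F N S} {I : Type} [Fintype I]

namespace PrimFrame

variable (φ : PrimFrame h I)

/-- Each string meets level `p` at most once, at `j = a_i - p`. -/
theorem card_deg_eq (p : ℤ) (P : I → Prop) [DecidablePred P] :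
    (Finset.univ.filter fun t : φ.Idx => φ.deg t = p ∧ P t.1).card =
      ∑ i, if (0 ≤ φ.a i - p ∧ φ.a i - p ≤ φ.l i) ∧ P i then 1 else 0 := by
  rw [Finset.card_filter, Fintype.sum_sigma]
  refine Finset.sum_congr rfl fun i _ => ?_
  simp only [deg]
  split_ifs with hc
  · rw [Finset.sum_eq_single ⟨(φ.a i - p).toNat, by omega⟩]
    · exact if_pos ⟨by dsimp only; omega, hc.2⟩
    · intro j _ hj
      refine if_neg fun h' => hj (Fin.ext ?_)
      dsimp only
      omega
    · simp
  · refine Finset.sum_eq_zero fun j _ => if_neg fun h' => hc ⟨?_, h'.2⟩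
    have := j.2
    omega

theorem a_le (hF : F (d + 1) = ⊥) (i : I) : φ.a i ≤ d := by
  by_contra! hlt
  have h1 := h.mhs.F_anti (show (d : ℤ) + 1 ≤ φ.a i by omega) (φ.u_mem_F i)
  rw [hF, Submodule.mem_bot] at h1
  have h2 := φ.form_self i
  rw [h1] at h2
  simp only [map_zero, mul_zero] at h2
  exact φ.sgn_ne i (by exact_mod_cast h2.symm)

/-- Otherwise the conjugate lift is zero, so `u_i` has weight below `d + l_i` and its form vanishes,
against `sgn_ne`. -/
theorem b_le (hF : F (d + 1) = ⊥) (i : I) : φ.b i ≤ d := by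
  by_contra! hlt
  obtain ⟨x, hx, -, h1⟩ := (φ.isPrimLift i).conj
  have h2 := h.mhs.F_anti (show (d : ℤ) + 1 ≤ φ.b i by omega) hx
  rw [hF, Submodule.mem_bot] at h2
  rw [h2, map_zero, sub_zero] at h1
  have h3 := φ.form_self i
  rw [h.S_weight (by omega) h1 (pow_mem_W h.toSituationA _ le_rfl
    (h.mhs.W_real _ _ (φ.u_mem_W i))), mul_zero] at h3
  exact φ.sgn_ne i (by exact_mod_cast h3.symm)

end PrimFrame

theorem SituationB.isPolarized_iff [FiniteDimensional ℂ H] (h : SituationB d σ W F N S) :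
    h.IsPolarized ↔ N ^ (d + 1) = 0 ∧ ∀ (p : ℤ) (l : ℕ), h.sNeg p (d + l - p) = 0 := by
  constructor
  · rintro ⟨h1, h2⟩
    refine ⟨h1, fun p l => ?_⟩
    obtain ⟨q, hq⟩ : ∃ q, q = (d : ℤ) + l - p := ⟨_, rfl⟩
    have h3 : ∀ k, k = (d : ℤ) + l → Polarizes (grConj σ W h.mhs.W_real k) k
        (fun p => grImage W k (F p)) (h.prim k) (h.grForm k) := by
      rintro _ rfl
      exact h2 l
    have h4 := (h3 (p + q) (by omega)).positive p
    simp only [add_sub_cancel_left] at h4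
    rw [← hq]
    exact IsHermForm.negIndex_eq_zero h4
  · rintro ⟨h1, h2⟩
    -- The isotropy relation is automatic from levels. Positivity is the vanishing of the negative
    -- index, since the primitive form is nondegenerate. The weight `k` is generalized to pass
    -- between `d + l` and `p + q` in dependent types.
    refine ⟨h1, fun l => ?_⟩
    suffices ∀ k, k = (d : ℤ) + l → Polarizes (grConj σ W h.mhs.W_real k) k
        (fun p => grImage W k (F p)) (h.prim k) (h.grForm k) from this _ rfl
    intro k hk
    constructor
    · rintro p _ ⟨-, x, hx, rfl⟩ _ ⟨-, y, hy, rfl⟩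
      change S x ((N ^ (k - d).toNat) y) = 0
      exact h.S_eq_zero_of_F (b := k - p + 1 - (k - d).toNat) (by omega) hx
        (pow_mem_F h.toSituationA _ _ _ hy)
    · intro p
      obtain ⟨q, rfl⟩ : ∃ q, k = p + q := ⟨k - p, by ring⟩
      simp only [add_sub_cancel_left]
      have h3 := h2 p l
      rw [← hk, add_sub_cancel_left] at h3
      exact (h.isHermForm_gr hk).posDef_of_negIndex_eq_zero (h.nondegOn_primComponent hk) h3

theorem SituationB.bigSNeg_eq_zero (h : SituationB d σ W F N S)
    (hneg : ∀ (p : ℤ) (l : ℕ), h.sNeg p (d + l - p) = 0) (p k : ℤ) : h.bigSNeg p k = 0 := by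
  rw [SituationB.bigSNeg]
  refine finsum_mem_eq_zero_of_forall_eq_zero fun r hr => ?_
  obtain ⟨h2, h3⟩ := max_le_iff.1 (show max (-(p + k - d)) 0 ≤ r from hr)
  have := hneg (p + r) (p + k + 2 * r - d).toNat
  convert this using 2
  omega

end Main

end LimitMHS

open LimitMHS in
theorem theorem2p4 {H : Type*} [AddCommGroup H] [Module ℂ H] [FiniteDimensional ℂ H]
    (d : ℕ) (σ : H →ₛₗ[starRingEnd ℂ] H) (W F : ℤ → Submodule ℂ H)
    (N : Module.End ℂ H) (S : H →ₗ[ℂ] H →ₗ[ℂ] ℂ)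
    (h : LimitMHS.SituationB d σ W F N S) :
    -- the refined filtration
    (∃ G : ℕ → Submodule ℂ H,
      LimitMHS.IsFullRefinement F (Module.finrank ℂ H) G ∧
      ∃ T : ℝ, ∀ z : ℂ, T < z.im → ∀ k : ℕ,
        LimitMHS.NondegOn (fun u v => Complex.I ^ d * S u (σ v))
          ((G k).map (LimitMHS.expN N z))) ∧
    -- the signature on the Hodge components of `exp (z N) F`
    (∃ T : ℝ, ∀ z : ℂ, T < z.im →
      LimitMHS.IsHodgeStructure σ d (LimitMHS.expF N F z) ∧
      ∀ p : ℤ,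
        LimitMHS.NondegOn (LimitMHS.weilForm σ S p (d - p))
          (LimitMHS.component σ (LimitMHS.expF N F z) p (d - p)) ∧
        LimitMHS.posIndex (LimitMHS.weilForm σ S p (d - p))
          (LimitMHS.component σ (LimitMHS.expF N F z) p (d - p)) =
            ∑ᶠ k : ℤ, h.bigSPos p k ∧
        LimitMHS.negIndex (LimitMHS.weilForm σ S p (d - p))
          (LimitMHS.component σ (LimitMHS.expF N F z) p (d - p)) =
            ∑ᶠ k : ℤ, h.bigSNeg p k) ∧
    -- the two displayed forms of the sums when `F^0 = H` and `F^{d+1} = 0`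
    (F 0 = ⊤ → F (d + 1) = ⊥ → ∀ p : ℤ,
      (∑ᶠ k : ℤ, h.bigSPos p k = ∑ k ∈ Finset.Icc (0 : ℤ) d, h.bigSPos p k ∧
        ∑ k ∈ Finset.Icc (0 : ℤ) d, h.bigSPos p k =
          ∑ᶠ x ∈ {x : ℤ × ℤ | p - d ≤ x.1 ∧ max (-x.1) 0 ≤ x.2},
            h.sPos (p + x.2) (d + x.1 - p + x.2)) ∧
      (∑ᶠ k : ℤ, h.bigSNeg p k = ∑ k ∈ Finset.Icc (0 : ℤ) d, h.bigSNeg p k ∧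
        ∑ k ∈ Finset.Icc (0 : ℤ) d, h.bigSNeg p k =
          ∑ᶠ x ∈ {x : ℤ × ℤ | p - d ≤ x.1 ∧ max (-x.1) 0 ≤ x.2},
            h.sNeg (p + x.2) (d + x.1 - p + x.2))) ∧
    -- the polarized case
    (h.IsPolarized ↔ N ^ (d + 1) = 0 ∧ ∀ (p : ℤ) (l : ℕ), h.sNeg p (d + l - p) = 0) ∧
    ((∀ (p : ℤ) (l : ℕ), h.sNeg p (d + l - p) = 0) →
      LimitMHS.IsNilpotentOrbit d σ F N S) ∧
    (h.IsPolarized → LimitMHS.IsNilpotentOrbit d σ F N S) := by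
  classical
  obtain ⟨I, _, ⟨φ⟩⟩ := h.exists_primFrame
  obtain ⟨T, ε, -, hT⟩ := φ.exists_nearDiagonal
  have hQ : IsHermForm (weilForm σ S d 0) := h.isHermForm (by simp)
  have hQ' : weilForm σ S d 0 = fun u v => Complex.I ^ d * S u (σ v) := by
    funext u v
    rw [weilForm_apply, sub_zero, zpow_natCast]
  have hsign : ∃ T : ℝ, ∀ z : ℂ, T < z.im → IsHodgeStructure σ d (expF N F z) ∧ ∀ p : ℤ,
      NondegOn (weilForm σ S p (d - p)) (component σ (expF N F z) p (d - p)) ∧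
      posIndex (weilForm σ S p (d - p)) (component σ (expF N F z) p (d - p)) =
        ∑ᶠ k : ℤ, h.bigSPos p k ∧
      negIndex (weilForm σ S p (d - p)) (component σ (expF N F z) p (d - p)) =
        ∑ᶠ k : ℤ, h.bigSNeg p k := by
    refine ⟨T, fun z hz => ?_⟩
    have hF : IsHodgeStructure σ d (expF N F z) := by
      refine h.isHodgeStructure_expF fun p => ?_
      have h1 := (φ.map_span_facts hQ (hT z hz) (φ.isLower_levelSet p)).2.1
      rwa [← φ.F_eq_span] at h1
    refine ⟨hF, fun p => ?_⟩
    obtain ⟨h1, h2, h3⟩ := φ.index_component hF (hT z hz) p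
    refine ⟨h1, ?_, ?_⟩
    · rw [h2, φ.card_deg_eq p fun i => 0 < φ.sgn i]
      exact (finsum_finsum_diagonal φ.sPos_eq φ.add_eq p).symm
    · rw [h3, φ.card_deg_eq p fun i => φ.sgn i < 0]
      exact (finsum_finsum_diagonal φ.sNeg_eq φ.add_eq p).symm
  have horbit : (∀ (p : ℤ) (l : ℕ), h.sNeg p (d + l - p) = 0) → IsNilpotentOrbit d σ F N S := by
    intro hneg
    refine ⟨h.nilpotent, h.N_real, h.S_isom, h.N_F, ?_⟩
    obtain ⟨T, hT⟩ := hsign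
    refine ⟨T, fun z hz => ⟨(hT z hz).1, ⟨?_, ?_⟩⟩⟩
    · intro p u hu v hv
      exact h.S_expF (by ring) hu.2 hv.2
    · intro p u hu hu0
      obtain ⟨h1, -, h3⟩ := (hT z hz).2 p
      -- The signature formula leaves no negative part, and nondegeneracy upgrades this to positive
      -- definiteness on every Hodge component.
      rw [finsum_congr fun k => h.bigSNeg_eq_zero hneg p k, finsum_zero] at h3
      exact (h.isHermForm (by ring)).posDef_of_negIndex_eq_zero h1 h3 u hu.2 hu0
  refine ⟨?_, hsign, ?_, h.isPolarized_iff, horbit, fun hp => horbit (h.isPolarized_iff.1 hp).2⟩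
  · obtain ⟨A, hA, hG⟩ := φ.exists_fullRefinement
    refine ⟨_, hG, T, fun z hz k => ?_⟩
    have h1 := (φ.map_span_facts hQ (hT z hz) (hA k)).2.1
    rwa [hQ'] at h1
  · intro _ hF p
    have ha := φ.a_le hF
    have hb := φ.b_le hF
    refine ⟨⟨?_, ?_⟩, ?_, ?_⟩
    · exact (finsum_finsum_diagonal φ.sPos_eq φ.add_eq p).trans
        (sum_Icc_diagonal φ.sPos_eq φ.add_eq ha hb p).symm
    · exact (sum_Icc_diagonal φ.sPos_eq φ.add_eq ha hb p).trans
        (finsum_pairs_diagonal φ.sPos_eq φ.add_eq ha p).symm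
    · exact (finsum_finsum_diagonal φ.sNeg_eq φ.add_eq p).trans
        (sum_Icc_diagonal φ.sNeg_eq φ.add_eq ha hb p).symm
    · exact (sum_Icc_diagonal φ.sNeg_eq φ.add_eq ha hb p).trans
        (finsum_pairs_diagonal φ.sNeg_eq φ.add_eq ha p).symm
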